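/- Let $q\in\mathbb C\setminus\{0\}$ and $\nu=-q-q^{-1}$. Put $\bar{\mathfrak p}(q)=\infty$ if $q=\pm1$ or if $q$ is not a root of unity, and $\bar{\mathfrak p}(q)=p$ if $q=e^{\pi i p'/p}\ne\pm1$ with coprime $p,p'\in\mathbb Z_{>0}$. Let $\varsigma=(s_1,\dots,s_d)$ be a multiindex of nonnegative integers with $\max\varsigma<\bar{\mathfrak p}(q)$. A $\varsigma$-valenced link diagram consists of $d$ nodes on each of two parallel vertical lines, joined by links in the strip between the lines that do not meet except at nodes, such that $s_i$ link ends lie at the $i$-th node on either side; links are taken up to homotopy. A loop link is a link with both ends at one node. A $(\varsigma,s)$-valenced link pattern is defined in the same way with $d$ nodes on one line, except that exactly $s$ link ends are defects, i.e. they belong to no link and are not enclosed by any link. Let $\mathsf{TL}_\varsigma$ (respectively $\mathsf L_\varsigma^{(s)}$) be the complex vector space with basis the $\varsigma$-valenced link diagrams (respectively $(\varsigma,s)$-valenced link patterns) without loop links, diagrams and patterns with loop links being regarded as zero, and let $\mathsf E_\varsigma$ be the set of all $s\ge0$ with $\mathsf L_\varsigma^{(s)}\neq\{0\}$. For $k<\bar{\mathfrak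 p}(q)$, the Jones-Wenzl projector $P_{(k)}$ is the unique nonzero idempotent of the Temperley-Lieb algebra $\mathsf{TL}_k(\nu)$ with $U_iP_{(k)}=P_{(k)}U_i=0$ for all the standard generators $U_1,\dots,U_{k-1}$. The product of $\mathsf{TL}_\varsigma(\nu)$ and its action on $\mathsf L_\varsigma^{(s)}$ are given by concatenation, in which each node at the interface, of valence $k$ say, is replaced by $P_{(k)}$, each closed loop by the factor $\nu$, each path joining two defects of the link pattern by the factor $0$, and diagrams or patterns with loop links by $0$. The unit is the diagram with $s_i$ parallel links between the $i$-th left and the $i$-th right node, for each $i$. The bilinear form on $\mathsf L_\varsigma^{(s)}$ is defined by reflecting the first link pattern upside down and joining it to the second one, with each node of valence $k$ replaced by $P_{(k)}$, and evaluating each closed loop as $\nu$, each path between a defect of one pattern and a defect of the other as $1$, and each path between two defects of the same pattern as $0$. Let $\operatorname{rad}\mathsf L_\varsigma^{(s)}=\{\alpha\mid(\alpha\,|\,\beta)=0\text{ for all }\beta\in\mathsf L_\varsigma^{(s)}\}$ and $\mathsf Q_\varsigma^{(s)}=\mathsf L_\varsigma^{(s)}/\operatorname{rad}\mathsf L_\varsigma^{(s)}$.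 Then $\mathsf{TL}_\varsigma(\nu)$ is an associative unital algebra, each $\mathsf L_\varsigma^{(s)}$ is a module over it, the action descends to each $\mathsf Q_\varsigma^{(s)}$, and the nonzero modules among the $\mathsf Q_\varsigma^{(s)}$, $s\in\mathsf E_\varsigma$, form the complete set of non-isomorphic simple $\mathsf{TL}_\varsigma(\nu)$-modules: each of them is simple, they are pairwise non-isomorphic for different $s$, and every simple $\mathsf{TL}_\varsigma(\nu)$-module is isomorphic to one of them. -/

import Mathlib

namespace ValencedTL

noncomputable section

open scoped Classical

/-! ### The parameter -/

/-- `𝔭(q)`: the denominator `p` when `q = exp (π i p' / p)` with `p, p' > 0` coprime (it is unique),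
and `∞` when `q` is not a root of unity. -/
def pmin (q : ℂ) : ℕ∞ :=
  sInf {x : ℕ∞ | ∃ p p' : ℕ, 0 < p ∧ 0 < p' ∧ Nat.Coprime p p' ∧
    q = Complex.exp (Real.pi * Complex.I * p' / p) ∧ x = p}

/-- `p̄(q)`: equal to `∞` at `q = ± 1` and to `𝔭(q)` otherwise. -/
def pbar (q : ℂ) : ℕ∞ :=
  if q = 1 ∨ q = -1 then ⊤ else pmin q

/-! ### Link diagrams and link patterns

The nodes on a line are indexed by a linearly ordered type (`Fin n` in the case of `n` nodes);
the order is from top to bottom on a vertical line, and from left to right on a horizontal one.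
A link diagram is recorded by the map sending each node to the other end of its link. -/

section Diagrams

variable {A B C : Type} [LinearOrder A] [LinearOrder B] [LinearOrder C]

/-- The order of the nodes along the boundary of the strip: down the left line, then up the
right line. -/
def Before : A ⊕ B → A ⊕ B → Prop
  | .inl a, .inl a' => a < a'
  | .inl _, .inr _ => True
  | .inr _, .inl _ => False
  | .inr b, .inr b' => b' < b

variable (A B) in
/-- Link diagrams with left nodes `A` and right nodes `B`: pairings of all the nodes by
noncrossing links. -/
@[ext]
structure LinkDiagram where
  mate : A ⊕ B → A ⊕ B
  mate_mate : ∀ x, mate (mate x) = x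
  mate_ne : ∀ x, mate x ≠ x
  planar : ∀ x y, Before x y → Before y (mate x) → ¬ Before (mate x) (mate y)

variable (A) in
/-- Link patterns on the nodes `A` with `s` defects: noncrossing partial pairings such that no
unpaired node (defect; a fixed point of `mate`) lies below a link. -/
@[ext]
structure LinkPattern (s : ℕ) where
  mate : A → A
  mate_mate : ∀ a, mate (mate a) = a
  planar : ∀ a b, a < b → b < mate a → ¬ mate a < mate b
  defect_exposed : ∀ a b, a < b → b < mate a → mate b ≠ b
  card_defects : Nat.card {a : A // mate a = a} = s

instance [Finite A] [Finite B] : Finite (LinkDiagram A B) :=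
  Finite.of_injective LinkDiagram.mate fun _ _ h => LinkDiagram.ext h

instance [Finite A] [Finite B] : Fintype (LinkDiagram A B) := Fintype.ofFinite _

variable (A) in
/-- The unit diagram: each left node is linked to the corresponding right node. -/
def LinkDiagram.id : LinkDiagram A A where
  mate := Sum.swap
  mate_mate := by rintro (a | a) <;> rfl
  mate_ne := by rintro (a | a) <;> simp
  planar := by
    rintro (a | a) (b | b) <;> simp [Before]
    exact le_of_lt

/-- The links of `D : LinkDiagram A B` placed to the left of `E : LinkDiagram B C`, the right
nodes of `D` being identified with the left nodes of `E`. -/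
def concatGraph (D : LinkDiagram A B) (E : LinkDiagram B C) : SimpleGraph (A ⊕ B ⊕ C) :=
  SimpleGraph.fromRel fun x y =>
    (∃ u : A ⊕ B, x = Sum.map id Sum.inl u ∧ y = Sum.map id Sum.inl (D.mate u)) ∨
    (∃ u : B ⊕ C, x = Sum.inr u ∧ y = Sum.inr (E.mate u))

/-- `F` is what remains of the concatenation of `D` and `E` when the loops are removed. -/
def IsConcat (D : LinkDiagram A B) (E : LinkDiagram B C) (F : LinkDiagram A C) : Prop :=
  ∀ x y : A ⊕ C, (concatGraph D E).Reachable (Sum.map id Sum.inr x) (Sum.map id Sum.inr y) ↔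
    y = x ∨ y = F.mate x

/-- The number of loops in the concatenation: connected components that reach no outer node. -/
def concatLoops (D : LinkDiagram A B) (E : LinkDiagram B C) : ℕ :=
  Nat.card {c : (concatGraph D E).ConnectedComponent //
    ∀ x : A ⊕ C, (concatGraph D E).connectedComponentMk (Sum.map id Sum.inr x) ≠ c}

/-- Concatenation of two link diagrams, each loop being replaced by the factor `ν`. There is
exactly one `F` with `IsConcat D E F`. -/
def concat (ν : ℂ) (D : LinkDiagram A B) (E : LinkDiagram B C) : LinkDiagram A C →₀ ℂ :=
  if h : ∃ F, IsConcat D E F then Finsupp.single h.choose (ν ^ concatLoops D E) else 0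

/-- Multiplication of tangles: the bilinear extension of `concat`. -/
def tangleMul (ν : ℂ) :
    (LinkDiagram A B →₀ ℂ) →ₗ[ℂ] (LinkDiagram B C →₀ ℂ) →ₗ[ℂ] (LinkDiagram A C →₀ ℂ) :=
  Finsupp.lift _ ℂ _ fun D => Finsupp.lift _ ℂ _ fun E => concat ν D E

/-- The links of `D : LinkDiagram A B` placed to the left of a link pattern on `B`. -/
def actGraph {s : ℕ} (D : LinkDiagram A B) (α : LinkPattern B s) : SimpleGraph (A ⊕ B) :=
  SimpleGraph.fromRel fun x y =>
    y = D.mate x ∨ ∃ b : B, x = Sum.inr b ∧ y = Sum.inr (α.mate b)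

/-- Two distinct defects of `α` are joined in the concatenation. -/
def HasTurnBack {s : ℕ} (D : LinkDiagram A B) (α : LinkPattern B s) : Prop :=
  ∃ b b' : B, b ≠ b' ∧ α.mate b = b ∧ α.mate b' = b' ∧
    (actGraph D α).Reachable (Sum.inr b) (Sum.inr b')

/-- `β` is the link pattern formed by the concatenation of `D` and `α`, loops being removed. -/
def IsAct {s : ℕ} (D : LinkDiagram A B) (α : LinkPattern B s) (β : LinkPattern A s) : Prop :=
  ∀ a a' : A, (actGraph D α).Reachable (Sum.inl a) (Sum.inl a') ↔ a' = a ∨ a' = β.mate a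

/-- The number of loops: connected components that contain neither a node of the left line nor a
defect of `α`. -/
def actLoops {s : ℕ} (D : LinkDiagram A B) (α : LinkPattern B s) : ℕ :=
  Nat.card {c : (actGraph D α).ConnectedComponent //
    (∀ a : A, (actGraph D α).connectedComponentMk (Sum.inl a) ≠ c) ∧
    (∀ b : B, α.mate b = b → (actGraph D α).connectedComponentMk (Sum.inr b) ≠ c)}

/-- Concatenation of a link diagram with a link pattern: each loop is replaced by the factor `ν`,
each turn-back path by the factor `0`. In the absence of turn-back paths there is exactly one `β`
with `IsAct D α β`. -/
def act (ν : ℂ) {s : ℕ} (D : LinkDiagram A B) (α : LinkPattern B s) : LinkPattern A s →₀ ℂ :=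
  if HasTurnBack D α then 0
  else if h : ∃ β, IsAct D α β then Finsupp.single h.choose (ν ^ actLoops D α) else 0

/-- The action of tangles on link states: the bilinear extension of `act`. -/
def tangleAct (ν : ℂ) (s : ℕ) :
    (LinkDiagram A B →₀ ℂ) →ₗ[ℂ] (LinkPattern B s →₀ ℂ) →ₗ[ℂ] (LinkPattern A s →₀ ℂ) :=
  Finsupp.lift _ ℂ _ fun D => Finsupp.lift _ ℂ _ fun α => act ν D α

/-- The network formed by `α` reflected upside down and joined to `β` from below. -/
def network {s : ℕ} (α β : LinkPattern A s) : SimpleGraph A :=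
  SimpleGraph.fromRel fun a a' => a' = α.mate a ∨ a' = β.mate a

/-- The evaluation of the network of two link patterns: `0` if there is a turn-back path (a path
joining two distinct defects of `α` or two distinct defects of `β`), and otherwise `ν` to the
number of loops (connected components without defects). -/
def evalNetwork (ν : ℂ) {s : ℕ} (α β : LinkPattern A s) : ℂ :=
  if (∃ a a', a ≠ a' ∧ α.mate a = a ∧ α.mate a' = a' ∧ (network α β).Reachable a a') ∨
      (∃ a a', a ≠ a' ∧ β.mate a = a ∧ β.mate a' = a' ∧ (network α β).Reachable a a') then 0
  else ν ^ Nat.card {c : (network α β).ConnectedComponent //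
    ∀ a, α.mate a = a ∨ β.mate a = a → (network α β).connectedComponentMk a ≠ c}

/-- The bilinear form on link states with `s` defects. -/
def linkForm (ν : ℂ) (s : ℕ) :
    (LinkPattern A s →₀ ℂ) →ₗ[ℂ] (LinkPattern A s →₀ ℂ) →ₗ[ℂ] ℂ :=
  Finsupp.lift _ ℂ _ fun α => Finsupp.lift _ ℂ _ fun β => evalNetwork ν α β

end Diagrams

/-! ### Jones-Wenzl projectors -/

/-- The node map of the generator `U` turning back the adjacent nodes `i` and `i + 1`. -/
def genMate (s i : ℕ) (hi : i + 1 < s) : Fin s ⊕ Fin s → Fin s ⊕ Fin s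
  | .inl j => if (j : ℕ) = i then .inl ⟨i + 1, hi⟩
      else if (j : ℕ) = i + 1 then .inl ⟨i, by omega⟩ else .inr j
  | .inr j => if (j : ℕ) = i then .inr ⟨i + 1, hi⟩
      else if (j : ℕ) = i + 1 then .inr ⟨i, by omega⟩ else .inl j

/-- The generator diagram of the Temperley-Lieb algebra on `s` strands turning back the adjacent
nodes `i` and `i + 1` (counted from `0`) on both sides. -/
def gen (s i : ℕ) (hi : i + 1 < s) : LinkDiagram (Fin s) (Fin s) where
  mate := genMate s i hi
  mate_mate := by
    rintro (⟨j, hj⟩ | ⟨j, hj⟩) <;> simp only [genMate] <;> split_ifs <;>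
      simp <;> grind
  mate_ne := by
    rintro (⟨j, hj⟩ | ⟨j, hj⟩) <;> simp only [genMate] <;> split_ifs <;>
      simp <;> omega
  planar := by
    rintro (⟨j, hj⟩ | ⟨j, hj⟩) (⟨k, hk⟩ | ⟨k, hk⟩) <;> simp only [genMate] <;> split_ifs <;>
      simp [Before] <;> omega

/-- The two properties characterizing, among nonzero tangles, the Jones-Wenzl projector of
size `s`. -/
def IsJonesWenzl (ν : ℂ) (s : ℕ) (P : LinkDiagram (Fin s) (Fin s) →₀ ℂ) : Prop :=
  P ≠ 0 ∧ tangleMul ν P P = P ∧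
  ∀ (i : ℕ) (hi : i + 1 < s),
    tangleMul ν (Finsupp.single (gen s i hi) 1) P = 0 ∧
    tangleMul ν P (Finsupp.single (gen s i hi) 1) = 0

/-- The Jones-Wenzl projector of size `s`: the unique tangle with `IsJonesWenzl ν s` (it exists
for `ν = - q - q⁻¹` and `s < p̄(q)`). -/
def jonesWenzl (ν : ℂ) (s : ℕ) : LinkDiagram (Fin s) (Fin s) →₀ ℂ :=
  if h : ∃ P, IsJonesWenzl ν s P then h.choose else 0

/-! ### Valenced nodes

A multiindex is a tuple `ς : Fin d → ℕ`. The link ends at the nodes of valences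
`ς 0, …, ς (d - 1)` are the pairs `(i, k)` with `k < ς i`, ordered lexicographically; the pair
`(i, k)` is the `k`-th of the link ends anchored to the `i`-th node. -/

section Valenced

variable {d : ℕ} (ς : Fin d → ℕ)

/-- The link ends anchored to the nodes of the multiindex `ς`. -/
abbrev Ends : Type := Lex (Σ i : Fin d, Fin (ς i))

/-- The node to which a link end is anchored. -/
def node (x : Ends ς) : Fin d := (ofLex x).1

/-- The inclusion of the ends at the `i`-th left and right nodes. -/
def blockIncl (i : Fin d) : Fin (ς i) ⊕ Fin (ς i) → Ends ς ⊕ Ends ς :=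
  Sum.map (fun k => toLex ⟨i, k⟩) (fun k => toLex ⟨i, k⟩)

/-- The node map of the diagram obtained by stacking diagrams `D 0, D 1, …` vertically. -/
def stackMate (D : ∀ i, LinkDiagram (Fin (ς i)) (Fin (ς i))) : Ends ς ⊕ Ends ς → Ends ς ⊕ Ends ς
  | .inl x => blockIncl ς (ofLex x).1 ((D (ofLex x).1).mate (.inl (ofLex x).2))
  | .inr x => blockIncl ς (ofLex x).1 ((D (ofLex x).1).mate (.inr (ofLex x).2))

theorem stackMate_blockIncl (D : ∀ i, LinkDiagram (Fin (ς i)) (Fin (ς i))) (i : Fin d)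
    (u : Fin (ς i) ⊕ Fin (ς i)) :
    stackMate ς D (blockIncl ς i u) = blockIncl ς i ((D i).mate u) := by
  rcases u with u | u <;> rfl

theorem exists_blockIncl (x : Ends ς ⊕ Ends ς) : ∃ i u, x = blockIncl ς i u := by
  rcases x with x | x
  · exact ⟨(ofLex x).1, .inl (ofLex x).2, rfl⟩
  · exact ⟨(ofLex x).1, .inr (ofLex x).2, rfl⟩

theorem blockIncl_injective (i : Fin d) : Function.Injective (blockIncl ς i) := by
  have h : Function.Injective (fun k : Fin (ς i) => (toLex ⟨i, k⟩ : Ends ς)) := by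
    intro a b hab
    simpa using hab
  exact Function.Injective.sumMap h h

theorem toLex_lt_toLex_iff (i j : Fin d) (u : Fin (ς i)) (v : Fin (ς j)) :
    (toLex ⟨i, u⟩ : Ends ς) < toLex ⟨j, v⟩ ↔ i < j ∨ ∃ h : i = j, h ▸ u < v :=
  Sigma.Lex.lt_def

theorem before_blockIncl (i j : Fin d) (u : Fin (ς i) ⊕ Fin (ς i)) (v : Fin (ς j) ⊕ Fin (ς j)) :
    Before (blockIncl ς i u) (blockIncl ς j v) ↔
      (i < j ∧ u.isLeft) ∨ (j < i ∧ v.isRight) ∨ ∃ h : i = j, Before (h ▸ u) v := by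
  rcases lt_trichotomy i j with h | rfl | h <;> rcases u with u | u <;> rcases v with v | v <;>
    simp only [blockIncl, Before, Sum.map_inl, Sum.map_inr, toLex_lt_toLex_iff] <;>
    simp [*, ne_of_lt, ne_of_gt, not_lt_of_gt]

/-- The diagram obtained by stacking the diagrams `D 0, D 1, …` vertically, from top to bottom. -/
def stack (D : ∀ i, LinkDiagram (Fin (ς i)) (Fin (ς i))) : LinkDiagram (Ends ς) (Ends ς) where
  mate := stackMate ς D
  mate_mate x := by
    obtain ⟨i, u, rfl⟩ := exists_blockIncl ς x
    simp [stackMate_blockIncl, (D i).mate_mate]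
  mate_ne x := by
    obtain ⟨i, u, rfl⟩ := exists_blockIncl ς x
    rw [stackMate_blockIncl]
    exact fun h => (D i).mate_ne u (blockIncl_injective ς i h)
  planar x y := by
    obtain ⟨i, u, rfl⟩ := exists_blockIncl ς x
    obtain ⟨j, v, rfl⟩ := exists_blockIncl ς y
    simp only [stackMate_blockIncl, before_blockIncl]
    rcases lt_trichotomy i j with h | rfl | h
    · generalize (D i).mate u = u'
      generalize (D j).mate v = v'
      rcases u with u | u <;> rcases v with v | v <;> rcases u' with u' | u' <;>
        rcases v' with v' | v' <;> simp [h, h.ne, h.ne', h.not_gt]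
    · simpa using (D i).planar u v
    · generalize (D i).mate u = u'
      generalize (D j).mate v = v'
      rcases u with u | u <;> rcases v with v | v <;> rcases u' with u' | u' <;>
        rcases v' with v' | v' <;> simp [h, h.ne, h.ne', h.not_gt]

/-- The Jones-Wenzl composite projector: the projectors of sizes `ς 0, ς 1, …` stacked
vertically. -/
def compositeProjector (ν : ℂ) : LinkDiagram (Ends ς) (Ends ς) →₀ ℂ :=
  ∑ D : (∀ i, LinkDiagram (Fin (ς i)) (Fin (ς i))),
    (∏ i, jonesWenzl ν (ς i) (D i)) • Finsupp.single (stack ς D) (1 : ℂ)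

/-! ### The valenced Temperley-Lieb algebra -/

/-- The diagram has a loop link, i.e. a link with both ends at the same node. -/
def DiagramLoopLink (D : LinkDiagram (Ends ς) (Ends ς)) : Prop :=
  (∃ x y, D.mate (.inl x) = .inl y ∧ node ς x = node ς y) ∨
  (∃ x y, D.mate (.inr x) = .inr y ∧ node ς x = node ς y)

/-- The pattern has a loop link, i.e. a link with both ends at the same node. -/
def PatternLoopLink {r : ℕ} (α : LinkPattern (Ends ς) r) : Prop :=
  ∃ x, α.mate x ≠ x ∧ node ς (α.mate x) = node ς x

/-- `ς`-valenced link diagrams without loop links. -/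
abbrev ValDiagram : Type := {D : LinkDiagram (Ends ς) (Ends ς) // ¬ DiagramLoopLink ς D}

/-- `(ς, r)`-valenced link patterns without loop links. -/
abbrev ValPattern (r : ℕ) : Type := {α : LinkPattern (Ends ς) r // ¬ PatternLoopLink ς α}

/-- The space `TL_ς` of valenced tangles modulo those containing loop links. -/
abbrev ValTangle : Type := ValDiagram ς →₀ ℂ

/-- The space `L_ς^(r)` of valenced link states modulo those containing loop links. -/
abbrev ValState (r : ℕ) : Type := ValPattern ς r →₀ ℂ

/-- A valenced tangle, each node being split into its link ends. -/
def tangleLift : ValTangle ς →ₗ[ℂ] (LinkDiagram (Ends ς) (Ends ς) →₀ ℂ) :=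
  Finsupp.lmapDomain ℂ ℂ Subtype.val

/-- The valenced tangle obtained by joining the link ends in each node; the diagrams with a loop
link are set to zero. -/
def tangleProj : (LinkDiagram (Ends ς) (Ends ς) →₀ ℂ) →ₗ[ℂ] ValTangle ς :=
  Finsupp.lift _ ℂ _ fun D => if h : ¬ DiagramLoopLink ς D then Finsupp.single ⟨D, h⟩ 1 else 0

/-- A valenced link state, each node being split into its link ends. -/
def stateLift (r : ℕ) : ValState ς r →ₗ[ℂ] (LinkPattern (Ends ς) r →₀ ℂ) :=
  Finsupp.lmapDomain ℂ ℂ Subtype.val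

/-- The valenced link state obtained by joining the link ends in each node; the patterns with a
loop link are set to zero. -/
def stateProj (r : ℕ) : (LinkPattern (Ends ς) r →₀ ℂ) →ₗ[ℂ] ValState ς r :=
  Finsupp.lift _ ℂ _ fun α => if h : ¬ PatternLoopLink ς α then Finsupp.single ⟨α, h⟩ 1 else 0

/-- The product of `TL_ς(ν)`: concatenate, replace each of the nodes in the middle by a
Jones-Wenzl projector box, and set diagrams with loop links to zero. -/
def valMul (ν : ℂ) (T U : ValTangle ς) : ValTangle ς :=
  tangleProj ς (tangleMul ν (tangleMul ν (tangleLift ς T) (compositeProjector ς ν)) (tangleLift ς U))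

/-- The unit of `TL_ς(ν)`. -/
def valOne : ValTangle ς := tangleProj ς (Finsupp.single (LinkDiagram.id (Ends ς)) 1)

/-- The action of `TL_ς(ν)` on the standard module `L_ς^(r)`: concatenate, replace each of the
nodes in the middle by a Jones-Wenzl projector box, and set patterns with loop links to zero. -/
def stdAction (ν : ℂ) (r : ℕ) : ValTangle ς →ₗ[ℂ] Module.End ℂ (ValState ς r) :=
  (LinearMap.compRight ℂ (stateProj ς r)).comp
    ((LinearMap.lcomp ℂ (LinkPattern (Ends ς) r →₀ ℂ) (stateLift ς r)).comp
      ((tangleAct ν r).comp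
        (((tangleMul ν).flip (compositeProjector ς ν)).comp (tangleLift ς))))

theorem stdAction_apply (ν : ℂ) (r : ℕ) (T : ValTangle ς) (α : ValState ς r) :
    stdAction ς ν r T α = stateProj ς r
      (tangleAct ν r (tangleMul ν (tangleLift ς T) (compositeProjector ς ν)) (stateLift ς r α)) :=
  rfl

/-- The bilinear form on `L_ς^(r)`: the form of ordinary link states, each node being replaced by
a projector box. -/
def valForm (ν : ℂ) (r : ℕ) : ValState ς r →ₗ[ℂ] ValState ς r →ₗ[ℂ] ℂ :=
  (linkForm ν r).compl₁₂
    ((tangleAct ν r (compositeProjector ς ν)).comp (stateLift ς r))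
    ((tangleAct ν r (compositeProjector ς ν)).comp (stateLift ς r))

/-- The radical `{α | (α | β) = 0 for all β}` of `L_ς^(r)`. -/
def rad (ν : ℂ) (r : ℕ) : Submodule ℂ (ValState ς r) := LinearMap.ker (valForm ς ν r)

/-- The quotient `Q_ς^(r) = L_ς^(r) / rad L_ς^(r)`. -/
abbrev StdQuotient (ν : ℂ) (r : ℕ) : Type := ValState ς r ⧸ rad ς ν r

/-- `E_ς`: the numbers `r` for which there is a `(ς, r)`-valenced link pattern. -/
def defectSet : Set ℕ := {r | Nonempty (ValPattern ς r)}

/-! ### Modules over the valenced Temperley-Lieb algebra -/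

/-- A (unital) `TL_ς(ν)`-module structure on the vector space `V`: a homomorphism of algebras
`TL_ς(ν) → End V`. -/
def IsTLModule (ν : ℂ) {V : Type*} [AddCommGroup V] [Module ℂ V]
    (ρ : ValTangle ς →ₗ[ℂ] Module.End ℂ V) : Prop :=
  ρ (valOne ς) = 1 ∧ ∀ T U, ρ (valMul ς ν T U) = ρ T * ρ U

variable {ς}

/-- The module is nonzero and has no nonzero proper submodule. -/
def IsSimpleTL {V : Type*} [AddCommGroup V] [Module ℂ V]
    (ρ : ValTangle ς →ₗ[ℂ] Module.End ℂ V) : Prop :=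
  Nontrivial V ∧ ∀ W : Submodule ℂ V, (∀ T, ∀ w ∈ W, ρ T w ∈ W) → W = ⊥ ∨ W = ⊤

/-- The two modules are isomorphic. -/
def IsoTL {V W : Type*} [AddCommGroup V] [Module ℂ V] [AddCommGroup W] [Module ℂ W]
    (ρ : ValTangle ς →ₗ[ℂ] Module.End ℂ V) (σ : ValTangle ς →ₗ[ℂ] Module.End ℂ W) : Prop :=
  ∃ e : V ≃ₗ[ℂ] W, ∀ T v, e (ρ T v) = σ T (e v)

end Valenced

end

end ValencedTL

namespace ValencedTL
open scoped Classical

set_option linter.unusedSectionVars false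

/-! ### Connected components and two-colourings -/

section Colourings

variable {X : Type}

/-! The algebra is cellular in the sense of Graham and Lehrer. Cut along its through-lines, a
diagram becomes a pair of link patterns with equally many defects; conversely `cell` joins two
states α, β with s defects into a tangle. Three facts govern these cells. The cell of (α, β) sends γ
to (β | γ) α (`stdAction_cell`). Cells with fewer than r through-lines annihilate the r-th standard
module (`stdAction_cell_of_lt`). Modulo cells with fewer through-lines, multiplying a cell by T is
acting with T on its left half (`valMul_cell_sub_mem`).

The classification follows, because the cells span (`mem_span_cells`) and the form is symmetric and
invariant under reflection. A vector γ outside the radical has some β with (β | γ) ≠ 0, so the cells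
carry it to every vector, and the quotient is simple. For s < r the cells of level s vanish on the
r-th quotient but not on a nonzero s-th one, which separates the quotients. For a simple module V,
take the least level r at which some cell acts nontrivially, and fix β₀, v₀. Then α ↦ cell(α, β₀) v₀
is a homomorphism onto V, and its kernel is the radical.

The diagram calculus is reduced to matrices. Colour the nodes with two colours and send a diagram to
the 0-1 matrix of the colourings constant on its links. Removing n loops from a concatenation
becomes a factor 2 ^ n, and both n and the diagram can be recovered from the matrix
(`eq_of_smul_colourMatrix`). Thus associativity is that of matrix multiplication, for every ν. Link
patterns with r defects are treated as diagrams with r right nodes, those with a link between right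
nodes counting as zero; the action and the form become products of tangles (`tangleAct_toState`,
`linkForm_toState`). That a planar concatenation exists at all is `exists_isConcat`, a parity
argument.

The projectors come from Wenzl's recursion, whose denominators are quantum integers [k] with k at
most the valence, nonzero below p̄(q). The composite projector P is self-adjoint and idempotent,
kills every diagram presenting a loop link to it, and is the unit plus diagrams with loop links on
both sides. Hence discarding loop links is compatible with products through P, and the bare unit
diagram is a unit. -/

theorem reachable_fromRel_iff (r : X → X → Prop) (x y : X) :
    (SimpleGraph.fromRel r).Reachable x y ↔
      ∀ σ : X → Bool, (∀ u v, r u v → σ u = σ v) → σ x = σ y := by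
  constructor
  · rintro ⟨w⟩ σ hσ
    induction w with
    | nil => rfl
    | cons h _ ih =>
      rw [SimpleGraph.fromRel_adj] at h
      rcases h.2 with h | h
      · exact (hσ _ _ h).trans ih
      · exact (hσ _ _ h).symm.trans ih
  · intro h
    -- The indicator of the component of `x` is constant along the edges, and testing on it gives
    -- reachability.
    have := h (fun z => decide ((SimpleGraph.fromRel r).Reachable x z)) (by
      intro u v huv
      by_cases e : u = v
      · rw [e]
      · have ha : (SimpleGraph.fromRel r).Adj u v := by
          rw [SimpleGraph.fromRel_adj]; exact ⟨e, Or.inl huv⟩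
        simp only [decide_eq_decide]
        exact ⟨fun k => k.trans ha.reachable, fun k => k.trans ha.symm.reachable⟩)
    simpa using this

/-- A colouring constant along the edges is a choice of colour on each component; the components
meeting `S` have it prescribed, the others are free. This is how numbers of loops become exponents
of 2. -/
theorem two_pow_card_components [Finite X] (r : X → X → Prop) (S : Set X) (σ₀ : X → Bool)
    (h₀ : ∀ u v, r u v → σ₀ u = σ₀ v) :
    Nat.card {σ : X → Bool // (∀ u v, r u v → σ u = σ v) ∧ ∀ z ∈ S, σ z = σ₀ z} =
      2 ^ Nat.card {c : (SimpleGraph.fromRel r).ConnectedComponent //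
        ∀ z ∈ S, (SimpleGraph.fromRel r).connectedComponentMk z ≠ c} := by
  have hlift : ∀ σ : X → Bool, (∀ u v, r u v → σ u = σ v) →
      ∀ x y, (SimpleGraph.fromRel r).connectedComponentMk x =
        (SimpleGraph.fromRel r).connectedComponentMk y → σ x = σ y := by
    intro σ hσ x y hxy
    exact (reachable_fromRel_iff r x y).1 (SimpleGraph.ConnectedComponent.eq.1 hxy) σ hσ
  have hrel : ∀ u v, r u v → (SimpleGraph.fromRel r).connectedComponentMk u =
        (SimpleGraph.fromRel r).connectedComponentMk v := by
    intro u v h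
    exact SimpleGraph.ConnectedComponent.eq.2
      ((reachable_fromRel_iff r u v).2 fun σ hσ => hσ u v h)
  have hout : ∀ c : (SimpleGraph.fromRel r).ConnectedComponent,
      (SimpleGraph.fromRel r).connectedComponentMk (Quot.out c) = c := fun c => Quot.out_eq c
  have e : {σ : X → Bool // (∀ u v, r u v → σ u = σ v) ∧ ∀ z ∈ S, σ z = σ₀ z} ≃
      ({c : (SimpleGraph.fromRel r).ConnectedComponent //
        ∀ z ∈ S, (SimpleGraph.fromRel r).connectedComponentMk z ≠ c} → Bool) :=
    { toFun := fun σ c => σ.1 (Quot.out c.1)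
      invFun := fun f => ⟨fun x => if h : ∀ z ∈ S, (SimpleGraph.fromRel r).connectedComponentMk z ≠
          (SimpleGraph.fromRel r).connectedComponentMk x then f ⟨_, h⟩ else σ₀ x, by
        refine ⟨fun u v huv => ?_, fun z hz => ?_⟩
        · have h1 := hrel u v huv
          simp only [h1, h₀ u v huv]
        · exact dif_neg fun h => h z hz rfl⟩
      left_inv := by
        rintro ⟨σ, hσ, hS⟩
        ext x
        simp only
        split_ifs with h
        · exact hlift σ hσ _ _ (hout _)
        · push Not at h
          obtain ⟨z, hz, hzx⟩ := h
          rw [← hlift σ hσ _ _ hzx, ← hlift σ₀ h₀ _ _ hzx, hS z hz]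
      right_inv := by
        intro f
        funext c
        simp only [hout]
        rw [dif_pos c.2] }
  rw [Nat.card_congr e, Nat.card_fun]
  simp

end Colourings

/-! ### Orbits of two involutions -/

section Dihedral

variable {X : Type} {d e : X → X}

/-- The points `x` and `y` lie in the same orbit of the group generated by `d` and `e`. -/
def SameOrbit (d e : X → X) (x y : X) : Prop :=
  ∀ σ : X → Bool, (∀ u, σ (d u) = σ u) → (∀ u, σ (e u) = σ u) → σ x = σ y

theorem SameOrbit.symm {x y : X} (h : SameOrbit d e x y) : SameOrbit d e y x :=
  fun σ h1 h2 => (h σ h1 h2).symm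

theorem SameOrbit.trans {x y z : X} (h : SameOrbit d e x y) (h' : SameOrbit d e y z) :
    SameOrbit d e x z :=
  fun σ h1 h2 => (h σ h1 h2).trans (h' σ h1 h2)

theorem SameOrbit.swap {x y : X} (h : SameOrbit d e x y) : SameOrbit e d x y :=
  fun σ h1 h2 => h σ h2 h1

theorem SameOrbit.left (x y : X) : SameOrbit d e x (d y) ↔ SameOrbit d e x y :=
  ⟨fun h σ h1 h2 => (h σ h1 h2).trans (h1 y), fun h σ h1 h2 => (h σ h1 h2).trans (h1 y).symm⟩

theorem SameOrbit.right (x y : X) : SameOrbit d e x (e y) ↔ SameOrbit d e x y :=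
  ⟨fun h σ h1 h2 => (h σ h1 h2).trans (h2 y), fun h σ h1 h2 => (h σ h1 h2).trans (h2 y).symm⟩

/-- Conjugation by `e` inverts p = `e * d`. On the points p ^ n x with x fixed by `e`, the
involutions therefore act on exponents as n ↦ -n and n ↦ -n - 1. -/
theorem dihedral_zpow_apply {d e : Equiv.Perm X} (hd : d * d = 1)
    (he : e * e = 1) {x : X} (hx : e x = x) (n : ℤ) :
    e (((e * d) ^ n) x) = ((e * d) ^ (-n)) x ∧ d (((e * d) ^ n) x) = ((e * d) ^ (-n - 1)) x := by
  set p := e * d with hp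
  have hpinv : p⁻¹ = d * e := by
    rw [hp, mul_inv_rev, inv_eq_of_mul_eq_one_left hd, inv_eq_of_mul_eq_one_left he]
  have hconj : ∀ n : ℤ, e * p ^ n = p ^ (-n) * e := by
    intro n
    have h1 : e * p * e⁻¹ = p⁻¹ := by
      rw [hpinv, hp, inv_eq_of_mul_eq_one_left he, ← mul_assoc, he, one_mul]
    have h2 : e * p ^ n * e⁻¹ = p ^ (-n) := by
      rw [← conj_zpow, h1, inv_zpow, zpow_neg]
    rw [← h2]; group
  have hen : ∀ n : ℤ, e ((p ^ n) x) = (p ^ (-n)) x := by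
    intro n
    have := congrArg (fun f : Equiv.Perm X => f x) (hconj n)
    simpa [hx] using this
  refine ⟨hen n, ?_⟩
  have h1 : d = e * p := by rw [hp, ← mul_assoc, he, one_mul]
  have h2 : d * p ^ n = e * p ^ (n + 1) := by
    rw [add_comm, zpow_one_add, ← mul_assoc, ← h1]
  have := congrArg (fun f : Equiv.Perm X => f x) h2
  simp only [Equiv.Perm.mul_apply] at this
  rw [this, hen]
  congr 2; ring

theorem SameOrbit.exists_zpow {d e : Equiv.Perm X} (hd : d * d = 1)
    (he : e * e = 1) {x : X} (hx : e x = x) {y : X} (h : SameOrbit d e x y) :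
    ∃ n : ℤ, y = ((e * d) ^ n) x := by
  have hd' : ∀ u, d (d u) = u := fun u => by rw [← Equiv.Perm.mul_apply, hd]; rfl
  have he' : ∀ u, e (e u) = u := fun u => by rw [← Equiv.Perm.mul_apply, he]; rfl
  have := h (fun y => decide (∃ n : ℤ, y = ((e * d) ^ n) x)) (by
      intro u
      simp only [decide_eq_decide]
      constructor
      · rintro ⟨n, hn⟩
        exact ⟨_, by rw [← (dihedral_zpow_apply hd he hx n).2, ← hn, hd']⟩
      · rintro ⟨n, rfl⟩
        exact ⟨_, (dihedral_zpow_apply hd he hx n).2⟩) (by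
      intro u
      simp only [decide_eq_decide]
      constructor
      · rintro ⟨n, hn⟩
        exact ⟨_, by rw [← (dihedral_zpow_apply hd he hx n).1, ← hn, he']⟩
      · rintro ⟨n, rfl⟩
        exact ⟨_, (dihedral_zpow_apply hd he hx n).1⟩)
  simp only [decide_eq_decide] at this
  exact this.1 ⟨0, by simp⟩

/-- With n ↦ p ^ n x the orbit is ℤ/m, and x is the class of 0. A fixed point of `d` solves 2n + 1 ≡
0, which requires m odd; a fixed point of `e` other than x solves 2n ≡ 0 with n ≢ 0, which requires
m even. For either parity there is at most one solution. Geometrically, a path has at most two ends.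
-/
theorem dihedral_fixed_point_unique {d e : Equiv.Perm X} (hd : d * d = 1)
    (he : e * e = 1) {x y z : X} (hx : e x = x) (hy : SameOrbit d e x y)
    (hz : SameOrbit d e x z) (hyx : y ≠ x) (hzx : z ≠ x)
    (fy : d y = y ∨ e y = y) (fz : d z = z ∨ e z = z) : y = z := by
  obtain ⟨n, rfl⟩ := hy.exists_zpow hd he hx
  obtain ⟨k, rfl⟩ := hz.exists_zpow hd he hx
  have hpow := dihedral_zpow_apply hd he hx
  set p := e * d with hp
  let K : AddSubgroup ℤ :=
    { carrier := {n | (p ^ n) x = x}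
      zero_mem' := by simp
      add_mem' := by
        intro a b (ha : _ = _) (hb : _ = _)
        change _ = _
        rw [zpow_add, Equiv.Perm.mul_apply, hb, ha]
      neg_mem' := by
        intro a (ha : _ = _)
        change _ = _
        rw [zpow_neg, Equiv.Perm.inv_eq_iff_eq, ha] }
  obtain ⟨m, hm⟩ := Int.subgroup_cyclic K
  have hK : ∀ n : ℤ, (p ^ n) x = x ↔ m ∣ n := by
    intro n
    rw [← Int.mem_zmultiples_iff, AddSubgroup.zmultiples_eq_closure, ← hm]; rfl
  have heq : ∀ a b : ℤ, (p ^ a) x = (p ^ b) x ↔ m ∣ a - b := by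
    intro a b
    rw [← hK, sub_eq_neg_add, zpow_add, Equiv.Perm.mul_apply, zpow_neg, Equiv.Perm.inv_eq_iff_eq]
  rw [Ne, hK] at hyx hzx
  rw [(hpow _).1, (hpow _).2, heq, heq] at fy fz
  rw [heq]
  -- In the second case 2j is an odd multiple of m, since an even multiple would give m ∣ j.
  have cases_of : ∀ j : ℤ, ¬ m ∣ j → (m ∣ -j - 1 - j ∨ m ∣ -j - j) →
      (∃ a, 2 * j + 1 = m * a) ∨ (∃ a, 2 * j = m * a ∧ a % 2 = 1) := by
    rintro j hj (⟨a, ha⟩ | ⟨a, ha⟩)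
    · left; exact ⟨-a, by linarith⟩
    · right
      refine ⟨-a, by linarith, ?_⟩
      by_contra h
      obtain ⟨b, rfl⟩ : ∃ b, a = 2 * b := ⟨a / 2, by omega⟩
      exact hj ⟨-b, by linarith⟩
  have key : ∀ a b : ℤ, (a - b) % 2 = 0 → 2 * (n - k) = m * (a - b) → m ∣ n - k := by
    intro a b h h'
    obtain ⟨c, hc⟩ : ∃ c, a - b = 2 * c := ⟨(a - b) / 2, by omega⟩
    rw [hc] at h'
    exact ⟨c, by linarith⟩
  have podd : ∀ j a : ℤ, 2 * j + 1 = m * a → m % 2 = 1 ∧ a % 2 = 1 := by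
    intro j a h
    have : (m * a) % 2 = 1 := by omega
    rw [← Int.odd_iff, Int.odd_mul, Int.odd_iff, Int.odd_iff] at this
    exact this
  have peven : ∀ j a : ℤ, 2 * j = m * a → a % 2 = 1 → m % 2 = 0 := by
    intro j a h ha
    have : (m * a) % 2 = 0 := by omega
    rw [← Int.even_iff, Int.even_mul, Int.even_iff, Int.even_iff] at this
    omega
  rcases cases_of n hyx fy with ⟨a, ha⟩ | ⟨a, ha, ha'⟩ <;>
    rcases cases_of k hzx fz with ⟨b, hb⟩ | ⟨b, hb, hb'⟩
  · have := podd n a ha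
    have := podd k b hb
    exact key a b (by omega) (by linarith)
  · have := podd n a ha
    have := peven k b hb hb'
    omega
  · have := podd k b hb
    have := peven n a ha ha'
    omega
  · exact key a b (by omega) (by linarith)

theorem sum_eq_zero_of_fixedPointFree [Fintype X] {O : Finset X} {f : X → X} (w : X → ZMod 2)
    (hf : ∀ u, f (f u) = u) (hO : ∀ u ∈ O, f u ∈ O) (hne : ∀ u ∈ O, w u ≠ 0 → f u ≠ u)
    (hw : ∀ u ∈ O, w (f u) = w u) : ∑ u ∈ O, w u = 0 := by
  refine Finset.sum_involution (fun u _ => f u) ?_ hne hO (fun u _ => hf u)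
  intro u hu
  rw [hw u hu, ← two_mul]
  have : (2 : ZMod 2) = 0 := rfl
  rw [this, zero_mul]

/-- Existence is a parity count on the orbit. If x were its only end, `d` would pair off the whole
orbit, making its size even, while `e` would pair off everything except x, making it odd. -/
theorem existsUnique_fixed_point [Finite X] (hd : Function.Involutive d)
    (he : Function.Involutive e) {x : X} (hx : e x = x) (hx' : d x ≠ x) :
    ∃! y, y ≠ x ∧ SameOrbit d e x y ∧ (d y = y ∨ e y = y) := by
  have := Fintype.ofFinite X
  apply existsUnique_of_exists_of_unique
  · by_contra hcon
    push Not at hcon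
    set O : Finset X := Finset.univ.filter fun y => SameOrbit d e x y with hO
    have hxO : x ∈ O := Finset.mem_filter.2 ⟨Finset.mem_univ _, fun σ _ _ => rfl⟩
    have hmem : ∀ u ∈ O, u ≠ x → d u ≠ u ∧ e u ≠ u := fun u hu hux =>
      hcon u hux (by simpa [hO] using hu)
    have h1 : ∑ u ∈ O, (1 : ZMod 2) = 0 := by
      refine sum_eq_zero_of_fixedPointFree (f := d) _ hd ?_ ?_ (fun _ _ => rfl)
      · intro u hu
        simpa [hO, SameOrbit.left] using hu
      · intro u hu _
        by_cases h : u = x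
        · rwa [h]
        · exact (hmem u hu h).1
    have h2 : ∑ u ∈ O, (if u = x then 0 else 1 : ZMod 2) = 0 := by
      refine sum_eq_zero_of_fixedPointFree (f := e) _ he ?_ ?_ ?_
      · intro u hu
        simpa [hO, SameOrbit.right] using hu
      · intro u hu hw
        exact (hmem u hu (by simpa using hw)).2
      · intro u hu
        have : e u = x ↔ u = x := ⟨fun h => by rw [← he u, h, hx], fun h => by rw [h, hx]⟩
        simp only [this]
    have h3 : ∑ u ∈ O, (if u = x then 1 else 0 : ZMod 2) = 1 := by
      rw [Finset.sum_ite_eq' O x, if_pos hxO]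
    have h4 : ∑ u ∈ O, ((if u = x then 0 else 1 : ZMod 2) + if u = x then 1 else 0) = 0 := by
      refine (Finset.sum_congr rfl fun u _ => ?_).trans h1
      split_ifs <;> rfl
    rw [Finset.sum_add_distrib, h2, h3] at h4
    exact absurd h4 (by decide)
  · rintro y z ⟨h1, h2, h3⟩ ⟨h4, h5, h6⟩
    refine dihedral_fixed_point_unique (d := hd.toPerm) (e := he.toPerm) ?_ ?_ hx h2 h5 h1 h4 h3 h6
    · ext u; exact hd u
    · ext u; exact he u

end Dihedral

/-! ### Existence of the concatenation -/

noncomputable section Concat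

variable {A B C : Type} [LinearOrder A] [LinearOrder B] [LinearOrder C]

/-- The inclusion of the nodes of the left diagram in a concatenation. -/
abbrev embLeft : A ⊕ B → A ⊕ B ⊕ C := Sum.map id Sum.inl

/-- The inclusion of the outer nodes in a concatenation. -/
abbrev embOuter : A ⊕ C → A ⊕ B ⊕ C := Sum.map id Sum.inr

/-- The links of the left diagram of a concatenation. -/
def leftMate (D : LinkDiagram A B) : A ⊕ B ⊕ C → A ⊕ B ⊕ C
  | .inl a => embLeft (D.mate (.inl a))
  | .inr (.inl b) => embLeft (D.mate (.inr b))
  | .inr (.inr c) => .inr (.inr c)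

/-- The links of the right diagram of a concatenation. -/
def rightMate (E : LinkDiagram B C) : A ⊕ B ⊕ C → A ⊕ B ⊕ C
  | .inl a => .inl a
  | .inr u => .inr (E.mate u)

theorem leftMate_embLeft (D : LinkDiagram A B) (u : A ⊕ B) :
    leftMate (C := C) D (embLeft u) = embLeft (D.mate u) := by
  rcases u with u | u <;> rfl

theorem leftMate_involutive (D : LinkDiagram A B) :
    Function.Involutive (leftMate (C := C) D) := by
  rintro (a | b | c)
  · change leftMate D (embLeft _) = _
    rw [leftMate_embLeft, D.mate_mate]; rfl
  · change leftMate D (embLeft _) = _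
    rw [leftMate_embLeft, D.mate_mate]; rfl
  · rfl

theorem rightMate_involutive (E : LinkDiagram B C) :
    Function.Involutive (rightMate (A := A) E) := by
  rintro (a | u)
  · rfl
  · simp [rightMate, E.mate_mate]

theorem embLeft_injective : Function.Injective (embLeft : A ⊕ B → A ⊕ B ⊕ C) :=
  Function.Injective.sumMap Function.injective_id Sum.inl_injective

theorem embOuter_injective : Function.Injective (embOuter : A ⊕ C → A ⊕ B ⊕ C) :=
  Function.Injective.sumMap Function.injective_id Sum.inr_injective

theorem concatGraph_reachable_iff (D : LinkDiagram A B) (E : LinkDiagram B C) (x y : A ⊕ B ⊕ C) :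
    (concatGraph D E).Reachable x y ↔ SameOrbit (leftMate D) (rightMate E) x y := by
  rw [concatGraph, reachable_fromRel_iff]
  constructor
  · intro h σ h1 h2
    refine h σ ?_
    rintro _ _ (⟨u, rfl, rfl⟩ | ⟨u, rfl, rfl⟩)
    · exact (h1 (embLeft u)).symm.trans (congrArg σ (leftMate_embLeft D u))
    · exact (h2 (.inr u)).symm
  · intro h σ h1
    refine h σ ?_ ?_
    · rintro (a | b | c)
      · exact (h1 _ _ (Or.inl ⟨.inl a, rfl, rfl⟩)).symm
      · exact (h1 _ _ (Or.inl ⟨.inr b, rfl, rfl⟩)).symm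
      · rfl
    · rintro (a | u)
      · rfl
      · exact (h1 _ _ (Or.inr ⟨u, rfl, rfl⟩)).symm

/-- A middle node is moved by both involutions, a left outer node is fixed by `rightMate` and a
right outer node by `leftMate`. The ends of the paths are thus exactly the outer nodes. -/
theorem existsUnique_outer_mate [Finite A] [Finite B] [Finite C] (D : LinkDiagram A B)
    (E : LinkDiagram B C) (x : A ⊕ C) :
    ∃! y : A ⊕ C, y ≠ x ∧ SameOrbit (leftMate D) (rightMate E) (embOuter x) (embOuter y) := by
  have hfix : ∀ y : A ⊕ B ⊕ C, leftMate D y = y ∨ rightMate E y = y →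
      ∃ z : A ⊕ C, y = embOuter z := by
    rintro (a | b | c) h
    · exact ⟨.inl a, rfl⟩
    · exfalso
      rcases h with h | h
      · exact D.mate_ne (.inr b) (embLeft_injective h)
      · exact E.mate_ne (.inl b) (Sum.inr_injective h)
    · exact ⟨.inr c, rfl⟩
  have hfix' : ∀ z : A ⊕ C, leftMate D (embOuter z) = embOuter z ∨
      rightMate E (embOuter z) = (embOuter z : A ⊕ B ⊕ C) := by
    rintro (a | c)
    · exact Or.inr rfl
    · exact Or.inl rfl
  have key : ∃! y, y ≠ embOuter x ∧ SameOrbit (leftMate D) (rightMate E) (embOuter x) y ∧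
      (leftMate D y = y ∨ rightMate E y = y) := by
    rcases x with a | c
    · exact existsUnique_fixed_point (leftMate_involutive D) (rightMate_involutive E) rfl
        fun h => D.mate_ne (.inl a) (embLeft_injective h)
    · have := existsUnique_fixed_point (rightMate_involutive (A := A) E) (leftMate_involutive D)
        (x := embOuter (.inr c)) rfl fun h => E.mate_ne (.inr c) (Sum.inr_injective h)
      refine (existsUnique_congr fun y => ?_).1 this
      exact and_congr Iff.rfl (and_congr ⟨SameOrbit.swap, SameOrbit.swap⟩ or_comm)
  obtain ⟨y, ⟨h1, h2, h3⟩, h4⟩ := key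
  obtain ⟨z, rfl⟩ := hfix y h3
  refine ⟨z, ⟨fun h => h1 (by rw [h]), h2⟩, ?_⟩
  rintro w ⟨hw1, hw2⟩
  exact embOuter_injective (h4 _ ⟨fun h => hw1 (embOuter_injective h), hw2, hfix' w⟩)

/-- The number `1` if `x` comes before `y` and `0` otherwise, modulo `2`. -/
def beforeIndicator (x y : A ⊕ B) : ZMod 2 := if Before x y then 1 else 0

/-- The position of a node on the boundary of the strip. -/
def boundaryPosition : A ⊕ B → Lex (A ⊕ Bᵒᵈ) := fun x => toLex (Sum.map id OrderDual.toDual x)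

theorem before_iff (x y : A ⊕ B) : Before x y ↔ boundaryPosition x < boundaryPosition y := by
  rcases x with x | x <;> rcases y with y | y <;> simp [Before, boundaryPosition]

theorem boundaryPosition_injective :
    Function.Injective (boundaryPosition : A ⊕ B → Lex (A ⊕ Bᵒᵈ)) := by
  rintro (x | x) (y | y) h <;> simp_all [boundaryPosition]

/-- If two pairs do not interlace, q and q' are both between p and p' or both outside, so the
numbers of elements of {p, p'} below q and below q' have the same parity. -/
theorem four_indicators_of_noncrossing {L : Type} [LinearOrder L] {p p' q q' : L} (h1 : p ≠ q)
    (h2 : p ≠ q') (h3 : p' ≠ q) (h4 : p' ≠ q')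
    (c : ∀ x x' y y' : L, ((x = p ∧ x' = p') ∨ (x = p' ∧ x' = p)) →
      ((y = q ∧ y' = q') ∨ (y = q' ∧ y' = q)) →
      ¬ (x < y ∧ y < x' ∧ x' < y') ∧ ¬ (y < x ∧ x < y' ∧ y' < x')) :
    (((if p < q then 1 else 0) + if p' < q then 1 else 0) +
      ((if p < q' then 1 else 0) + if p' < q' then 1 else 0) : ZMod 2) = 0 := by
  have c1 := c p p' q q' (by simp) (by simp)
  have c2 := c p' p q q' (by simp) (by simp)
  have c3 := c p p' q' q (by simp) (by simp)
  have c4 := c p' p q' q (by simp) (by simp)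
  clear c
  split_ifs <;> first | rfl | (exfalso; grind)

theorem LinkDiagram.four_beforeIndicators (D : LinkDiagram A B) {x y : A ⊕ B} (h : y ≠ x)
    (h' : y ≠ D.mate x) :
    (beforeIndicator x y + beforeIndicator (D.mate x) y) +
      (beforeIndicator x (D.mate y) + beforeIndicator (D.mate x) (D.mate y)) = 0 := by
  simp only [beforeIndicator, before_iff]
  have hinj : ∀ u v : A ⊕ B, u ≠ v → boundaryPosition u ≠ boundaryPosition v :=
    fun u v huv h => huv (boundaryPosition_injective h)
  have hm : ∀ u v, D.mate u = v ↔ D.mate v = u := fun u v =>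
    ⟨fun h => by rw [← h, D.mate_mate], fun h => by rw [← h, D.mate_mate]⟩
  apply four_indicators_of_noncrossing
  · exact hinj _ _ h.symm
  · exact hinj _ _ fun k => h' (by rw [k, D.mate_mate])
  · exact hinj _ _ h'.symm
  · exact hinj _ _ fun k => h (by rw [← D.mate_mate x, k, D.mate_mate])
  · have hp : ∀ u v : A ⊕ B, ¬ (boundaryPosition u < boundaryPosition v ∧
        boundaryPosition v < boundaryPosition (D.mate u) ∧
        boundaryPosition (D.mate u) < boundaryPosition (D.mate v)) := by
      rintro u v ⟨k1, k2, k3⟩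
      exact D.planar u v ((before_iff _ _).2 k1) ((before_iff _ _).2 k2) ((before_iff _ _).2 k3)
    have := hp
    rintro _ _ _ _ (⟨rfl, rfl⟩ | ⟨rfl, rfl⟩) (⟨rfl, rfl⟩ | ⟨rfl, rfl⟩)
    · exact ⟨hp x y, hp y x⟩
    · have h1 := hp x (D.mate y)
      have h2 := hp (D.mate y) x
      simp only [D.mate_mate] at h1 h2
      exact ⟨h1, h2⟩
    · have h1 := hp (D.mate x) y
      have h2 := hp y (D.mate x)
      simp only [D.mate_mate] at h1 h2
      exact ⟨h1, h2⟩
    · have h1 := hp (D.mate x) (D.mate y)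
      have h2 := hp (D.mate y) (D.mate x)
      simp only [D.mate_mate] at h1 h2
      exact ⟨h1, h2⟩

/-- The indicator of the boundary order of the left strip of a concatenation. -/
def leftIndicator : A ⊕ B ⊕ C → A ⊕ B ⊕ C → ZMod 2
  | .inl a, .inl a' => beforeIndicator (B := B) (.inl a) (.inl a')
  | .inl a, .inr (.inl b) => beforeIndicator (.inl a) (.inr b)
  | .inr (.inl b), .inl a => beforeIndicator (.inr b) (.inl a)
  | .inr (.inl b), .inr (.inl b') => beforeIndicator (A := A) (.inr b) (.inr b')
  | .inr (.inr _), _ => 0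
  | _, .inr (.inr _) => 0

/-- The indicator of the boundary order of the right strip of a concatenation. -/
def rightIndicator : A ⊕ B ⊕ C → A ⊕ B ⊕ C → ZMod 2
  | .inr u, .inr v => beforeIndicator u v
  | .inl _, _ => 0
  | _, .inl _ => 0

/-- The indicator of the outer boundary order of a concatenation. -/
def outerIndicator : A ⊕ B ⊕ C → A ⊕ B ⊕ C → ZMod 2
  | .inl a, .inl a' => beforeIndicator (B := C) (.inl a) (.inl a')
  | .inl a, .inr (.inr c) => beforeIndicator (.inl a) (.inr c)
  | .inr (.inr c), .inl a => beforeIndicator (.inr c) (.inl a)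
  | .inr (.inr c), .inr (.inr c') => beforeIndicator (A := A) (.inr c) (.inr c')
  | .inr (.inl _), _ => 0
  | _, .inr (.inl _) => 0

/-- The indicator of the nodes of the left strip. -/
def leftWeight : A ⊕ B ⊕ C → ZMod 2
  | .inr (.inr _) => 0
  | _ => 1

/-- The indicator of the nodes of the right strip. -/
def rightWeight : A ⊕ B ⊕ C → ZMod 2
  | .inl _ => 0
  | _ => 1

/-- The two strips traverse the middle line in opposite directions, so for distinct middle nodes the
left and right indicators add up to 1, which the last term cancels; that term also supplies the
order of left before right outer nodes. Its product form lets the double sum over two paths factor.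
-/
theorem outerIndicator_eq {u v : A ⊕ B ⊕ C} (h : u ≠ v) :
    outerIndicator u v = leftIndicator u v + rightIndicator u v + leftWeight u * rightWeight v := by
  have h2 : (1 + 1 : ZMod 2) = 0 := rfl
  rcases u with a | b | c <;> rcases v with a' | b' | c' <;>
    simp [outerIndicator, leftIndicator, rightIndicator, leftWeight, rightWeight, beforeIndicator,
      Before, h2]
  · congr
  swap
  · congr
  rcases lt_trichotomy b b' with hb | rfl | hb
  · simp [hb, hb.not_gt, h2]
  · exact absurd rfl h
  · simp [hb, hb.not_gt, h2]

/-- The terms cancel in blocks of four, {u, d u} × {v, d v}; the points fixed by `d` contribute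
nothing. -/
theorem double_sum_eq_zero_of_involution {X : Type} {O₁ O₂ : Finset X} {d : X → X}
    (hd : Function.Involutive d) (w : X → X → ZMod 2) (h₁ : ∀ u ∈ O₁, d u ∈ O₁)
    (h₂ : ∀ u ∈ O₂, d u ∈ O₂) (hl : ∀ u v, d u = u → w u v = 0) (hr : ∀ u v, d v = v → w u v = 0)
    (hw : ∀ u ∈ O₁, ∀ v ∈ O₂, (w u v + w (d u) v) + (w u (d v) + w (d u) (d v)) = 0) :
    ∑ u ∈ O₁, ∑ v ∈ O₂, w u v = 0 := by
  refine Finset.sum_involution (fun u _ => d u) ?_ ?_ h₁ (fun u _ => hd u)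
  · intro u hu
    rw [← Finset.sum_add_distrib]
    refine Finset.sum_involution (fun v _ => d v) (fun v hv => hw u hu v hv) ?_ h₂
      (fun v _ => hd v)
    intro v _ h k
    exact h (by rw [hr _ _ k, hr _ _ k, add_zero])
  · intro u _ h k
    exact h (Finset.sum_eq_zero fun v _ => hl _ _ k)

theorem sum_leftIndicator {O₁ O₂ : Finset (A ⊕ B ⊕ C)} (D : LinkDiagram A B)
    (h : Disjoint O₁ O₂) (h₁ : ∀ u ∈ O₁, leftMate D u ∈ O₁) (h₂ : ∀ u ∈ O₂, leftMate D u ∈ O₂) :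
    ∑ u ∈ O₁, ∑ v ∈ O₂, leftIndicator u v = 0 := by
  have hfix : ∀ u : A ⊕ B, leftMate (C := C) D (embLeft u) ≠ embLeft u := fun u hu =>
    D.mate_ne u (embLeft_injective ((leftMate_embLeft D u).symm.trans hu))
  have hI : ∀ x y : A ⊕ B, leftIndicator (C := C) (embLeft x) (embLeft y) =
      beforeIndicator x y := by
    rintro (x | x) (y | y) <;> rfl
  have hcase : ∀ u : A ⊕ B ⊕ C, (∃ x : A ⊕ B, u = embLeft x) ∨ ∃ c, u = .inr (.inr c) := by
    rintro (a | b | c)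
    · exact Or.inl ⟨.inl a, rfl⟩
    · exact Or.inl ⟨.inr b, rfl⟩
    · exact Or.inr ⟨c, rfl⟩
  have hl : ∀ (c : C) (v : A ⊕ B ⊕ C), leftIndicator (.inr (.inr c)) v = 0 := fun _ _ => rfl
  have hr : ∀ (c : C) (v : A ⊕ B ⊕ C), leftIndicator v (.inr (.inr c)) = 0 := by
    rintro c (a | b | c') <;> rfl
  refine double_sum_eq_zero_of_involution (leftMate_involutive D) _ h₁ h₂ ?_ ?_ ?_
  · intro u v hu
    rcases hcase u with ⟨x, rfl⟩ | ⟨c, rfl⟩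
    · exact absurd hu (hfix x)
    · exact hl _ _
  · intro u v hu
    rcases hcase v with ⟨x, rfl⟩ | ⟨c, rfl⟩
    · exact absurd hu (hfix x)
    · exact hr _ _
  · intro u hu v hv
    have hne : ∀ a ∈ O₁, a ≠ v := fun a ha hav => Finset.disjoint_left.1 h ha (hav ▸ hv)
    rcases hcase u with ⟨x, rfl⟩ | ⟨c, rfl⟩
    · rcases hcase v with ⟨y, rfl⟩ | ⟨c, rfl⟩
      · have k1 := hne _ hu
        have k2 := hne _ (h₁ _ hu)
        rw [leftMate_embLeft] at k2
        rw [leftMate_embLeft, leftMate_embLeft, hI, hI, hI, hI]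
        exact D.four_beforeIndicators (fun k => k1 (by rw [k])) (fun k => k2 (by rw [k]))
      · have : leftMate (C := C) D (.inr (.inr c)) = .inr (.inr c) := rfl
        rw [this, hr, hr]; rfl
    · have : leftMate (C := C) D (.inr (.inr c)) = .inr (.inr c) := rfl
      rw [this, hl, hl]; rfl

theorem sum_rightIndicator {O₁ O₂ : Finset (A ⊕ B ⊕ C)} (E : LinkDiagram B C)
    (h : Disjoint O₁ O₂) (h₁ : ∀ u ∈ O₁, rightMate E u ∈ O₁)
    (h₂ : ∀ u ∈ O₂, rightMate E u ∈ O₂) :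
    ∑ u ∈ O₁, ∑ v ∈ O₂, rightIndicator u v = 0 := by
  have hl : ∀ (a : A) (v : A ⊕ B ⊕ C), rightIndicator (.inl a) v = 0 := by
    rintro a (v | v) <;> rfl
  have hr : ∀ (a : A) (v : A ⊕ B ⊕ C), rightIndicator v (.inl a) = 0 := by
    rintro a (v | v) <;> rfl
  refine double_sum_eq_zero_of_involution (rightMate_involutive E) _ h₁ h₂ ?_ ?_ ?_
  · rintro (a | x) v hu
    · exact hl _ _
    · exact absurd (Sum.inr_injective hu) (E.mate_ne x)
  · rintro u (a | x) hv
    · exact hr _ _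
    · exact absurd (Sum.inr_injective hv) (E.mate_ne x)
  · intro u hu v hv
    have hne : ∀ a ∈ O₁, a ≠ v := fun a ha hav => Finset.disjoint_left.1 h ha (hav ▸ hv)
    rcases u with a | x
    · have : rightMate E (.inl a : A ⊕ B ⊕ C) = .inl a := rfl
      rw [this, hl, hl]; rfl
    · rcases v with a | y
      · have : rightMate E (.inl a : A ⊕ B ⊕ C) = .inl a := rfl
        rw [this, hr, hr]; rfl
      · have k1 := hne _ hu
        have k2 := hne _ (h₁ _ hu)
        exact E.four_beforeIndicators (fun k => k1 (by rw [k])) (fun k => k2 (by rw [k]; rfl))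

/-- Outer nodes are paired as the two ends of a path. For planarity, the outer indicator is summed
modulo 2 over pairs of nodes of two disjoint paths. The left and right parts vanish because the two
given diagrams are planar, and the product part vanishes because a path has an even number of nodes
in the left strip. Only the ends of the paths contribute to the total, and crossing ends would make
it odd. -/
theorem exists_isConcat [Finite A] [Finite B] [Finite C] (D : LinkDiagram A B)
    (E : LinkDiagram B C) : ∃ F, IsConcat D E F := by
  have := Fintype.ofFinite A
  have := Fintype.ofFinite B
  have := Fintype.ofFinite C
  have hex := existsUnique_outer_mate D E
  choose m hm hu using hex
  have hmm : ∀ x, m (m x) = x := fun x =>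
    (hu (m x) x ⟨(hm x).1.symm, (hm x).2.symm⟩).symm
  have hiff : ∀ x y, SameOrbit (leftMate D) (rightMate E) (embOuter x) (embOuter y) ↔
      y = x ∨ y = m x := by
    intro x y
    constructor
    · intro h
      by_cases hyx : y = x
      · exact Or.inl hyx
      · exact Or.inr (hu x y ⟨hyx, h⟩)
    · rintro (rfl | rfl)
      · exact fun σ _ _ => rfl
      · exact (hm x).2
  refine ⟨⟨m, hmm, fun x => (hm x).1, ?_⟩, fun x y => ?_⟩
  · intro x y h1 h2 h3
    have hirr : ∀ u : A ⊕ C, ¬ Before u u := fun u hu => by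
      rw [before_iff] at hu; exact lt_irrefl _ hu
    have hyx : y ≠ x := by rintro rfl; exact hirr _ h1
    have hymx : y ≠ m x := by rintro rfl; exact hirr _ h2
    set O : A ⊕ C → Finset (A ⊕ B ⊕ C) := fun x =>
      Finset.univ.filter fun v => SameOrbit (leftMate D) (rightMate E) (embOuter x) v with hO
    have hmem : ∀ x v, v ∈ O x ↔ SameOrbit (leftMate D) (rightMate E) (embOuter x) v := by
      simp [hO]
    have hdisj : Disjoint (O x) (O y) := by
      rw [Finset.disjoint_left]
      intro v hv hv'
      rw [hmem] at hv hv'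
      rcases (hiff x y).1 (hv.trans hv'.symm) with h | h
      · exact hyx h
      · exact hymx h
    have hL : ∀ x, ∀ u ∈ O x, leftMate D u ∈ O x := fun x u hu => by
      rw [hmem] at hu ⊢; exact (SameOrbit.left _ _).2 hu
    have hR : ∀ x, ∀ u ∈ O x, rightMate E u ∈ O x := fun x u hu => by
      rw [hmem] at hu ⊢; exact (SameOrbit.right _ _).2 hu
    have hwt : ∑ u ∈ O x, (leftWeight u : ZMod 2) = 0 := by
      refine sum_eq_zero_of_fixedPointFree _ (leftMate_involutive D) (hL x) ?_ ?_
      · rintro (a | b | c) - hw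
        · exact fun h => D.mate_ne (.inl a) (embLeft_injective h)
        · exact fun h => D.mate_ne (.inr b) (embLeft_injective h)
        · exact absurd rfl hw
      · have : ∀ z : A ⊕ B, leftWeight (C := C) (embLeft z) = 1 := by rintro (z | z) <;> rfl
        rintro (a | b | c) -
        · exact this _
        · exact this _
        · rfl
    have htot : ∑ u ∈ O x, ∑ v ∈ O y, outerIndicator u v = 0 := by
      have : ∀ u ∈ O x, ∑ v ∈ O y, outerIndicator u v =
          ∑ v ∈ O y, leftIndicator u v + ∑ v ∈ O y, rightIndicator u v +
            leftWeight u * ∑ v ∈ O y, rightWeight v := by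
        intro u hu
        rw [Finset.mul_sum, ← Finset.sum_add_distrib, ← Finset.sum_add_distrib]
        refine Finset.sum_congr rfl fun v hv => outerIndicator_eq ?_
        rintro rfl
        exact Finset.disjoint_left.1 hdisj hu hv
      rw [Finset.sum_congr rfl this, Finset.sum_add_distrib, Finset.sum_add_distrib,
        sum_leftIndicator D hdisj (hL x) (hL y), sum_rightIndicator E hdisj (hR x) (hR y),
        ← Finset.sum_mul, hwt]
      simp
    have hsub : ∀ (x : A ⊕ C) (f : A ⊕ B ⊕ C → ZMod 2), (∀ b, f (.inr (.inl b)) = 0) →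
        ∑ v ∈ O x, f v = f (embOuter x) + f (embOuter (m x)) := by
      intro x f hf
      rw [← Finset.sum_pair (f := f) (fun h => (hm x).1 (embOuter_injective h).symm)]
      symm
      refine Finset.sum_subset ?_ ?_
      · intro v hv
        rw [hmem]
        rcases Finset.mem_insert.1 hv with rfl | hv
        · exact fun σ _ _ => rfl
        · rw [Finset.mem_singleton.1 hv]
          exact (hm x).2
      · intro v hv hv'
        rw [hmem] at hv
        have hout : ∀ z : A ⊕ C, v = embOuter z → f v = 0 := by
          rintro z rfl
          rcases (hiff x z).1 hv with rfl | rfl <;> simp at hv'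
        rcases v with a | b | c
        · exact hout (.inl a) rfl
        · exact hf b
        · exact hout (.inr c) rfl
    have hI : ∀ x y : A ⊕ C, outerIndicator (B := B) (embOuter x) (embOuter y) =
        beforeIndicator x y := by
      rintro (x | x) (y | y) <;> rfl
    have hz1 : ∀ (b : B) (v : A ⊕ B ⊕ C), outerIndicator (.inr (.inl b)) v = 0 := fun _ _ => rfl
    have hz2 : ∀ (b : B) (v : A ⊕ B ⊕ C), outerIndicator v (.inr (.inl b)) = 0 := by
      rintro b (a | b' | c) <;> rfl
    rw [hsub x _ (fun b => Finset.sum_eq_zero fun v _ => hz1 b v), hsub y _ (fun b => hz2 b _),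
      hsub y _ (fun b => hz2 b _), hI, hI, hI, hI] at htot
    have t : ∀ u v : A ⊕ C, Before u v → beforeIndicator u v = 1 ∧ beforeIndicator v u = 0 := by
      intro u v huv
      refine ⟨if_pos huv, if_neg ?_⟩
      rw [before_iff] at huv ⊢
      exact huv.not_gt
    have h4 : Before x (m y) := by
      rw [before_iff] at *
      exact h1.trans (h2.trans h3)
    -- With x, y, m x, m y in this order the four indicators are 1, 1, 0, 1, of sum 1 modulo 2.
    rw [(t _ _ h1).1, (t _ _ h4).1, (t _ _ h2).2, (t _ _ h3).1] at htot
    exact absurd htot (by decide)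
  · change (concatGraph D E).Reachable (embOuter x) (embOuter y) ↔ _
    rw [concatGraph_reachable_iff]
    exact hiff x y

end Concat

/-! ### Two-colourings as a faithful test for diagrams, and the Temperley-Lieb category. -/

noncomputable section Matrices

variable {A B C K : Type} [LinearOrder A] [LinearOrder B] [LinearOrder C] [LinearOrder K]

/-! ### The colouring matrix of a link diagram -/

/-- The colourings `σ` of the left nodes and `τ` of the right nodes are constant on the links. -/
def Compatible (D : LinkDiagram A B) (σ : A → Bool) (τ : B → Bool) : Prop :=
  ∀ x, Sum.elim σ τ (D.mate x) = Sum.elim σ τ x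

/-- The matrix of the compatible pairs of colourings. -/
def colourMatrix (D : LinkDiagram A B) : Matrix (A → Bool) (B → Bool) ℕ :=
  Matrix.of fun σ τ => if Compatible D σ τ then 1 else 0

theorem colourMatrix_apply (D : LinkDiagram A B) (σ : A → Bool) (τ : B → Bool) :
    colourMatrix D σ τ = if Compatible D σ τ then 1 else 0 := rfl

/-- The test colouring is the indicator of the single link at `x`; it lets the diagram be read off
from its compatible colourings. -/
theorem LinkDiagram.exists_compatible_indicator (D : LinkDiagram A B) (x : A ⊕ B) :
    ∃ σ τ, Compatible D σ τ ∧ ∀ y, Sum.elim σ τ y = true ↔ y = x ∨ y = D.mate x := by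
  set f : A ⊕ B → Bool := fun y => decide (y = x ∨ y = D.mate x) with hf
  have hfe : Sum.elim (fun a => f (.inl a)) (fun b => f (.inr b)) = f := by
    funext y; rcases y with y | y <;> rfl
  refine ⟨fun a => f (.inl a), fun b => f (.inr b), fun y => ?_, fun y => ?_⟩
  · rw [hfe]
    simp only [hf, decide_eq_decide]
    have : ∀ u v, D.mate u = v ↔ u = D.mate v := fun u v =>
      ⟨fun h => by rw [← h, D.mate_mate], fun h => by rw [h, D.mate_mate]⟩
    rw [this, this, D.mate_mate, or_comm]
  · rw [hfe]
    simp [hf]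

theorem LinkDiagram.eq_of_compatible {D E : LinkDiagram A B}
    (h : ∀ σ τ, Compatible D σ τ → Compatible E σ τ) : D = E := by
  ext1
  funext x
  obtain ⟨σ, τ, h1, h2⟩ := D.exists_compatible_indicator x
  have h3 := h σ τ h1 x
  rw [(h2 x).2 (Or.inl rfl), h2] at h3
  exact (h3.resolve_left (E.mate_ne x)).symm

theorem colourMatrix_const (D : LinkDiagram A B) :
    colourMatrix D (fun _ => false) (fun _ => false) = 1 := by
  rw [colourMatrix_apply, if_pos]
  intro x
  rcases x with x | x <;> rcases D.mate _ with y | y <;> rfl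

/-- Every colouring matrix has entry 1 at the constant colourings, so the power of 2 is read off
there; the support then determines the diagram. Identities between diagrams, loop counts included,
can therefore be checked on matrices. -/
theorem eq_of_smul_colourMatrix {D E : LinkDiagram A B} {m n : ℕ}
    (h : 2 ^ m • colourMatrix D = 2 ^ n • colourMatrix E) : m = n ∧ D = E := by
  have hmn : m = n := by
    have := congrFun (congrFun h fun _ => false) fun _ => false
    rw [Matrix.smul_apply, Matrix.smul_apply, colourMatrix_const, colourMatrix_const] at this
    simpa using this
  refine ⟨hmn, LinkDiagram.eq_of_compatible fun σ τ hD => ?_⟩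
  have := congrFun (congrFun h σ) τ
  rw [Matrix.smul_apply, Matrix.smul_apply, colourMatrix_apply, colourMatrix_apply, if_pos hD] at this
  by_contra hE
  rw [if_neg hE] at this
  simp at this

theorem colourMatrix_mul_apply [Fintype B] (D : LinkDiagram A B) (E : LinkDiagram B C)
    (σ : A → Bool) (τ : C → Bool) :
    (colourMatrix D * colourMatrix E) σ τ =
      Nat.card {ρ : B → Bool // Compatible D σ ρ ∧ Compatible E ρ τ} := by
  rw [Matrix.mul_apply, Nat.card_eq_fintype_card, Fintype.card_subtype, Finset.card_eq_sum_ones,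
    Finset.sum_filter]
  refine Finset.sum_congr rfl fun ρ _ => ?_
  rw [colourMatrix_apply, colourMatrix_apply]
  by_cases h1 : Compatible D σ ρ <;> by_cases h2 : Compatible E ρ τ <;> simp [h1, h2]

/-- The relation generating `concatGraph D E`. -/
def concatRel (D : LinkDiagram A B) (E : LinkDiagram B C) (x y : A ⊕ B ⊕ C) : Prop :=
  (∃ u : A ⊕ B, x = Sum.map id Sum.inl u ∧ y = Sum.map id Sum.inl (D.mate u)) ∨
    (∃ u : B ⊕ C, x = Sum.inr u ∧ y = Sum.inr (E.mate u))

theorem concatRel_invariant_iff (D : LinkDiagram A B) (E : LinkDiagram B C) (σ : A → Bool)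
    (ρ : B → Bool) (τ : C → Bool) :
    (∀ u v, concatRel D E u v → Sum.elim σ (Sum.elim ρ τ) u = Sum.elim σ (Sum.elim ρ τ) v) ↔
      Compatible D σ ρ ∧ Compatible E ρ τ := by
  have hemb : ∀ x : A ⊕ B, Sum.elim σ (Sum.elim ρ τ) (Sum.map id Sum.inl x) = Sum.elim σ ρ x := by
    rintro (x | x) <;> rfl
  constructor
  · intro h
    refine ⟨fun x => ?_, fun x => ?_⟩
    · rw [← hemb, ← hemb]
      exact (h _ _ (Or.inl ⟨x, rfl, rfl⟩)).symm
    · exact (h _ _ (Or.inr ⟨x, rfl, rfl⟩)).symm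
  · rintro ⟨h1, h2⟩ _ _ (⟨u, rfl, rfl⟩ | ⟨u, rfl, rfl⟩)
    · rw [hemb, hemb]; exact (h1 u).symm
    · exact (h2 u).symm

theorem elim_eq_self {A B : Type} (f : A ⊕ B ⊕ C → Bool) :
    Sum.elim (fun a => f (.inl a)) (Sum.elim (fun b => f (.inr (.inl b)))
      (fun c => f (.inr (.inr c)))) = f := by
  funext x; rcases x with x | x | x <;> rfl

theorem IsConcat.exists_compatible {D : LinkDiagram A B} {E : LinkDiagram B C}
    {F : LinkDiagram A C} (h : IsConcat D E F) {σ : A → Bool} {τ : C → Bool}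
    (hF : Compatible F σ τ) : ∃ ρ, Compatible D σ ρ ∧ Compatible E ρ τ := by
  -- A node is coloured true when it is connected to an outer node coloured true; all the loops are
  -- coloured false.
  set g : A ⊕ B ⊕ C → Bool := fun v => decide (∃ x : A ⊕ C, Sum.elim σ τ x = true ∧
    (concatGraph D E).Reachable (Sum.map id Sum.inr x) v) with hg
  have hout : ∀ x : A ⊕ C, g (Sum.map id Sum.inr x) = Sum.elim σ τ x := by
    intro x
    rw [Bool.eq_iff_iff]
    simp only [hg, decide_eq_true_eq]
    constructor
    · rintro ⟨y, hy, hyx⟩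
      rcases (h y x).1 hyx with rfl | rfl
      · exact hy
      · rw [hF, hy]
    · intro hx
      exact ⟨x, hx, SimpleGraph.Reachable.refl _⟩
  have hinv : ∀ u v, concatRel D E u v → g u = g v := by
    intro u v huv
    have hr : (concatGraph D E).Reachable u v :=
      (reachable_fromRel_iff (concatRel D E) u v).2 fun σ hσ => hσ u v huv
    simp only [hg, decide_eq_decide]
    exact ⟨fun ⟨x, hx, hxu⟩ => ⟨x, hx, hxu.trans hr⟩,
      fun ⟨x, hx, hxu⟩ => ⟨x, hx, hxu.trans hr.symm⟩⟩
  refine ⟨fun b => g (.inr (.inl b)), ?_⟩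
  rw [← concatRel_invariant_iff]
  have e1 : σ = fun a => g (.inl a) := funext fun a => (hout (.inl a)).symm
  have e2 : τ = fun c => g (.inr (.inr c)) := funext fun c => (hout (.inr c)).symm
  rw [e1, e2, elim_eq_self]
  exact hinv

/-- An entry of the product counts the colourings of the middle nodes that fit the two outer ones.
There is none unless the ends of each path agree; otherwise the paths are forced and each loop is
free. -/
theorem IsConcat.colourMatrix_mul [Fintype A] [Fintype B] [Fintype C] {D : LinkDiagram A B}
    {E : LinkDiagram B C} {F : LinkDiagram A C} (h : IsConcat D E F) :
    colourMatrix D * colourMatrix E = 2 ^ concatLoops D E • colourMatrix F := by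
  ext σ τ
  rw [colourMatrix_mul_apply, Matrix.smul_apply, colourMatrix_apply]
  split_ifs with hF
  · obtain ⟨ρ₀, hρ⟩ := h.exists_compatible hF
    rw [← concatRel_invariant_iff] at hρ
    have key := two_pow_card_components (concatRel D E)
      (Set.range (Sum.map id Sum.inr : A ⊕ C → A ⊕ B ⊕ C)) _ hρ
    simp only [Set.forall_mem_range] at key
    rw [smul_eq_mul, mul_one, concatLoops]
    refine Eq.trans (Nat.card_congr ?_) key
    refine ⟨fun ρ => ⟨Sum.elim σ (Sum.elim ρ.1 τ), (concatRel_invariant_iff D E _ _ _).2 ρ.2, ?_⟩,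
      fun f => ⟨fun b => f.1 (.inr (.inl b)), ?_⟩, ?_, ?_⟩
    · rintro (x | x) <;> rfl
    · rw [← concatRel_invariant_iff]
      have e : Sum.elim σ (Sum.elim (fun b => f.1 (.inr (.inl b))) τ) = f.1 := by
        funext x
        rcases x with x | x | x
        · exact (f.2.2 (.inl x)).symm
        · rfl
        · exact (f.2.2 (.inr x)).symm
      rw [e]
      exact f.2.1
    · intro ρ; rfl
    · rintro ⟨f, h1, h2⟩
      ext x
      rcases x with x | x | x
      · exact (h2 (.inl x)).symm
      · rfl
      · exact (h2 (.inr x)).symm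
  · rw [smul_zero, Nat.card_eq_zero]
    left
    constructor
    rintro ⟨ρ, hρ⟩
    rw [← concatRel_invariant_iff] at hρ
    apply hF
    intro x
    have hr := (reachable_fromRel_iff (concatRel D E) _ _).1 ((h x (F.mate x)).2 (Or.inr rfl)) _ hρ
    have hout : ∀ x : A ⊕ C, Sum.elim σ (Sum.elim ρ τ) (Sum.map id Sum.inr x) = Sum.elim σ τ x := by
      rintro (x | x) <;> rfl
    rw [hout, hout] at hr
    exact hr.symm

/-- The reflection of a link diagram. -/
def LinkDiagram.flip (D : LinkDiagram A B) : LinkDiagram B A where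
  mate x := (D.mate x.swap).swap
  mate_mate x := by simp [D.mate_mate]
  mate_ne x h := D.mate_ne x.swap (by rw [← Sum.swap_swap (D.mate x.swap), h])
  planar x y := by
    have hB : ∀ u v : B ⊕ A, Before u v ↔ Before v.swap u.swap := by
      rintro (u | u) (v | v) <;> rfl
    rw [hB x, hB y, hB]
    simp only [Sum.swap_swap]
    intro h1 h2 h3
    have := D.planar (D.mate y.swap) (D.mate x.swap)
    simp only [D.mate_mate] at this
    exact this h3 h2 h1

theorem LinkDiagram.flip_mate_inl (D : LinkDiagram A B) (b : B) :
    D.flip.mate (.inl b) = (D.mate (.inr b)).swap := rfl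

theorem LinkDiagram.flip_mate_inr (D : LinkDiagram A B) (a : A) :
    D.flip.mate (.inr a) = (D.mate (.inl a)).swap := rfl

@[simp]
theorem LinkDiagram.flip_flip (D : LinkDiagram A B) : D.flip.flip = D := by
  ext x; simp [LinkDiagram.flip]

theorem LinkDiagram.flip_id : (LinkDiagram.id A).flip = LinkDiagram.id A := by
  ext1; funext x; simp [LinkDiagram.flip, LinkDiagram.id]

variable [Fintype A] [Fintype B] [Fintype C] [Fintype K]

theorem exists_colourMatrix_mul (D : LinkDiagram A B) (E : LinkDiagram B C) :
    ∃ F n, colourMatrix D * colourMatrix E = 2 ^ n • colourMatrix F ∧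
      ∀ ν, concat ν D E = Finsupp.single F (ν ^ n) := by
  have h := exists_isConcat D E
  refine ⟨h.choose, concatLoops D E, h.choose_spec.colourMatrix_mul, fun ν => ?_⟩
  rw [concat, dif_pos h]

theorem concat_eq_single {D : LinkDiagram A B} {E : LinkDiagram B C} {F : LinkDiagram A C} {n : ℕ}
    (h : colourMatrix D * colourMatrix E = 2 ^ n • colourMatrix F) (ν : ℂ) :
    concat ν D E = Finsupp.single F (ν ^ n) := by
  obtain ⟨F', n', h', hc⟩ := exists_colourMatrix_mul D E
  obtain ⟨rfl, rfl⟩ := eq_of_smul_colourMatrix (h'.symm.trans h)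
  exact hc ν

/-! ### The Temperley-Lieb category -/

@[simp]
theorem tangleMul_single (ν : ℂ) (D : LinkDiagram A B) (E : LinkDiagram B C) (a b : ℂ) :
    tangleMul ν (Finsupp.single D a) (Finsupp.single E b) = (a * b) • concat ν D E := by
  simp [tangleMul, smul_smul]

theorem tangleMul_single_eq {D : LinkDiagram A B} {E : LinkDiagram B C} {F : LinkDiagram A C}
    {n : ℕ} (h : colourMatrix D * colourMatrix E = 2 ^ n • colourMatrix F) (ν : ℂ) :
    tangleMul ν (Finsupp.single D 1) (Finsupp.single E 1) = ν ^ n • Finsupp.single F 1 := by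
  rw [tangleMul_single, concat_eq_single h]
  simp

/-- On diagrams, associativity of the matrix product gives both bracketings the same colouring
matrix up to the same power of 2, hence the same diagram and the same total number of loops. The
powers of ν then agree. -/
theorem tangleMul_assoc (ν : ℂ) (S : LinkDiagram A B →₀ ℂ) (T : LinkDiagram B C →₀ ℂ)
    (U : LinkDiagram C K →₀ ℂ) :
    tangleMul ν (tangleMul ν S T) U = tangleMul ν S (tangleMul ν T U) := by
  induction S using Finsupp.induction_linear with
  | zero => simp
  | add _ _ h1 h2 => simp [h1, h2]
  | single D a =>
  induction T using Finsupp.induction_linear with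
  | zero => simp
  | add _ _ h1 h2 => simp [h1, h2]
  | single E b =>
  induction U using Finsupp.induction_linear with
  | zero => simp
  | add _ _ h1 h2 => simp only [map_add, h1, h2]
  | single G c =>
  obtain ⟨F, m, h1, h1'⟩ := exists_colourMatrix_mul D E
  obtain ⟨H, n, h2, h2'⟩ := exists_colourMatrix_mul E G
  obtain ⟨F', m', h3, h3'⟩ := exists_colourMatrix_mul F G
  obtain ⟨H', n', h4, h4'⟩ := exists_colourMatrix_mul D H
  have key : 2 ^ (m + m') • colourMatrix F' = 2 ^ (n + n') • colourMatrix H' := by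
    rw [pow_add, pow_add, mul_smul, mul_smul, ← h3, ← h4, ← Matrix.smul_mul, ← h1,
      ← Matrix.mul_smul, ← h2, Matrix.mul_assoc]
  obtain ⟨hmn, rfl⟩ := eq_of_smul_colourMatrix key
  have hν : ν ^ m * ν ^ m' = ν ^ n * ν ^ n' := by rw [← pow_add, ← pow_add, hmn]
  simp only [tangleMul_single, h1', h2', Finsupp.smul_single, h3', h4', smul_eq_mul]
  congr 1
  linear_combination a * b * c * hν

theorem compatible_id (σ τ : A → Bool) : Compatible (LinkDiagram.id A) σ τ ↔ σ = τ := by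
  constructor
  · intro h
    funext a
    exact (h (.inr a))
  · rintro rfl (x | x) <;> rfl

theorem id_tangleMul (ν : ℂ) (T : LinkDiagram A B →₀ ℂ) :
    tangleMul ν (Finsupp.single (LinkDiagram.id A) 1) T = T := by
  induction T using Finsupp.induction_linear with
  | zero => simp
  | add _ _ h1 h2 => simp [h1, h2]
  | single E b =>
  have h : colourMatrix (LinkDiagram.id A) * colourMatrix E = 2 ^ 0 • colourMatrix E := by
    have : colourMatrix (LinkDiagram.id A) = 1 := by
      ext σ τ
      rw [colourMatrix_apply, Matrix.one_apply]
      simp only [compatible_id]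
    rw [this, Matrix.one_mul, pow_zero, one_smul]
  rw [tangleMul_single, concat_eq_single h]
  simp

theorem compatible_flip (D : LinkDiagram A B) (σ : A → Bool) (τ : B → Bool) :
    Compatible D.flip τ σ ↔ Compatible D σ τ := by
  have h : ∀ x : B ⊕ A, Sum.elim τ σ x = Sum.elim σ τ x.swap := by rintro (x | x) <;> rfl
  constructor
  · intro k x
    have := k x.swap
    rw [h, h] at this
    simpa [LinkDiagram.flip] using this
  · intro k x
    rw [h, h]
    simpa [LinkDiagram.flip] using k x.swap

theorem colourMatrix_flip (D : LinkDiagram A B) :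
    colourMatrix D.flip = (colourMatrix D).transpose := by
  ext σ τ
  rw [Matrix.transpose_apply, colourMatrix_apply, colourMatrix_apply]
  simp only [compatible_flip]

/-- The reflection of tangles. -/
def dagger : (LinkDiagram A B →₀ ℂ) →ₗ[ℂ] (LinkDiagram B A →₀ ℂ) :=
  Finsupp.lmapDomain ℂ ℂ LinkDiagram.flip

@[simp]
theorem dagger_single (D : LinkDiagram A B) (a : ℂ) :
    dagger (Finsupp.single D a) = Finsupp.single D.flip a := by
  simp [dagger]

@[simp]
theorem dagger_dagger (T : LinkDiagram A B →₀ ℂ) : dagger (dagger T) = T := by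
  induction T using Finsupp.induction_linear with
  | zero => simp
  | add _ _ h1 h2 => simp [h1, h2]
  | single D a => simp

theorem dagger_tangleMul (ν : ℂ) (S : LinkDiagram A B →₀ ℂ) (T : LinkDiagram B C →₀ ℂ) :
    dagger (tangleMul ν S T) = tangleMul ν (dagger T) (dagger S) := by
  induction S using Finsupp.induction_linear with
  | zero => simp
  | add _ _ h1 h2 => simp [h1, h2]
  | single D a =>
  induction T using Finsupp.induction_linear with
  | zero => simp
  | add _ _ h1 h2 => simp [h1, h2]
  | single E b =>
  obtain ⟨F, m, h1, h1'⟩ := exists_colourMatrix_mul D E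
  have h2 : colourMatrix E.flip * colourMatrix D.flip = 2 ^ m • colourMatrix F.flip := by
    rw [colourMatrix_flip, colourMatrix_flip, colourMatrix_flip, ← Matrix.transpose_mul, h1,
      Matrix.transpose_smul]
  simp only [tangleMul_single, dagger_single, concat_eq_single h2, h1', Finsupp.smul_single,
    smul_eq_mul, mul_comm a b]

theorem tangleMul_id (ν : ℂ) (T : LinkDiagram A B →₀ ℂ) :
    tangleMul ν T (Finsupp.single (LinkDiagram.id B) 1) = T := by
  rw [← dagger_dagger (tangleMul ν T _), dagger_tangleMul, dagger_single, LinkDiagram.flip_id,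
    id_tangleMul, dagger_dagger]

/-- A link between two left nodes survives concatenation on the right. -/
theorem mate_of_colourMatrix_mul {D : LinkDiagram A B} {E : LinkDiagram B C}
    {F : LinkDiagram A C} {n : ℕ} (h : colourMatrix D * colourMatrix E = 2 ^ n • colourMatrix F)
    {a a' : A} (ha : D.mate (.inl a) = .inl a') : F.mate (.inl a) = .inl a' := by
  obtain ⟨σ, τ, h1, h1'⟩ := F.exists_compatible_indicator (.inl a)
  have h2 := congrFun (congrFun h σ) τ
  rw [colourMatrix_mul_apply, Matrix.smul_apply, colourMatrix_apply, if_pos h1] at h2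
  have h3 : 0 < Nat.card {ρ : B → Bool // Compatible D σ ρ ∧ Compatible E ρ τ} := by
    rw [h2]; simp
  obtain ⟨⟨ρ, hρ, -⟩⟩ := (Nat.card_pos_iff.1 h3).1
  have h4 : σ a' = σ a := by simpa [ha] using hρ (.inl a)
  have h5 := (h1' (.inl a')).1 (h4.trans ((h1' (.inl a)).2 (Or.inl rfl)))
  rcases h5 with h5 | h5
  · exact absurd (ha.trans (congrArg Sum.inl (Sum.inl_injective h5))) (D.mate_ne _)
  · exact h5.symm

end Matrices

/-! ### Link patterns as diagrams without links between right nodes. -/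

noncomputable section Patterns

variable {A B C K : Type} [LinearOrder A] [LinearOrder B] [LinearOrder C] [LinearOrder K]

/-! ### Link patterns as link diagrams -/

/-- No link joins two right nodes. -/
def NoRightLink (D : LinkDiagram A B) : Prop := ∀ b b', D.mate (.inr b) ≠ .inr b'

theorem LinkDiagram.mate_eq_comm (D : LinkDiagram A B) {x y : A ⊕ B} :
    D.mate x = y ↔ D.mate y = x :=
  ⟨fun h => by rw [← h, D.mate_mate], fun h => by rw [← h, D.mate_mate]⟩

theorem LinkDiagram.through_lt (D : LinkDiagram A B) {a a' : A} {b b' : B}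
    (h : D.mate (.inl a) = .inr b) (h' : D.mate (.inl a') = .inr b') (hlt : a < a') : b < b' := by
  have h1 := D.planar (.inl a) (.inl a') hlt (by rw [h]; trivial)
  rw [h, h'] at h1
  refine lt_of_le_of_ne (not_lt.1 h1) ?_
  rintro rfl
  have := (D.mate_eq_comm.1 h).symm.trans (D.mate_eq_comm.1 h')
  exact hlt.ne (Sum.inl_injective this)

theorem LinkDiagram.through_lt_iff (D : LinkDiagram A B) {a a' : A} {b b' : B}
    (h : D.mate (.inl a) = .inr b) (h' : D.mate (.inl a') = .inr b') : a < a' ↔ b < b' := by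
  refine ⟨D.through_lt h h', fun hb => ?_⟩
  rcases lt_trichotomy a a' with k | rfl | k
  · exact k
  · rw [h] at h'
    exact absurd (Sum.inr_injective h') hb.ne
  · exact absurd (D.through_lt h' h k) hb.not_gt

theorem NoRightLink.exists_ends {D : LinkDiagram A B} (h : NoRightLink D) :
    ∃ t : B → A, StrictMono t ∧ ∀ b, D.mate (.inr b) = .inl (t b) := by
  have : ∀ b, ∃ a, D.mate (.inr b) = .inl a := by
    intro b
    rcases e : D.mate (.inr b) with a | b'
    · exact ⟨a, rfl⟩
    · exact absurd e (h b b')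
  choose t ht using this
  refine ⟨t, fun b b' hb => ?_, ht⟩
  exact (D.through_lt_iff (D.mate_eq_comm.1 (ht b)) (D.mate_eq_comm.1 (ht b'))).2 hb

/-- The node map of the link pattern formed by the left nodes of a link diagram. -/
def LinkDiagram.leftMate (D : LinkDiagram A B) (a : A) : A :=
  Sum.elim (fun a' => a') (fun _ => a) (D.mate (.inl a))

theorem LinkDiagram.leftMate_of_inl {D : LinkDiagram A B} {a a' : A}
    (h : D.mate (.inl a) = .inl a') : D.leftMate a = a' := by simp [LinkDiagram.leftMate, h]

theorem LinkDiagram.leftMate_of_inr {D : LinkDiagram A B} {a : A} {b : B}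
    (h : D.mate (.inl a) = .inr b) : D.leftMate a = a := by simp [LinkDiagram.leftMate, h]

theorem LinkDiagram.leftMate_eq_self_iff (D : LinkDiagram A B) (a : A) :
    D.leftMate a = a ↔ ∃ b, D.mate (.inl a) = .inr b := by
  rcases h : D.mate (.inl a) with a' | b
  · rw [LinkDiagram.leftMate_of_inl h]
    refine ⟨?_, by simp⟩
    rintro rfl
    exact absurd h (D.mate_ne _)
  · simp [LinkDiagram.leftMate_of_inr h]

/-- The link pattern formed by the left nodes of a link diagram. -/
def LinkDiagram.leftPattern (D : LinkDiagram A B) (r : ℕ)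
    (hr : Nat.card {a : A // D.leftMate a = a} = r) : LinkPattern A r where
  mate := D.leftMate
  mate_mate a := by
    rcases h : D.mate (.inl a) with a' | b
    · rw [LinkDiagram.leftMate_of_inl h, LinkDiagram.leftMate_of_inl (D.mate_eq_comm.1 h)]
    · rw [LinkDiagram.leftMate_of_inr h, LinkDiagram.leftMate_of_inr h]
  planar a b h1 h2 h3 := by
    rcases h : D.mate (.inl a) with a' | a'
    · rw [LinkDiagram.leftMate_of_inl h] at h2 h3
      rcases k : D.mate (.inl b) with b' | b'
      · rw [LinkDiagram.leftMate_of_inl k] at h3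
        exact D.planar (.inl a) (.inl b) h1 (by rw [h]; exact h2) (by rw [h, k]; exact h3)
      · rw [LinkDiagram.leftMate_of_inr k] at h3
        exact h3.not_gt h2
    · rw [LinkDiagram.leftMate_of_inr h] at h2
      exact h1.not_gt h2
  defect_exposed a b h1 h2 h3 := by
    obtain ⟨c, hc⟩ := (D.leftMate_eq_self_iff b).1 h3
    rcases h : D.mate (.inl a) with a' | a'
    · rw [LinkDiagram.leftMate_of_inl h] at h2
      exact D.planar (.inl a) (.inl b) h1 (by rw [h]; exact h2) (by rw [h, hc]; trivial)
    · rw [LinkDiagram.leftMate_of_inr h] at h2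
      exact h1.not_gt h2
  card_defects := hr

theorem card_through (D : LinkDiagram A B) :
    Nat.card {a : A // D.leftMate a = a} = Nat.card {b : B // D.flip.leftMate b = b} := by
  have hl : ∀ a : {a : A // D.leftMate a = a}, ∃ b, D.mate (.inl a.1) = .inr b := fun a =>
    (D.leftMate_eq_self_iff a.1).1 a.2
  choose f hf using hl
  refine Nat.card_congr (Equiv.ofBijective (fun a => ⟨f a, ?_⟩) ⟨?_, ?_⟩)
  · rw [LinkDiagram.leftMate_eq_self_iff]
    exact ⟨a.1, by rw [LinkDiagram.flip_mate_inl, D.mate_eq_comm.1 (hf a)]; rfl⟩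
  · intro a a' h
    have h1 := D.mate_eq_comm.1 (hf a)
    have h2 := D.mate_eq_comm.1 (hf a')
    simp only [Subtype.mk.injEq] at h
    rw [h, h2] at h1
    exact Subtype.ext (Sum.inl_injective h1.symm)
  · rintro ⟨b, hb⟩
    obtain ⟨a, ha⟩ := (D.flip.leftMate_eq_self_iff b).1 hb
    rw [LinkDiagram.flip_mate_inl] at ha
    have ha' : D.mate (.inr b) = .inl a := by rw [← Sum.swap_swap (D.mate _), ha]; rfl
    have ha'' := D.mate_eq_comm.1 ha'
    refine ⟨⟨a, (D.leftMate_eq_self_iff a).2 ⟨b, ha''⟩⟩, ?_⟩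
    have := hf ⟨a, (D.leftMate_eq_self_iff a).2 ⟨b, ha''⟩⟩
    exact Subtype.ext (Sum.inr_injective (this.symm.trans ha''))

theorem NoRightLink.card_through {r : ℕ} {D : LinkDiagram A (Fin r)} (h : NoRightLink D) :
    Nat.card {a : A // D.leftMate a = a} = r := by
  rw [ValencedTL.card_through]
  have : ∀ k, D.flip.leftMate k = k := by
    intro k
    rw [LinkDiagram.leftMate_eq_self_iff]
    obtain ⟨t, -, ht⟩ := h.exists_ends
    exact ⟨t k, by rw [LinkDiagram.flip_mate_inl, ht]; rfl⟩
  simp [this]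

theorem LinkPattern.exists_ends [Fintype A] {r : ℕ} (α : LinkPattern A r) :
    ∃ t : Fin r → A, StrictMono t ∧ ∀ a, α.mate a = a ↔ a ∈ Set.range t := by
  have hc : (Finset.univ.filter fun a => α.mate a = a).card = r := by
    rw [← Fintype.card_subtype, ← Nat.card_eq_fintype_card, α.card_defects]
  refine ⟨Finset.orderEmbOfFin _ hc, (Finset.orderEmbOfFin _ hc).strictMono, fun a => ?_⟩
  rw [Finset.range_orderEmbOfFin]
  simp

variable [Fintype A] [Fintype B] [Fintype C] [Fintype K]

/-- The positions of the defects of a link pattern, in increasing order. -/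
def LinkPattern.ends {r : ℕ} (α : LinkPattern A r) : Fin r → A := α.exists_ends.choose

theorem LinkPattern.ends_strictMono {r : ℕ} (α : LinkPattern A r) : StrictMono α.ends :=
  α.exists_ends.choose_spec.1

theorem LinkPattern.mate_eq_self_iff {r : ℕ} (α : LinkPattern A r) (a : A) :
    α.mate a = a ↔ ∃ k, α.ends k = a :=
  α.exists_ends.choose_spec.2 a

/-- The node map of `ofPattern`. -/
def ofPatternMate {r : ℕ} (α : LinkPattern A r) : A ⊕ Fin r → A ⊕ Fin r
  | .inl a => if h : ∃ k, α.ends k = a then .inr h.choose else .inl (α.mate a)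
  | .inr k => .inl (α.ends k)

theorem ofPatternMate_ends {r : ℕ} (α : LinkPattern A r) (k : Fin r) :
    ofPatternMate α (.inl (α.ends k)) = .inr k := by
  have h : ∃ l, α.ends l = α.ends k := ⟨k, rfl⟩
  rw [ofPatternMate, dif_pos h]
  exact congrArg _ (α.ends_strictMono.injective h.choose_spec)

theorem ofPatternMate_of_ne {r : ℕ} (α : LinkPattern A r) {a : A} (h : α.mate a ≠ a) :
    ofPatternMate α (.inl a) = .inl (α.mate a) := by
  rw [Ne, α.mate_eq_self_iff] at h
  rw [ofPatternMate, dif_neg h]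

/-- The link diagram obtained from a link pattern by joining the defects to right nodes. -/
def ofPattern {r : ℕ} (α : LinkPattern A r) : LinkDiagram A (Fin r) where
  mate := ofPatternMate α
  mate_mate := by
    rintro (a | k)
    · by_cases h : α.mate a = a
      · obtain ⟨k, rfl⟩ := (α.mate_eq_self_iff a).1 h
        rw [ofPatternMate_ends]; rfl
      · rw [ofPatternMate_of_ne α h, ofPatternMate_of_ne α, α.mate_mate]
        rw [α.mate_mate]
        exact Ne.symm h
    · exact ofPatternMate_ends α k
  mate_ne := by
    rintro (a | k)
    · by_cases h : α.mate a = a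
      · obtain ⟨k, rfl⟩ := (α.mate_eq_self_iff a).1 h
        rw [ofPatternMate_ends]; simp
      · rw [ofPatternMate_of_ne α h]
        simpa using h
    · simp [ofPatternMate]
  planar := by
    rintro (a | k) (b | l) h1 h2 h3
    · by_cases ha : α.mate a = a
      · obtain ⟨k, rfl⟩ := (α.mate_eq_self_iff a).1 ha
        rw [ofPatternMate_ends] at h2 h3
        by_cases hb : α.mate b = b
        · obtain ⟨l, rfl⟩ := (α.mate_eq_self_iff b).1 hb
          rw [ofPatternMate_ends] at h3
          have : k < l := α.ends_strictMono.lt_iff_lt.1 h1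
          exact this.not_gt h3
        · rw [ofPatternMate_of_ne α hb] at h3
          exact h3
      · rw [ofPatternMate_of_ne α ha] at h2 h3
        by_cases hb : α.mate b = b
        · exact α.defect_exposed a b h1 h2 hb
        · rw [ofPatternMate_of_ne α hb] at h3
          exact α.planar a b h1 h2 h3
    · by_cases ha : α.mate a = a
      · obtain ⟨k, rfl⟩ := (α.mate_eq_self_iff a).1 ha
        rw [ofPatternMate_ends] at h3
        exact h3
      · rw [ofPatternMate_of_ne α ha] at h2
        exact h2
    · exact h1
    · exact h2

theorem ofPattern_mate_inr {r : ℕ} (α : LinkPattern A r) (k : Fin r) :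
    (ofPattern α).mate (.inr k) = .inl (α.ends k) := rfl

theorem ofPattern_mate_ends {r : ℕ} (α : LinkPattern A r) (k : Fin r) :
    (ofPattern α).mate (.inl (α.ends k)) = .inr k := ofPatternMate_ends α k

theorem ofPattern_mate_of_ne {r : ℕ} (α : LinkPattern A r) {a : A} (h : α.mate a ≠ a) :
    (ofPattern α).mate (.inl a) = .inl (α.mate a) := ofPatternMate_of_ne α h

theorem ofPattern_noRightLink {r : ℕ} (α : LinkPattern A r) : NoRightLink (ofPattern α) := by
  intro k l
  rw [ofPattern_mate_inr]
  simp

theorem ofPattern_leftMate {r : ℕ} (α : LinkPattern A r) (a : A) :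
    (ofPattern α).leftMate a = α.mate a := by
  by_cases h : α.mate a = a
  · rw [h]
    obtain ⟨k, rfl⟩ := (α.mate_eq_self_iff a).1 h
    exact LinkDiagram.leftMate_of_inr (ofPattern_mate_ends α k)
  · exact LinkDiagram.leftMate_of_inl (ofPattern_mate_of_ne α h)

theorem leftPattern_ofPattern {r : ℕ} (α : LinkPattern A r) (h) :
    (ofPattern α).leftPattern r h = α :=
  LinkPattern.ext (funext fun a => ofPattern_leftMate α a)

/-- Through-lines cannot cross, so the k-th right node is joined to the k-th defect and the left
half determines the diagram. -/
theorem ofPattern_leftPattern {r : ℕ} {D : LinkDiagram A (Fin r)} (h : NoRightLink D) (h') :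
    ofPattern (D.leftPattern r h') = D := by
  set α := D.leftPattern r h' with hα
  obtain ⟨t, ht, ht'⟩ := h.exists_ends
  have hends : α.ends = t := by
    rw [← StrictMono.range_inj α.ends_strictMono ht]
    ext a
    rw [Set.mem_range, ← α.mate_eq_self_iff]
    change D.leftMate a = a ↔ _
    rw [D.leftMate_eq_self_iff]
    refine exists_congr fun k => ?_
    rw [D.mate_eq_comm, ht']
    exact Sum.inl_injective.eq_iff
  have hr : ∀ k, (ofPattern α).mate (.inr k) = D.mate (.inr k) := by
    intro k
    rw [ofPattern_mate_inr, ht', hends]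
  ext1
  funext x
  rcases x with a | k
  · rcases ha : D.mate (.inl a) with a' | k
    · have h1 : α.mate a = a' := LinkDiagram.leftMate_of_inl ha
      rw [ofPattern_mate_of_ne, h1]
      rw [h1]
      rintro rfl
      exact D.mate_ne _ ha
    · rw [(ofPattern α).mate_eq_comm, hr, D.mate_eq_comm, ha]
  · exact hr k

theorem compatible_iff (D : LinkDiagram A B) (σ : A → Bool) (τ : B → Bool) :
    Compatible D σ τ ↔ (∀ a, σ (D.leftMate a) = σ a) ∧ (∀ b, τ (D.flip.leftMate b) = τ b) ∧
      ∀ a b, D.mate (.inl a) = .inr b → σ a = τ b := by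
  have hr : ∀ b b', D.mate (.inr b) = .inr b' → D.flip.mate (.inl b) = .inl b' := by
    intro b b' h
    rw [LinkDiagram.flip_mate_inl, h]; rfl
  have hr' : ∀ b a, D.mate (.inr b) = .inl a → D.flip.mate (.inl b) = .inr a := by
    intro b b' h
    rw [LinkDiagram.flip_mate_inl, h]; rfl
  constructor
  · intro h
    refine ⟨fun a => ?_, fun b => ?_, fun a b hab => ?_⟩
    · rcases ha : D.mate (.inl a) with a' | b
      · rw [LinkDiagram.leftMate_of_inl ha]
        simpa [ha] using h (.inl a)
      · rw [LinkDiagram.leftMate_of_inr ha]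
    · rcases ha : D.mate (.inr b) with a | b'
      · rw [LinkDiagram.leftMate_of_inr (hr' _ _ ha)]
      · rw [LinkDiagram.leftMate_of_inl (hr _ _ ha)]
        simpa [ha] using h (.inr b)
    · simpa [hab] using (h (.inl a)).symm
  · rintro ⟨h1, h2, h3⟩ (a | b)
    · rcases ha : D.mate (.inl a) with a' | b
      · have := h1 a
        rw [LinkDiagram.leftMate_of_inl ha] at this
        simpa using this
      · simpa using (h3 a b ha).symm
    · rcases ha : D.mate (.inr b) with a | b'
      · simpa using h3 a b (D.mate_eq_comm.1 ha)
      · have := h2 b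
        rw [LinkDiagram.leftMate_of_inl (hr _ _ ha)] at this
        simpa using this

theorem compatible_ofPattern_iff {r : ℕ} (α : LinkPattern A r) (σ : A → Bool) (τ : Fin r → Bool) :
    Compatible (ofPattern α) σ τ ↔ (∀ a, σ (α.mate a) = σ a) ∧ τ = σ ∘ α.ends := by
  rw [compatible_iff]
  simp only [ofPattern_leftMate]
  refine and_congr_right fun _ => ⟨fun h => ?_, ?_⟩
  · funext k
    exact (h.2 _ _ (ofPattern_mate_ends α k)).symm
  · rintro rfl
    refine ⟨fun k => ?_, fun a k hk => ?_⟩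
    · rw [LinkDiagram.leftMate_of_inr (b := α.ends k)]
      rw [LinkDiagram.flip_mate_inl, ofPattern_mate_inr]; rfl
    · rw [(ofPattern α).mate_eq_comm, ofPattern_mate_inr] at hk
      rw [← Sum.inl_injective hk]; rfl

/-- Every link diagram is the concatenation of two link patterns. -/
theorem exists_factorization (D : LinkDiagram A B) : ∃ (r : ℕ) (α : LinkPattern A r)
    (β : LinkPattern B r),
    colourMatrix (ofPattern α) * colourMatrix (ofPattern β).flip = 2 ^ 0 • colourMatrix D := by
  refine ⟨_, D.leftPattern _ rfl, D.flip.leftPattern _ (card_through D).symm, ?_⟩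
  set α := D.leftPattern _ rfl with hα
  set β := D.flip.leftPattern _ (card_through D).symm with hβ
  have hl : ∀ k, ∃ b, D.mate (.inl (α.ends k)) = .inr b := fun k =>
    (D.leftMate_eq_self_iff _).1 ((α.mate_eq_self_iff _).2 ⟨k, rfl⟩)
  choose s hs using hl
  have hsm : StrictMono s := fun k l hkl => D.through_lt (hs k) (hs l) (α.ends_strictMono hkl)
  -- By planarity the k-th defects of the two halves are the ends of the same through-line.
  have hends : β.ends = s := by
    rw [← StrictMono.range_inj β.ends_strictMono hsm]
    ext b
    rw [Set.mem_range, ← β.mate_eq_self_iff]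
    change D.flip.leftMate b = b ↔ _
    rw [LinkDiagram.leftMate_eq_self_iff]
    constructor
    · rintro ⟨a, ha⟩
      have ha' : D.mate (.inr b) = .inl a := by
        rw [← Sum.swap_swap (D.mate _), ← LinkDiagram.flip_mate_inl, ha]; rfl
      have ha'' := D.mate_eq_comm.1 ha'
      obtain ⟨k, rfl⟩ := (α.mate_eq_self_iff a).1 ((D.leftMate_eq_self_iff _).2 ⟨b, ha''⟩)
      exact ⟨k, Sum.inr_injective ((hs k).symm.trans ha'')⟩
    · rintro ⟨k, rfl⟩
      exact ⟨α.ends k, by rw [LinkDiagram.flip_mate_inl, D.mate_eq_comm.1 (hs k)]; rfl⟩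
  rw [pow_zero, one_smul]
  ext σ τ
  rw [colourMatrix_mul_apply, colourMatrix_apply]
  simp only [compatible_flip, compatible_ofPattern_iff]
  split_ifs with h
  · rw [compatible_iff] at h
    rw [Nat.card_eq_one_iff_unique]
    -- The colours at the cut are forced by the defects, so gluing the two halves creates no loop.
    refine ⟨⟨?_⟩, ⟨⟨σ ∘ α.ends, ⟨h.1, rfl⟩, h.2.1, ?_⟩⟩⟩
    · rintro ⟨ρ, h1, h2⟩ ⟨ρ', h1', h2'⟩
      exact Subtype.ext (h1.2.trans h1'.2.symm)
    · rw [hends]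
      funext k
      exact h.2.2 _ _ (hs k)
  · rw [Nat.card_eq_zero]
    left
    constructor
    rintro ⟨ρ, h1, h2⟩
    apply h
    rw [compatible_iff]
    refine ⟨h1.1, h2.1, fun a b hab => ?_⟩
    obtain ⟨k, rfl⟩ := (α.mate_eq_self_iff a).1 ((D.leftMate_eq_self_iff _).2 ⟨b, hab⟩)
    have h3 : σ (α.ends k) = τ (β.ends k) := congrFun (h1.2.symm.trans h2.2) k
    rw [h3, hends]
    exact congrArg τ (Sum.inr_injective ((hs k).symm.trans hab))

theorem NoRightLink.le {m r : ℕ} {D : LinkDiagram (Fin m) (Fin r)} (h : NoRightLink D) :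
    r ≤ m := by
  obtain ⟨t, ht, -⟩ := h.exists_ends
  simpa using Fintype.card_le_of_injective t ht.injective

/-- The right ends give a strictly increasing self-map of `Fin r`, which can only be the identity.
-/
theorem NoRightLink.eq_id {r : ℕ} {D : LinkDiagram (Fin r) (Fin r)} (h : NoRightLink D) :
    D = LinkDiagram.id (Fin r) := by
  obtain ⟨t, ht, hD⟩ := h.exists_ends
  have h1 : t = id := by
    have hs : Function.Surjective t := Finite.injective_iff_surjective.1 ht.injective
    rw [← StrictMono.range_inj ht strictMono_id, hs.range_eq, Set.range_id]
  subst h1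
  ext1
  funext x
  rcases x with k | k
  · exact D.mate_eq_comm.1 (hD k)
  · exact hD k

end Patterns

/-! ### The action and the bilinear form as products of tangles. -/

noncomputable section PatternActions

variable {A B C K : Type} [LinearOrder A] [LinearOrder B] [LinearOrder C] [LinearOrder K]
variable [Fintype A] [Fintype B] [Fintype C] [Fintype K]

theorem exists_compatible_iff {D : LinkDiagram A B} {E : LinkDiagram B C}
    {F : LinkDiagram A C} {n : ℕ} (h : colourMatrix D * colourMatrix E = 2 ^ n • colourMatrix F)
    (σ : A → Bool) (τ : C → Bool) :
    (∃ ρ, Compatible D σ ρ ∧ Compatible E ρ τ) ↔ Compatible F σ τ := by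
  have h2 := congrFun (congrFun h σ) τ
  rw [colourMatrix_mul_apply, Matrix.smul_apply, colourMatrix_apply] at h2
  constructor
  · rintro ⟨ρ, hρ⟩
    by_contra hF
    rw [if_neg hF, smul_zero, Nat.card_eq_zero] at h2
    exact h2.elim (fun h => h.false ⟨ρ, hρ⟩) fun h => h.not_finite inferInstance
  · intro hF
    rw [if_pos hF] at h2
    have h3 : 0 < Nat.card {ρ : B → Bool // Compatible D σ ρ ∧ Compatible E ρ τ} := by
      rw [h2]; simp
    obtain ⟨⟨ρ, hρ⟩⟩ := (Nat.card_pos_iff.1 h3).1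
    exact ⟨ρ, hρ⟩

theorem LinkDiagram.forall_compatible_iff (F : LinkDiagram A C) (x y : A ⊕ C) :
    (∀ σ τ, Compatible F σ τ → Sum.elim σ τ x = Sum.elim σ τ y) ↔ y = x ∨ y = F.mate x := by
  constructor
  · intro h
    obtain ⟨σ, τ, h1, h2⟩ := F.exists_compatible_indicator x
    rw [← h2, ← h σ τ h1, h2]
    exact Or.inl rfl
  · rintro (rfl | rfl) σ τ h
    · rfl
    · exact (h x).symm

/-! ### The action on link patterns in terms of link diagrams -/

section Act

variable {r : ℕ} (D : LinkDiagram A B) (α : LinkPattern B r)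

/-- The relation generating `actGraph D α`. -/
def actRel (x y : A ⊕ B) : Prop := y = D.mate x ∨ ∃ b : B, x = Sum.inr b ∧ y = Sum.inr (α.mate b)

theorem actRel_invariant_iff (f : A ⊕ B → Bool) :
    (∀ u v, actRel D α u v → f u = f v) ↔
      Compatible D (fun a => f (.inl a)) (fun b => f (.inr b)) ∧
        ∀ b, f (.inr (α.mate b)) = f (.inr b) := by
  have hf : Sum.elim (fun a => f (.inl a)) (fun b => f (.inr b)) = f := by
    funext y; rcases y with y | y <;> rfl
  constructor
  · intro h
    refine ⟨fun x => ?_, fun b => (h _ _ (Or.inr ⟨b, rfl, rfl⟩)).symm⟩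
    rw [hf]
    exact (h _ _ (Or.inl rfl)).symm
  · rintro ⟨h1, h2⟩ u v (rfl | ⟨b, rfl, rfl⟩)
    · have := h1 u
      rw [hf] at this
      exact this.symm
    · exact (h2 b).symm

/-- The outer node of the concatenation of `D` and `ofPattern α` as a node of `actGraph D α`. -/
def actOuter : A ⊕ Fin r → A ⊕ B := Sum.map (fun a => a) α.ends

variable {D α} {F : LinkDiagram A (Fin r)} {n : ℕ}

/-- Reachability is tested on invariant colourings. These are the compatible colourings of `D`
followed by `ofPattern α`, the k-th right node carrying the colour of the k-th defect. -/
theorem actGraph_reachable_iff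
    (h : colourMatrix D * colourMatrix (ofPattern α) = 2 ^ n • colourMatrix F) (x y : A ⊕ Fin r) :
    (actGraph D α).Reachable (actOuter α x) (actOuter α y) ↔ y = x ∨ y = F.mate x := by
  have hact : actGraph D α = SimpleGraph.fromRel (actRel D α) := rfl
  rw [hact, reachable_fromRel_iff, ← F.forall_compatible_iff]
  have hout : ∀ (σ : A → Bool) (ρ : B → Bool) (x : A ⊕ Fin r),
      Sum.elim σ ρ (actOuter α x) = Sum.elim σ (ρ ∘ α.ends) x := by
    rintro σ ρ (x | x) <;> rfl
  constructor
  · intro k σ τ hF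
    obtain ⟨ρ, h1, h2⟩ := (exists_compatible_iff h σ τ).2 hF
    rw [compatible_ofPattern_iff] at h2
    have := k (Sum.elim σ ρ) ((actRel_invariant_iff D α _).2 ⟨h1, h2.1⟩)
    rwa [hout, hout, ← h2.2] at this
  · intro k f hf
    rw [actRel_invariant_iff] at hf
    have hf' : Sum.elim (fun a => f (.inl a)) (fun b => f (.inr b)) = f := by
      funext y; rcases y with y | y <;> rfl
    rw [← hf', hout, hout]
    refine k _ _ ((exists_compatible_iff h _ _).1 ⟨_, hf.1, ?_⟩)
    rw [compatible_ofPattern_iff]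
    exact ⟨hf.2, rfl⟩

theorem hasTurnBack_iff
    (h : colourMatrix D * colourMatrix (ofPattern α) = 2 ^ n • colourMatrix F) :
    HasTurnBack D α ↔ ¬ NoRightLink F := by
  have key : ∀ k l : Fin r, (actGraph D α).Reachable (.inr (α.ends k)) (.inr (α.ends l)) ↔
      (l = k ∨ F.mate (.inr k) = .inr l) := by
    intro k l
    rw [← Sum.inr_injective.eq_iff (a := l), eq_comm (a := F.mate _)]
    exact actGraph_reachable_iff h (.inr k) (.inr l)
  simp only [NoRightLink, not_forall, not_not]
  constructor
  · rintro ⟨b, b', hne, h1, h2, h3⟩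
    obtain ⟨k, rfl⟩ := (α.mate_eq_self_iff b).1 h1
    obtain ⟨l, rfl⟩ := (α.mate_eq_self_iff b').1 h2
    rcases (key k l).1 h3 with rfl | h4
    · exact absurd rfl hne
    · exact ⟨k, l, h4⟩
  · rintro ⟨k, l, hkl⟩
    refine ⟨_, _, fun hne => ?_, (α.mate_eq_self_iff _).2 ⟨k, rfl⟩,
      (α.mate_eq_self_iff _).2 ⟨l, rfl⟩, (key k l).2 (Or.inr hkl)⟩
    rw [α.ends_strictMono.injective hne] at hkl
    exact F.mate_ne _ hkl

theorem isAct_leftPattern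
    (h : colourMatrix D * colourMatrix (ofPattern α) = 2 ^ n • colourMatrix F) (h') :
    IsAct D α (F.leftPattern r h') := by
  intro a a'
  refine (actGraph_reachable_iff h (.inl a) (.inl a')).trans ?_
  rw [Sum.inl_injective.eq_iff]
  change _ ↔ a' = a ∨ a' = F.leftMate a
  rcases ha : F.mate (.inl a) with a'' | k
  · rw [LinkDiagram.leftMate_of_inl ha, Sum.inl_injective.eq_iff]
  · rw [LinkDiagram.leftMate_of_inr ha]
    simp

theorem IsAct.unique {β β' : LinkPattern A r} (h : IsAct D α β) (h' : IsAct D α β') : β = β' := by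
  ext1
  funext a
  have h1 := (h' a (β.mate a)).1 ((h a _).2 (Or.inr rfl))
  have h2 := (h a (β'.mate a)).1 ((h' a _).2 (Or.inr rfl))
  rcases h1 with h1 | h1
  · rw [h1] at h2
    rw [h1]
    exact (h2.elim (fun h => h) fun h => h).symm
  · exact h1

/-- Both 2 ^ `actLoops D α` and 2 ^ n count the colourings that are false on the left nodes and on
the defects. -/
theorem actLoops_eq
    (h : colourMatrix D * colourMatrix (ofPattern α) = 2 ^ n • colourMatrix F) :
    actLoops D α = n := by
  have h2 := congrFun (congrFun h fun _ => false) fun _ => false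
  rw [colourMatrix_mul_apply, Matrix.smul_apply, colourMatrix_const, smul_eq_mul, mul_one] at h2
  apply Nat.pow_right_injective (le_refl 2)
  dsimp only
  rw [← h2]
  have key := two_pow_card_components (actRel D α)
    (Set.range Sum.inl ∪ Sum.inr '' {b | α.mate b = b}) (fun _ => false) fun _ _ _ => rfl
  have hS : ∀ P : A ⊕ B → Prop,
      (∀ z ∈ Set.range Sum.inl ∪ Sum.inr '' {b | α.mate b = b}, P z) ↔
      (∀ a, P (.inl a)) ∧ ∀ b, α.mate b = b → P (.inr b) := by
    intro P
    constructor
    · intro h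
      exact ⟨fun a => h _ (Or.inl ⟨a, rfl⟩), fun b hb => h _ (Or.inr ⟨b, hb, rfl⟩)⟩
    · rintro ⟨h1, h2⟩ _ (⟨a, rfl⟩ | ⟨b, hb, rfl⟩)
      · exact h1 a
      · exact h2 b hb
  simp only [hS] at key
  refine Eq.trans key.symm (Nat.card_congr ?_)
  refine ⟨fun f => ⟨fun b => f.1 (.inr b), ?_⟩, fun ρ => ⟨Sum.elim (fun _ => false) ρ.1, ?_⟩, ?_, ?_⟩
  · obtain ⟨h1, h2, h3⟩ := f.2
    rw [actRel_invariant_iff] at h1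
    simp only [h2] at h1
    refine ⟨h1.1, ?_⟩
    rw [compatible_ofPattern_iff]
    refine ⟨h1.2, ?_⟩
    funext k
    exact (h3 _ ((α.mate_eq_self_iff _).2 ⟨k, rfl⟩)).symm
  · obtain ⟨h1, h2⟩ := ρ.2
    rw [compatible_ofPattern_iff] at h2
    refine ⟨(actRel_invariant_iff _ _ _).2 ⟨h1, h2.1⟩, fun _ => rfl, fun b hb => ?_⟩
    obtain ⟨k, rfl⟩ := (α.mate_eq_self_iff b).1 hb
    exact (congrFun h2.2 k).symm
  · rintro ⟨f, h1, h2, h3⟩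
    ext x
    rcases x with a | b
    · exact (h2 a).symm
    · rfl
  · intro ρ; rfl

end Act

/-- The link state of a tangle with `r` right nodes: the link diagrams with a link between right
nodes are set to zero. -/
def toState (r : ℕ) : (LinkDiagram A (Fin r) →₀ ℂ) →ₗ[ℂ] (LinkPattern A r →₀ ℂ) :=
  Finsupp.lift _ ℂ _ fun D =>
    if h : NoRightLink D then Finsupp.single (D.leftPattern r h.card_through) 1 else 0

/-- The tangle of a link state. -/
def ofState (r : ℕ) : (LinkPattern A r →₀ ℂ) →ₗ[ℂ] (LinkDiagram A (Fin r) →₀ ℂ) :=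
  Finsupp.lmapDomain ℂ ℂ ofPattern

@[simp]
theorem ofState_single {r : ℕ} (α : LinkPattern A r) (c : ℂ) :
    ofState r (Finsupp.single α c) = Finsupp.single (ofPattern α) c := by
  simp [ofState]

theorem toState_single {r : ℕ} (D : LinkDiagram A (Fin r)) (c : ℂ) :
    toState r (Finsupp.single D c) = c •
      if h : NoRightLink D then Finsupp.single (D.leftPattern r h.card_through) 1 else 0 := by
  simp [toState]

theorem toState_single_of_not {r : ℕ} {D : LinkDiagram A (Fin r)} (h : ¬ NoRightLink D) (c : ℂ) :
    toState r (Finsupp.single D c) = 0 := by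
  rw [toState_single, dif_neg h, smul_zero]

@[simp]
theorem toState_ofPattern {r : ℕ} (α : LinkPattern A r) (c : ℂ) :
    toState r (Finsupp.single (ofPattern α) c) = Finsupp.single α c := by
  rw [toState_single, dif_pos (ofPattern_noRightLink α), leftPattern_ofPattern]
  simp

@[simp]
theorem toState_ofState {r : ℕ} (X : LinkPattern A r →₀ ℂ) : toState r (ofState r X) = X := by
  induction X using Finsupp.induction_linear with
  | zero => simp
  | add _ _ h1 h2 => simp [h1, h2]
  | single D a => simp

theorem NoRightLink.exists_ofPattern {r : ℕ} {D : LinkDiagram A (Fin r)} (h : NoRightLink D) :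
    ∃ α, D = ofPattern α :=
  ⟨_, (ofPattern_leftPattern h h.card_through).symm⟩

/-- A link between two right nodes survives concatenation on the left. -/
theorem mate_right_of_colourMatrix_mul {D : LinkDiagram A B} {E : LinkDiagram B C}
    {F : LinkDiagram A C} {n : ℕ} (h : colourMatrix D * colourMatrix E = 2 ^ n • colourMatrix F)
    {c c' : C} (hc : E.mate (.inr c) = .inr c') : F.mate (.inr c) = .inr c' := by
  have h1 : colourMatrix E.flip * colourMatrix D.flip = 2 ^ n • colourMatrix F.flip := by
    rw [colourMatrix_flip, colourMatrix_flip, colourMatrix_flip, ← Matrix.transpose_mul, h,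
      Matrix.transpose_smul]
  have h2 := mate_of_colourMatrix_mul h1 (a := c) (a' := c')
    (by rw [LinkDiagram.flip_mate_inl, hc]; rfl)
  rw [LinkDiagram.flip_mate_inl] at h2
  rw [← Sum.swap_swap (F.mate _), h2]; rfl

theorem not_noRightLink_of_colourMatrix_mul {D : LinkDiagram A B} {E : LinkDiagram B C}
    {F : LinkDiagram A C} {n : ℕ} (h : colourMatrix D * colourMatrix E = 2 ^ n • colourMatrix F)
    (hE : ¬ NoRightLink E) : ¬ NoRightLink F := by
  simp only [NoRightLink, not_forall, not_not] at hE ⊢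
  obtain ⟨c, c', hc⟩ := hE
  exact ⟨c, c', mate_right_of_colourMatrix_mul h hc⟩

@[simp]
theorem tangleAct_single (ν : ℂ) {r : ℕ} (D : LinkDiagram A B) (α : LinkPattern B r) (a b : ℂ) :
    tangleAct ν r (Finsupp.single D a) (Finsupp.single α b) = (a * b) • act ν D α := by
  simp [tangleAct, smul_smul]

/-- A turn-back path is a link between two right nodes of the product, which `toState` sends to
zero. Such links of the second factor survive multiplication, so the truncation may be made before
or after it. -/
theorem tangleAct_toState (ν : ℂ) (r : ℕ) (T : LinkDiagram A B →₀ ℂ)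
    (X : LinkDiagram B (Fin r) →₀ ℂ) :
    tangleAct ν r T (toState r X) = toState r (tangleMul ν T X) := by
  induction T using Finsupp.induction_linear with
  | zero => simp
  | add _ _ h1 h2 => simp [h1, h2]
  | single D a =>
  induction X using Finsupp.induction_linear with
  | zero => simp
  | add _ _ h1 h2 => simp only [map_add, h1, h2]
  | single E b =>
  obtain ⟨F, n, h1, h2⟩ := exists_colourMatrix_mul D E
  rw [tangleMul_single, h2, map_smul]
  by_cases hE : NoRightLink E
  · obtain ⟨α, rfl⟩ := hE.exists_ofPattern
    rw [toState_ofPattern, tangleAct_single, act]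
    have hT := hasTurnBack_iff h1
    congr 1
    by_cases hF : NoRightLink F
    · have hex : ∃ β, IsAct D α β := ⟨_, isAct_leftPattern h1 hF.card_through⟩
      rw [if_neg (by rw [hT]; exact not_not.2 hF), dif_pos hex, toState_single, dif_pos hF,
        actLoops_eq h1, IsAct.unique hex.choose_spec (isAct_leftPattern h1 hF.card_through)]
      simp
    · rw [if_pos (hT.2 hF), toState_single_of_not hF]
  · rw [toState_single_of_not hE, toState_single_of_not (not_noRightLink_of_colourMatrix_mul h1 hE)]
    simp

/-! ### The bilinear form in terms of link diagrams -/

section Form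

variable {r : ℕ} (α β : LinkPattern A r)

/-- The relation generating `network α β`. -/
def networkRel (a a' : A) : Prop := a' = α.mate a ∨ a' = β.mate a

theorem networkRel_invariant_iff (τ : A → Bool) :
    (∀ u v, networkRel α β u v → τ u = τ v) ↔
      (∀ a, τ (α.mate a) = τ a) ∧ ∀ a, τ (β.mate a) = τ a := by
  constructor
  · intro h
    exact ⟨fun a => (h _ _ (Or.inl rfl)).symm, fun a => (h _ _ (Or.inr rfl)).symm⟩
  · rintro ⟨h1, h2⟩ u v (rfl | rfl)
    · exact (h1 u).symm
    · exact (h2 u).symm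

variable {α β} {F : LinkDiagram (Fin r) (Fin r)} {n : ℕ}

theorem network_reachable_iff
    (h : colourMatrix (ofPattern α).flip * colourMatrix (ofPattern β) = 2 ^ n • colourMatrix F)
    (x y : Fin r ⊕ Fin r) :
    (network α β).Reachable (Sum.elim α.ends β.ends x) (Sum.elim α.ends β.ends y) ↔
      y = x ∨ y = F.mate x := by
  have hact : network α β = SimpleGraph.fromRel (networkRel α β) := rfl
  rw [hact, reachable_fromRel_iff, ← F.forall_compatible_iff]
  have hout : ∀ (ρ : A → Bool) (x : Fin r ⊕ Fin r),
      ρ (Sum.elim α.ends β.ends x) = Sum.elim (ρ ∘ α.ends) (ρ ∘ β.ends) x := by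
    rintro ρ (x | x) <;> rfl
  constructor
  · intro k σ τ hF
    obtain ⟨ρ, h1, h2⟩ := (exists_compatible_iff h σ τ).2 hF
    rw [compatible_flip] at h1
    rw [compatible_ofPattern_iff] at h1 h2
    have := k ρ ((networkRel_invariant_iff α β _).2 ⟨h1.1, h2.1⟩)
    rwa [hout ρ x, hout ρ y, ← h2.2, ← h1.2] at this
  · intro k ρ hρ
    rw [networkRel_invariant_iff] at hρ
    rw [hout ρ x, hout ρ y]
    refine k _ _ ((exists_compatible_iff h _ _).1 ⟨ρ, ?_, ?_⟩)
    · rw [compatible_flip, compatible_ofPattern_iff]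
      exact ⟨hρ.1, rfl⟩
    · rw [compatible_ofPattern_iff]
      exact ⟨hρ.2, rfl⟩

theorem network_loops_eq
    (h : colourMatrix (ofPattern α).flip * colourMatrix (ofPattern β) = 2 ^ n • colourMatrix F) :
    Nat.card {c : (network α β).ConnectedComponent //
      ∀ a, α.mate a = a ∨ β.mate a = a → (network α β).connectedComponentMk a ≠ c} = n := by
  have h2 := congrFun (congrFun h fun _ => false) fun _ => false
  rw [colourMatrix_mul_apply, Matrix.smul_apply, colourMatrix_const, smul_eq_mul, mul_one] at h2
  apply Nat.pow_right_injective (le_refl 2)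
  dsimp only
  rw [← h2]
  have key := two_pow_card_components (networkRel α β)
    {a | α.mate a = a ∨ β.mate a = a} (fun _ => false) fun _ _ _ => rfl
  refine Eq.trans key.symm (congrArg Nat.card (congrArg Subtype (funext fun ρ => propext ?_)))
  rw [networkRel_invariant_iff, compatible_flip, compatible_ofPattern_iff, compatible_ofPattern_iff]
  constructor
  · rintro ⟨⟨h1, h2⟩, h3⟩
    refine ⟨⟨h1, funext fun k => ?_⟩, ⟨h2, funext fun k => ?_⟩⟩
    · exact (h3 _ (Or.inl ((α.mate_eq_self_iff _).2 ⟨k, rfl⟩))).symm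
    · exact (h3 _ (Or.inr ((β.mate_eq_self_iff _).2 ⟨k, rfl⟩))).symm
  · rintro ⟨⟨h1, h1'⟩, h2, h2'⟩
    refine ⟨⟨h1, h2⟩, ?_⟩
    rintro a (ha | ha)
    · obtain ⟨k, rfl⟩ := (α.mate_eq_self_iff a).1 ha
      exact (congrFun h1' k).symm
    · obtain ⟨k, rfl⟩ := (β.mate_eq_self_iff a).1 ha
      exact (congrFun h2' k).symm

/-- Defects of the same pattern are joined exactly when `F` has a link on one side. A square diagram
without right links is the unit, so the absence of turn-back paths means that `F` is the unit. -/
theorem evalNetwork_eq (ν : ℂ)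
    (h : colourMatrix (ofPattern α).flip * colourMatrix (ofPattern β) = 2 ^ n • colourMatrix F) :
    evalNetwork ν α β = if F = LinkDiagram.id (Fin r) then ν ^ n else 0 := by
  have hα := α.ends_strictMono.injective
  have hβ := β.ends_strictMono.injective
  rw [evalNetwork, network_loops_eq h]
  split_ifs with h1 h2 h2
  · exfalso
    subst h2
    rcases h1 with ⟨a, a', hne, ha, ha', hr⟩ | ⟨a, a', hne, ha, ha', hr⟩
    · obtain ⟨k, rfl⟩ := (α.mate_eq_self_iff a).1 ha
      obtain ⟨l, rfl⟩ := (α.mate_eq_self_iff a').1 ha'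
      have := (network_reachable_iff h (.inl k) (.inl l)).1 hr
      simp only [LinkDiagram.id, Sum.swap_inl, reduceCtorEq, or_false, Sum.inl.injEq] at this
      exact hne (by rw [this])
    · obtain ⟨k, rfl⟩ := (β.mate_eq_self_iff a).1 ha
      obtain ⟨l, rfl⟩ := (β.mate_eq_self_iff a').1 ha'
      have := (network_reachable_iff h (.inr k) (.inr l)).1 hr
      simp only [LinkDiagram.id, Sum.swap_inr, reduceCtorEq, or_false, Sum.inr.injEq] at this
      exact hne (by rw [this])
  · rfl
  · rfl
  · exfalso
    apply h1
    right
    have h3 : ¬ NoRightLink F := fun h3 => h2 h3.eq_id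
    simp only [NoRightLink, not_forall, not_not] at h3
    obtain ⟨k, l, hkl⟩ := h3
    refine ⟨β.ends k, β.ends l, ?_, (β.mate_eq_self_iff _).2 ⟨k, rfl⟩,
      (β.mate_eq_self_iff _).2 ⟨l, rfl⟩,
      (network_reachable_iff h (.inr k) (.inr l)).2 (Or.inr hkl.symm)⟩
    intro he
    rw [hβ he] at hkl
    exact F.mate_ne _ hkl

end Form

/-- The coefficient of the unit diagram. -/
def idCoeff (A : Type) [LinearOrder A] : (LinkDiagram A A →₀ ℂ) →ₗ[ℂ] ℂ :=
  Finsupp.lapply (LinkDiagram.id A)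

theorem idCoeff_single (D : LinkDiagram A A) (c : ℂ) :
    idCoeff A (Finsupp.single D c) = if D = LinkDiagram.id A then c else 0 := by
  simp only [idCoeff, Finsupp.lapply_apply, Finsupp.single_apply]

/-- A right link of `X` or `Y` survives into the product, which then has no unit diagram; this
matches its removal by `toState`. -/
theorem linkForm_toState (ν : ℂ) (r : ℕ) (X Y : LinkDiagram A (Fin r) →₀ ℂ) :
    linkForm ν r (toState r X) (toState r Y) =
      idCoeff (Fin r) (tangleMul ν (dagger X) Y) := by
  induction X using Finsupp.induction_linear with
  | zero => simp
  | add _ _ h1 h2 => simp [h1, h2]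
  | single D a =>
  induction Y using Finsupp.induction_linear with
  | zero => simp
  | add _ _ h1 h2 => simp only [map_add, h1, h2]
  | single E b =>
  obtain ⟨F, n, h1, h2⟩ := exists_colourMatrix_mul D.flip E
  rw [dagger_single, tangleMul_single, h2, map_smul, idCoeff_single]
  have hid : ∀ k l : Fin r, (LinkDiagram.id (Fin r)).mate (.inr k) ≠ .inr l := by
    intro k l; simp [LinkDiagram.id]
  have hid' : ∀ k l : Fin r, (LinkDiagram.id (Fin r)).mate (.inl k) ≠ .inl l := by
    intro k l; simp [LinkDiagram.id]
  by_cases hE : NoRightLink E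
  · by_cases hD : NoRightLink D
    · obtain ⟨β, rfl⟩ := hE.exists_ofPattern
      obtain ⟨α, rfl⟩ := hD.exists_ofPattern
      rw [toState_ofPattern, toState_ofPattern]
      have : linkForm ν r (Finsupp.single α a) (Finsupp.single β b) =
          (a * b) * evalNetwork ν α β := by
        simp [linkForm, mul_assoc]
      rw [this, evalNetwork_eq ν h1, smul_eq_mul]
    · rw [toState_single_of_not hD]
      simp only [NoRightLink, not_forall, not_not] at hD
      obtain ⟨k, l, hkl⟩ := hD
      rw [if_neg]
      · simp
      · rintro rfl
        exact hid' k l (mate_of_colourMatrix_mul h1 (by rw [LinkDiagram.flip_mate_inl, hkl]; rfl))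
  · rw [toState_single_of_not hE]
    simp only [NoRightLink, not_forall, not_not] at hE
    obtain ⟨k, l, hkl⟩ := hE
    rw [if_neg]
    · simp
    · rintro rfl
      exact hid k l (mate_right_of_colourMatrix_mul h1 hkl)

end PatternActions

/-! ### The Temperley-Lieb relations. -/

noncomputable section Caps

variable {A B C K : Type} [LinearOrder A] [LinearOrder B] [LinearOrder C] [LinearOrder K]

/-! ### Diagrams turning back two nodes -/

/-- The diagram turns back the nodes `a` and `b` on both sides and is the unit elsewhere. -/
structure IsCap (U : LinkDiagram A A) (a b : A) : Prop where
  ne : a ≠ b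
  left : U.mate (.inl a) = .inl b
  right : U.mate (.inr a) = .inr b
  across : ∀ x, x ≠ a → x ≠ b → U.mate (.inl x) = .inr x

theorem IsCap.symm {U : LinkDiagram A A} {a b : A} (h : IsCap U a b) : IsCap U b a :=
  ⟨h.ne.symm, U.mate_eq_comm.1 h.left, U.mate_eq_comm.1 h.right, fun x h1 h2 => h.across x h2 h1⟩

theorem IsCap.compatible_iff {U : LinkDiagram A A} {a b : A} (h : IsCap U a b)
    (σ τ : A → Bool) :
    Compatible U σ τ ↔ σ a = σ b ∧ τ a = τ b ∧ ∀ x, x ≠ a → x ≠ b → σ x = τ x := by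
  constructor
  · intro k
    refine ⟨?_, ?_, fun x hx hx' => ?_⟩
    · simpa [h.left] using (k (.inl a)).symm
    · simpa [h.right] using (k (.inr a)).symm
    · simpa [h.across x hx hx'] using (k (.inl x)).symm
  · rintro ⟨h1, h2, h3⟩ (x | x)
    · by_cases hx : x = a
      · subst hx; simpa [h.left] using h1.symm
      · by_cases hx' : x = b
        · subst hx'; simpa [h.symm.left] using h1
        · simpa [h.across x hx hx'] using (h3 x hx hx').symm
    · by_cases hx : x = a
      · subst hx; simpa [h.right] using h2.symm
      · by_cases hx' : x = b
        · subst hx'; simpa [h.symm.right] using h2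
        · simpa [U.mate_eq_comm.1 (h.across x hx hx')] using h3 x hx hx'

variable [Fintype A] [Fintype B] [Fintype C] [Fintype K]

theorem Compatible.of_eq_off_link {D : LinkDiagram A B} {a b : A}
    (h : D.mate (.inl a) = .inl b) {ρ σ : A → Bool} {τ : B → Bool} (hρ : Compatible D ρ τ)
    (hab : σ a = σ b) (hoff : ∀ x, x ≠ a → x ≠ b → σ x = ρ x) : Compatible D σ τ := by
  have h' := D.mate_eq_comm.1 h
  intro x
  by_cases hx : x = .inl a
  · subst hx; simpa [h] using hab.symm
  · by_cases hx' : x = .inl b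
    · subst hx'; simpa [h'] using hab
    · have key : ∀ y : A ⊕ B, y ≠ .inl a → y ≠ .inl b → Sum.elim σ τ y = Sum.elim ρ τ y := by
        rintro (y | y) h1 h2
        · exact hoff y (fun h => h1 (by rw [h])) (fun h => h2 (by rw [h]))
        · rfl
      rw [key x hx hx', key, hρ]
      · rwa [Ne, D.mate_eq_comm, h, eq_comm]
      · rwa [Ne, D.mate_eq_comm, h', eq_comm]

/-- The right link of the cap meets the link of `D` in one closed loop, whose colour is free; the
outer links are those of `D`. -/
theorem IsCap.colourMatrix_mul {U : LinkDiagram A A} {a b : A} (hU : IsCap U a b)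
    {D : LinkDiagram A B} (hD : D.mate (.inl a) = .inl b) :
    colourMatrix U * colourMatrix D = 2 ^ 1 • colourMatrix D := by
  ext σ τ
  rw [colourMatrix_mul_apply, Matrix.smul_apply, colourMatrix_apply]
  simp only [hU.compatible_iff]
  split_ifs with h
  · have hσ : σ a = σ b := by simpa [hD] using (h (.inl a)).symm
    let e : {ρ : A → Bool // (σ a = σ b ∧ ρ a = ρ b ∧ ∀ x, x ≠ a → x ≠ b → σ x = ρ x) ∧
        Compatible D ρ τ} ≃ Bool :=
      { toFun := fun ρ => ρ.1 a
        invFun := fun v => ⟨fun x => if x = a ∨ x = b then v else σ x,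
          ⟨hσ, by simp, fun x h1 h2 => by simp [h1, h2]⟩,
          h.of_eq_off_link hD (by simp) fun x h1 h2 => by simp [h1, h2]⟩
        left_inv := by
          rintro ⟨ρ, ⟨h1, h2, h3⟩, h4⟩
          ext x
          by_cases hx : x = a
          · simp [hx]
          · by_cases hx' : x = b
            · simp [hx', h2]
            · simp [hx, hx', h3 x hx hx']
        right_inv := fun v => by simp }
    rw [Nat.card_congr e]
    simp
  · rw [smul_zero, Nat.card_eq_zero]
    left
    constructor
    rintro ⟨ρ, ⟨h1, h2, h3⟩, h4⟩
    exact h (h4.of_eq_off_link hD h1 h3)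

theorem IsCap.tangleMul {U : LinkDiagram A A} {a b : A} (hU : IsCap U a b)
    {D : LinkDiagram A B} (hD : D.mate (.inl a) = .inl b) (ν : ℂ) :
    ValencedTL.tangleMul ν (Finsupp.single U 1) (Finsupp.single D 1) =
      ν • Finsupp.single D 1 := by
  rw [tangleMul_single_eq (hU.colourMatrix_mul hD), pow_one]

/-- A loop could be coloured true with everything outside false, so uniqueness of the middle
colouring excludes loops. -/
theorem eq_zero_of_compatible_unique {D : LinkDiagram A B} {E : LinkDiagram B C}
    {F : LinkDiagram A C} {n : ℕ} (h : colourMatrix D * colourMatrix E = 2 ^ n • colourMatrix F)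
    (hu : ∀ ρ, Compatible D (fun _ => false) ρ → Compatible E ρ (fun _ => false) →
      ρ = fun _ => false) : n = 0 := by
  have h2 := congrFun (congrFun h fun _ => false) fun _ => false
  rw [colourMatrix_mul_apply, Matrix.smul_apply, colourMatrix_const, smul_eq_mul, mul_one] at h2
  have : Subsingleton {ρ : B → Bool // Compatible D (fun _ => false) ρ ∧
      Compatible E ρ (fun _ => false)} :=
    ⟨fun ρ ρ' => Subtype.ext ((hu _ ρ.2.1 ρ.2.2).trans (hu _ ρ'.2.1 ρ'.2.2).symm)⟩
  have h3 := Finite.card_le_one_iff_subsingleton.2 this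
  rw [h2] at h3
  by_contra hn
  have := Nat.one_lt_two_pow hn
  omega

theorem IsCap.braid {U V : LinkDiagram A A} {a b c : A} (hU : IsCap U a b) (hV : IsCap V b c)
    (hac : a ≠ c) (ν : ℂ) :
    ValencedTL.tangleMul ν (ValencedTL.tangleMul ν (Finsupp.single U 1) (Finsupp.single V 1))
      (Finsupp.single U 1) = Finsupp.single U 1 := by
  obtain ⟨F, m, h1, -⟩ := exists_colourMatrix_mul U V
  obtain ⟨G, n, h2, -⟩ := exists_colourMatrix_mul F U
  have ca := hU.ne
  have cb := hV.ne
  -- Tracing the relations through the three diagrams, the colour at c passes to a and b in the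
  -- inner colouring and the other colours are unchanged. Nothing is free, so there are no loops,
  -- and the outer colourings are those allowed by `U`.
  have key : ∀ σ ρ ρ' τ, Compatible U σ ρ → Compatible V ρ ρ' → Compatible U ρ' τ →
      Compatible U σ τ ∧ ∀ x, ρ' x = if x = a ∨ x = b then σ c else σ x := by
    intro σ ρ ρ' τ k1 k2 k3
    rw [hU.compatible_iff] at *
    rw [hV.compatible_iff] at k2
    obtain ⟨k1, k1', k1''⟩ := k1
    obtain ⟨k2, k2', k2''⟩ := k2
    obtain ⟨k3, k3', k3''⟩ := k3
    have e1 := k1'' c hac.symm cb.symm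
    have e2 := k2'' a ca hac
    have e3 := k3'' c hac.symm cb.symm
    refine ⟨⟨k1, k3', fun x hxa hxb => ?_⟩, fun x => ?_⟩
    · by_cases hxc : x = c
      · subst hxc; rw [e1, ← e3, ← k2', ← k3, ← e2, k1', k2]
      · rw [k1'' x hxa hxb, k2'' x hxb hxc, k3'' x hxa hxb]
    · split_ifs with hx
      · rcases hx with rfl | rfl
        · rw [← e2, k1', k2, e1]
        · rw [← k3, ← e2, k1', k2, e1]
      · push Not at hx
        by_cases hxc : x = c
        · subst hxc; rw [e1, ← k2', ← k3, ← e2, k1', k2]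
        · rw [k1'' x hx.1 hx.2, k2'' x hx.2 hxc]
  have hm : m = 0 := by
    refine eq_zero_of_compatible_unique h1 fun ρ k1 k2 => ?_
    rw [hU.compatible_iff] at k1
    rw [hV.compatible_iff] at k2
    funext x
    by_cases hxc : x = b ∨ x = c
    · have : ρ c = false := (k1.2.2 c hac.symm cb.symm).symm
      rcases hxc with rfl | rfl
      · rw [k2.1, this]
      · exact this
    · push Not at hxc
      exact k2.2.2 x hxc.1 hxc.2
  have hn : n = 0 := by
    refine eq_zero_of_compatible_unique h2 fun ρ' k1 k2 => ?_
    obtain ⟨ρ, k3, k4⟩ := (exists_compatible_iff h1 _ _).2 k1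
    funext x
    rw [(key _ _ _ _ k3 k4 k2).2 x]
    simp
  have hG : G = U := by
    refine LinkDiagram.eq_of_compatible fun σ τ hG => ?_
    obtain ⟨ρ', k1, k2⟩ := (exists_compatible_iff h2 _ _).2 hG
    obtain ⟨ρ, k3, k4⟩ := (exists_compatible_iff h1 _ _).2 k1
    exact (key _ _ _ _ k3 k4 k2).1
  subst hm hn hG
  rw [tangleMul_single_eq h1, map_smul, LinearMap.smul_apply, tangleMul_single_eq h2]
  simp

theorem IsCap.commute {U V : LinkDiagram A A} {a b c d : A} (hU : IsCap U a b) (hV : IsCap V c d)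
    (hac : a ≠ c) (had : a ≠ d) (hbc : b ≠ c) (hbd : b ≠ d) (ν : ℂ) :
    ValencedTL.tangleMul ν (Finsupp.single U 1) (Finsupp.single V 1) =
      ValencedTL.tangleMul ν (Finsupp.single V 1) (Finsupp.single U 1) := by
  have key : ∀ {U V F : LinkDiagram A A} {a b c d : A} {m : ℕ}, IsCap U a b → IsCap V c d →
      a ≠ c → a ≠ d → b ≠ c → b ≠ d →
      colourMatrix U * colourMatrix V = 2 ^ m • colourMatrix F → m = 0 ∧
      ∀ σ τ, Compatible F σ τ → ∃ ρ, Compatible V σ ρ ∧ Compatible U ρ τ := by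
    intro U V F a b c d m hU hV hac had hbc hbd h
    constructor
    · refine eq_zero_of_compatible_unique h fun ρ k1 k2 => ?_
      rw [hU.compatible_iff] at k1
      rw [hV.compatible_iff] at k2
      funext x
      by_cases hx : x = a ∨ x = b
      · rcases hx with rfl | rfl
        · exact k2.2.2 _ hac had
        · exact k2.2.2 _ hbc hbd
      · push Not at hx
        exact (k1.2.2 x hx.1 hx.2).symm
    · intro σ τ hF
      obtain ⟨ρ, k1, k2⟩ := (exists_compatible_iff h _ _).2 hF
      rw [hU.compatible_iff] at k1
      rw [hV.compatible_iff] at k2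
      -- For the opposite order the middle colouring agrees with τ on the nodes of `V` and with σ
      -- elsewhere.
      refine ⟨fun x => if x = c ∨ x = d then τ x else σ x, ?_, ?_⟩
      · rw [hV.compatible_iff]
        refine ⟨?_, by simpa using k2.2.1, fun x h1 h2 => by simp [h1, h2]⟩
        rw [k1.2.2 c hac.symm hbc.symm, k1.2.2 d had.symm hbd.symm, k2.1]
      · rw [hU.compatible_iff]
        refine ⟨by simpa [hac, had, hbc, hbd] using k1.1, ?_, fun x h1 h2 => ?_⟩
        · rw [← k2.2.2 a hac had, ← k2.2.2 b hbc hbd, k1.2.1]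
        · by_cases hx : x = c ∨ x = d
          · simp [hx]
          · simp only [hx, if_false]
            push Not at hx
            rw [k1.2.2 x h1 h2, k2.2.2 x hx.1 hx.2]
  obtain ⟨F, m, h1, -⟩ := exists_colourMatrix_mul U V
  obtain ⟨G, n, h2, -⟩ := exists_colourMatrix_mul V U
  obtain ⟨rfl, k⟩ := key hU hV hac had hbc hbd h1
  obtain ⟨rfl, -⟩ := key hV hU hac.symm hbc.symm had.symm hbd.symm h2
  have : F = G := LinkDiagram.eq_of_compatible fun σ τ hF => (exists_compatible_iff h2 _ _).1 (k σ τ hF)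
  subst this
  rw [tangleMul_single_eq h1, tangleMul_single_eq h2]

theorem gen_isCap (s i : ℕ) (hi : i + 1 < s) :
    IsCap (gen s i hi) ⟨i, by omega⟩ ⟨i + 1, hi⟩ where
  ne := by simp
  left := by simp [gen, genMate]
  right := by simp [gen, genMate]
  across := by
    rintro ⟨x, hx⟩ h1 h2
    simp only [ne_eq, Fin.mk.injEq] at h1 h2
    simp [gen, genMate, h1, h2]

end Caps

/-! ### Quantum integers -/

section Quantum

/-- The quantum integers, as polynomials in the loop weight `ν = - q - q⁻¹`. -/
def quantumInt (ν : ℂ) : ℕ → ℂ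
  | 0 => 0
  | 1 => 1
  | n + 2 => -ν * quantumInt ν (n + 1) - quantumInt ν n

theorem quantumInt_mul_sub {q : ℂ} (hq : q ≠ 0) (n : ℕ) :
    (q - q⁻¹) * quantumInt (-q - q⁻¹) n = q ^ n - q⁻¹ ^ n := by
  induction n using Nat.twoStepInduction with
  | zero => simp [quantumInt]
  | one => simp [quantumInt]
  | more n h1 h2 =>
    have h : q * q⁻¹ = 1 := mul_inv_cancel₀ hq
    rw [quantumInt]
    have : (q - q⁻¹) * (-(-q - q⁻¹) * quantumInt (-q - q⁻¹) (n + 1) - quantumInt (-q - q⁻¹) n) =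
      (q + q⁻¹) * ((q - q⁻¹) * quantumInt (-q - q⁻¹) (n + 1)) -
        (q - q⁻¹) * quantumInt (-q - q⁻¹) n := by ring
    rw [this, h1, h2]
    linear_combination (q ^ n - q⁻¹ ^ n) * h

theorem quantumInt_neg_two (n : ℕ) : quantumInt (-2) n = n := by
  induction n using Nat.twoStepInduction with
  | zero => simp [quantumInt]
  | one => simp [quantumInt]
  | more n h1 h2 => rw [quantumInt, h1, h2]; push_cast; ring

theorem quantumInt_two (n : ℕ) : quantumInt 2 n = (-1) ^ (n + 1) * n := by
  induction n using Nat.twoStepInduction with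
  | zero => simp [quantumInt]
  | one => simp [quantumInt]
  | more n h1 h2 => rw [quantumInt, h1, h2]; push_cast; ring

/-- Here q = exp (π i j / k) with 0 ≤ j < 2k, and j > 0 as q ≠ 1. In lowest terms j / k has a
denominator dividing k. -/
theorem pmin_le_of_pow_eq_one {q : ℂ} (hq : q ≠ 1) {k : ℕ} (hk : 0 < k) (h : q ^ (2 * k) = 1) :
    pmin q ≤ k := by
  have hne : NeZero (2 * k) := ⟨by omega⟩
  obtain ⟨i, hi, hqi⟩ : ∃ i < 2 * k, Complex.exp (2 * Real.pi * Complex.I * (i / (2 * k : ℕ))) = q := by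
    have hu : IsUnit q := IsUnit.of_pow_eq_one h (by omega)
    obtain ⟨u, rfl⟩ := hu
    rw [← Complex.mem_rootsOfUnity, mem_rootsOfUnity]
    ext
    simpa using h
  have hi0 : 0 < i := by
    rcases Nat.eq_zero_or_pos i with rfl | h0
    · exfalso; apply hq; rw [← hqi]; simp
    · exact h0
  have hg : 0 < Nat.gcd k i := Nat.gcd_pos_of_pos_left _ hk
  obtain ⟨g, p, p', hg0, hcop, hkp, hip⟩ := Nat.exists_coprime' hg
  have hg1 : 0 < g := hg0
  have hp : 0 < p := Nat.pos_of_ne_zero (by rintro rfl; simp at hkp; omega)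
  have hp' : 0 < p' := Nat.pos_of_ne_zero (by rintro rfl; simp at hip; omega)
  refine le_trans (sInf_le ⟨p, p', hp, hp', hcop, ?_, rfl⟩) ?_
  · rw [← hqi]
    congr 1
    rw [hkp, hip]
    have h1 : (g : ℂ) ≠ 0 := by exact_mod_cast hg1.ne'
    have h2 : (p : ℂ) ≠ 0 := by exact_mod_cast hp.ne'
    push_cast
    field_simp
  · rw [hkp]
    exact_mod_cast Nat.le_mul_of_pos_right p hg1

/-- At q = ± 1 the quantum integer is k up to sign. Otherwise (q - q⁻¹) [k] = q ^ k - q⁻¹ ^ k, so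
its vanishing would give q ^ (2k) = 1 and hence 𝔭(q) ≤ k ≤ s. -/
theorem quantumInt_ne_zero {q : ℂ} (hq : q ≠ 0) {s : ℕ} (hs : (s : ℕ∞) < pbar q) {k : ℕ}
    (hk : 1 ≤ k) (hks : k ≤ s) : quantumInt (-q - q⁻¹) k ≠ 0 := by
  have hk0 : (k : ℂ) ≠ 0 := by exact_mod_cast (by omega : k ≠ 0)
  by_cases h1 : q = 1
  · subst h1
    have : (-1 - 1⁻¹ : ℂ) = -2 := by norm_num
    rwa [this, quantumInt_neg_two]
  by_cases h2 : q = -1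
  · subst h2
    have : (- -1 - (-1)⁻¹ : ℂ) = 2 := by norm_num
    rw [this, quantumInt_two]
    simpa using hk0
  intro h0
  have h3 := quantumInt_mul_sub hq k
  rw [h0, mul_zero] at h3
  have h4 : q ^ (2 * k) = 1 := by
    have h5 : q ^ k * q⁻¹ ^ k = 1 := by rw [← mul_pow, mul_inv_cancel₀ hq, one_pow]
    rw [two_mul, pow_add]
    linear_combination h5 - q ^ k * h3
  have h5 := pmin_le_of_pow_eq_one h1 (by omega) h4
  rw [pbar, if_neg (by tauto)] at hs
  have h6 : (k : ℕ∞) ≤ s := by exact_mod_cast hks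
  exact absurd (hs.trans_le h5) (not_lt.2 h6)

end Quantum

/-! ### Existence of the Jones-Wenzl projectors -/

section JonesWenzl

variable {R : Type*} [Ring R] [Algebra ℂ R]

/-- The Jones-Wenzl recursion in an algebra. -/
noncomputable def wenzl (ν : ℂ) (U : ℕ → R) : ℕ → R
  | 0 => 1
  | 1 => 1
  | k + 2 => wenzl ν U (k + 1) + (quantumInt ν (k + 1) / quantumInt ν (k + 2)) •
      (wenzl ν U (k + 1) * U k * wenzl ν U (k + 1))

/-- The properties are proved together because each feeds the next induction step. The element of
index k + 1 is built from U_0, …, U_(k-1), hence the commutation with later generators. The sandwich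
relation produces the factor -[k+2]/[k+1], and the coefficient [k+1]/[k+2] of the recursion is
chosen to cancel it, so the next element annihilates U_k. The sandwich relation itself propagates by
[k+3] = -ν [k+2] - [k+1]. -/
theorem wenzl_spec {ν : ℂ} {s : ℕ} {U : ℕ → R} (h1 : ∀ i, i + 1 < s → U i * U i = ν • U i)
    (h2 : ∀ i, i + 2 < s → U (i + 1) * U i * U (i + 1) = U (i + 1))
    (h3 : ∀ i j, i + 2 ≤ j → j + 1 < s → U i * U j = U j * U i)
    (hQ : ∀ k, 1 ≤ k → k ≤ s → quantumInt ν k ≠ 0) (k : ℕ) (hk : k + 1 ≤ s) :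
    (∀ j, k + 1 ≤ j → j + 1 < s → Commute (wenzl ν U (k + 1)) (U j)) ∧
    (∀ j, k ≤ j → j + 1 < s → Commute (wenzl ν U k) (U j)) ∧
    wenzl ν U (k + 1) * wenzl ν U (k + 1) = wenzl ν U (k + 1) ∧
    (∀ i < k, U i * wenzl ν U (k + 1) = 0 ∧ wenzl ν U (k + 1) * U i = 0) ∧
    (k + 1 < s → U k * wenzl ν U (k + 1) * U k =
      -(quantumInt ν (k + 2) / quantumInt ν (k + 1)) • (wenzl ν U k * U k)) ∧
    wenzl ν U (k + 1) * wenzl ν U k = wenzl ν U (k + 1) ∧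
    wenzl ν U k * wenzl ν U (k + 1) = wenzl ν U (k + 1) := by
  induction k with
  | zero =>
    simp only [wenzl, mul_one, one_mul]
    refine ⟨fun _ _ _ => Commute.one_left _, fun _ _ _ => Commute.one_left _, trivial, by simp,
      fun h => ?_, trivial, trivial⟩
    rw [h1 0 h]
    simp [quantumInt]
  | succ k ih =>
    obtain ⟨ia, ia', ib, ic, id', ie, ie'⟩ := ih (by omega)
    have hQ1 := hQ (k + 1) (by omega) (by omega)
    have hQ2 := hQ (k + 2) (by omega) hk
    have hd := id' (by omega)
    set P := wenzl ν U (k + 1) with hP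
    set P' := wenzl ν U k with hP'
    set c := quantumInt ν (k + 1) / quantumInt ν (k + 2) with hc
    have hW : wenzl ν U (k + 1 + 1) = P + c • (P * U k * P) := rfl
    have hcc : c * (quantumInt ν (k + 2) / quantumInt ν (k + 1)) = 1 := by
      rw [hc]; field_simp
    have hcomm : P' * U k = U k * P' := ia' k le_rfl (by omega)
    have hUP : U k * wenzl ν U (k + 1 + 1) = 0 := by
      have : U k * (P * U k * P) = (U k * P * U k) * P := by noncomm_ring
      rw [hW, mul_add, mul_smul_comm, this, hd, smul_mul_assoc, smul_smul, mul_neg, hcc, hcomm,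
        mul_assoc, ie']
      simp
    have hPU : wenzl ν U (k + 1 + 1) * U k = 0 := by
      have : (P * U k * P) * U k = P * (U k * P * U k) := by noncomm_ring
      rw [hW, add_mul, smul_mul_assoc, this, hd, mul_smul_comm, smul_smul, mul_neg, hcc,
        ← mul_assoc, ie]
      simp
    have hWP : wenzl ν U (k + 1 + 1) * P = wenzl ν U (k + 1 + 1) := by
      rw [hW, add_mul, smul_mul_assoc, mul_assoc (P * U k), ib]
    have hPW : P * wenzl ν U (k + 1 + 1) = wenzl ν U (k + 1 + 1) := by
      rw [hW, mul_add, mul_smul_comm, ← mul_assoc, ← mul_assoc, ib]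
    refine ⟨fun j hj hjs => ?_, fun j hj hjs => ia j hj hjs, ?_, fun i hi => ?_, fun hs => ?_,
      hWP, hPW⟩
    · have hPj : Commute P (U j) := ia j (by omega) hjs
      have hUj : Commute (U k) (U j) := h3 k j (by omega) hjs
      rw [hW]
      exact hPj.add_left (((hPj.mul_left hUj).mul_left hPj).smul_left c)
    · nth_rewrite 2 [hW]
      rw [mul_add, mul_smul_comm, ← mul_assoc, ← mul_assoc, hWP, hPU]
      simp
    · rcases Nat.lt_succ_iff_lt_or_eq.1 hi with hi | rfl
      · constructor
        · rw [hW, mul_add, mul_smul_comm, ← mul_assoc, ← mul_assoc, (ic i hi).1]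
          simp
        · rw [hW, add_mul, smul_mul_assoc, mul_assoc (P * U k), (ic i hi).2]
          simp
      · exact ⟨hUP, hPU⟩
    · have hPj : P * U (k + 1) = U (k + 1) * P := ia (k + 1) le_rfl hs
      have e1 : U (k + 1) * P * U (k + 1) = ν • (P * U (k + 1)) := by
        rw [← hPj, mul_assoc, h1 _ hs, mul_smul_comm]
      have e2 : U (k + 1) * (P * U k * P) * U (k + 1) = P * U (k + 1) := by
        calc U (k + 1) * (P * U k * P) * U (k + 1)
            = (U (k + 1) * P) * U k * (P * U (k + 1)) := by noncomm_ring
          _ = (P * U (k + 1)) * U k * (U (k + 1) * P) := by rw [← hPj, hPj]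
          _ = P * (U (k + 1) * U k * U (k + 1)) * P := by noncomm_ring
          _ = P * U (k + 1) := by rw [h2 k (by omega), mul_assoc, ← hPj, ← mul_assoc, ib]
      rw [hW, mul_add, add_mul, e1, mul_smul_comm, smul_mul_assoc, e2, ← add_smul]
      congr 1
      have hrec : quantumInt ν (k + 1 + 2) = -ν * quantumInt ν (k + 2) - quantumInt ν (k + 1) := rfl
      rw [hrec, hc]
      change _ = -(_ / quantumInt ν (k + 2))
      field_simp
      ring

/-- `S` and `J` stand for left multiplications by tangles and for maps without unit coefficient. The
first makes the result a tangle, the second keeps it congruent to 1 and so nonzero. -/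
theorem wenzl_mem {ν : ℂ} {s : ℕ} {U : ℕ → R} (S : Subalgebra ℂ R)
    (hS : ∀ i, i + 1 < s → U i ∈ S) (J : Submodule ℂ R) (hJ : ∀ i x, i + 1 < s → U i * x ∈ J)
    (hJ' : ∀ y ∈ J, ∀ x, y * x ∈ J) (k : ℕ) (hk : k ≤ s) :
    wenzl ν U k ∈ S ∧ wenzl ν U k - 1 ∈ J := by
  induction k using Nat.twoStepInduction with
  | zero => simp [wenzl, S.one_mem]
  | one => simp [wenzl, S.one_mem]
  | more k _ ih =>
    obtain ⟨i1, i2⟩ := ih (by omega)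
    rw [wenzl]
    constructor
    · exact S.add_mem i1 (S.smul_mem (S.mul_mem (S.mul_mem i1 (hS k (by omega))) i1) _)
    · set P := wenzl ν U (k + 1)
      have : P * U k * P = (P - 1) * (U k * P) + U k * P := by noncomm_ring
      rw [add_sub_right_comm, this]
      exact J.add_mem i2 (J.smul_mem _ (J.add_mem (hJ' _ i2 _) (hJ k _ (by omega))))

end JonesWenzl

/-! ### Existence and uniqueness of the Jones-Wenzl projectors. -/

noncomputable section Projectors

variable {A B C : Type} [LinearOrder A] [LinearOrder B] [LinearOrder C]
variable [Fintype A] [Fintype B] [Fintype C]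

/-! ### The Jones-Wenzl projectors as tangles -/

/-- A linear map vanishing on all the diagrams other than the unit. -/
theorem map_eq_idCoeff_smul {W : Type*} [AddCommGroup W] [Module ℂ W]
    (f : (LinkDiagram A A →₀ ℂ) →ₗ[ℂ] W)
    (hf : ∀ D, D ≠ LinkDiagram.id A → f (Finsupp.single D 1) = 0) (T : LinkDiagram A A →₀ ℂ) :
    f T = idCoeff A T • f (Finsupp.single (LinkDiagram.id A) 1) := by
  induction T using Finsupp.induction_linear with
  | zero => simp
  | add _ _ h1 h2 => simp only [map_add, h1, h2, add_smul]
  | single D c =>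
    rw [idCoeff_single, ← mul_one c, ← smul_eq_mul, ← Finsupp.smul_single, map_smul]
    split_ifs with h
    · rw [h, smul_eq_mul, mul_one]
    · rw [hf D h, smul_zero, zero_smul]

theorem idCoeff_tangleMul_eq_zero (ν : ℂ) {U : LinkDiagram A A} {a b : A}
    (hU : U.mate (.inl a) = .inl b) (T : LinkDiagram A A →₀ ℂ) :
    idCoeff A (tangleMul ν (Finsupp.single U 1) T) = 0 := by
  induction T using Finsupp.induction_linear with
  | zero => simp
  | add _ _ h1 h2 => simp only [map_add, h1, h2, add_zero]
  | single D c =>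
    obtain ⟨F, n, h1, h2⟩ := exists_colourMatrix_mul U D
    rw [tangleMul_single, h2, map_smul, idCoeff_single, if_neg, smul_zero]
    rintro rfl
    have := mate_of_colourMatrix_mul h1 hU
    simp [LinkDiagram.id] at this

/-- The recursion is run among the endomorphisms of the space of tangles, where the generators act
by left multiplication. The projector is the value of the resulting endomorphism at the unit; its
unit coefficient is 1. -/
theorem exists_isJonesWenzl {ν : ℂ} {s : ℕ} (hQ : ∀ k, 1 ≤ k → k ≤ s → quantumInt ν k ≠ 0) :
    ∃ P, IsJonesWenzl ν s P := by
  set H := LinkDiagram (Fin s) (Fin s) →₀ ℂ with hH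
  set one : H := Finsupp.single (LinkDiagram.id (Fin s)) 1 with hone
  set U : ℕ → Module.End ℂ H := fun i =>
    if h : i + 1 < s then tangleMul ν (Finsupp.single (gen s i h) 1) else 0 with hU
  have hUi : ∀ (i : ℕ) (h : i + 1 < s), U i = tangleMul ν (Finsupp.single (gen s i h) 1) :=
    fun i h => dif_pos h
  have hmul : ∀ S T : H, (tangleMul ν S * tangleMul ν T : Module.End ℂ H) =
      tangleMul ν (tangleMul ν S T) := fun S T => LinearMap.ext fun X =>
    (tangleMul_assoc ν S T X).symm
  set W := wenzl ν U s with hW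
  let S : Subalgebra ℂ (Module.End ℂ H) :=
    { carrier := {f | ∀ x, f x = tangleMul ν (f one) x}
      mul_mem' := by
        intro f g hf hg x
        change f (g x) = tangleMul ν (f (g one)) x
        rw [hf (g x), hg x, hf (g one), tangleMul_assoc]
      add_mem' := by
        intro f g hf hg x
        change f x + g x = tangleMul ν (f one + g one) x
        rw [map_add, LinearMap.add_apply, ← hf x, ← hg x]
      algebraMap_mem' := by
        intro c x
        change c • x = tangleMul ν (c • one) x
        rw [map_smul, LinearMap.smul_apply, id_tangleMul] }
  let J : Submodule ℂ (Module.End ℂ H) :=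
    { carrier := {f | ∀ x, idCoeff (Fin s) (f x) = 0}
      zero_mem' := fun x => by simp
      add_mem' := by
        intro f g hf hg x
        rw [LinearMap.add_apply, map_add, hf x, hg x, add_zero]
      smul_mem' := by
        intro c f hf x
        rw [LinearMap.smul_apply, map_smul, hf x, smul_zero] }
  have hmem := wenzl_mem (ν := ν) (s := s) (U := U) S
    (by
      intro i hi x
      rw [hUi i hi, tangleMul_id])
    J
    (by
      intro i x hi y
      rw [hUi i hi]
      exact idCoeff_tangleMul_eq_zero ν (gen_isCap s i hi).left _)
    (by intro y hy x z; exact hy (x z)) s le_rfl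
  rw [← hW] at hmem
  have hspec : W * W = W ∧ ∀ i, i + 1 < s → U i * W = 0 ∧ W * U i = 0 := by
    rcases s with _ | s
    · refine ⟨by simp [hW, wenzl], by simp⟩
    · have := wenzl_spec (ν := ν) (s := s + 1) (U := U) ?_ ?_ ?_ hQ s le_rfl
      · exact ⟨this.2.2.1, fun i hi => this.2.2.2.1 i (by omega)⟩
      · intro i hi
        rw [hUi i hi, hmul, (gen_isCap _ i hi).tangleMul (gen_isCap _ i hi).left, map_smul]
      · intro i hi
        rw [hUi i (by omega), hUi (i + 1) (by omega), hmul, hmul,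
          (gen_isCap _ (i + 1) (by omega)).symm.braid (gen_isCap _ i (by omega)).symm]
        simp only [ne_eq, Fin.mk.injEq]
        omega
      · intro i j hij hj
        rw [hUi i (by omega), hUi j hj, hmul, hmul,
          (gen_isCap _ i (by omega)).commute (gen_isCap _ j hj)] <;>
        simp only [ne_eq, Fin.mk.injEq] <;> omega
  have hWx : ∀ x, tangleMul ν (W one) x = W x := fun x => (hmem.1 x).symm
  refine ⟨W one, ?_, ?_, fun i hi => ⟨?_, ?_⟩⟩
  · intro h0
    have h1 : idCoeff (Fin s) (W one - one) = 0 := hmem.2 one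
    rw [h0, map_sub, hone, idCoeff_single, if_pos rfl] at h1
    simp at h1
  · rw [hWx, ← Module.End.mul_apply, hspec.1]
  · rw [← hUi i hi, ← Module.End.mul_apply, (hspec.2 i hi).1, LinearMap.zero_apply]
  · have h1 : (Finsupp.single (gen s i hi) 1 : H) = U i one := by
      rw [hUi i hi, tangleMul_id]
    rw [hWx, h1, ← Module.End.mul_apply, (hspec.2 i hi).2, LinearMap.zero_apply]

/-- A link between two left nodes encloses a link between adjacent left nodes. -/
theorem LinkDiagram.exists_covBy_link (D : LinkDiagram A B) {a b : A} (hab : a < b)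
    (h : D.mate (.inl a) = .inl b) :
    ∃ c d, a ≤ c ∧ d ≤ b ∧ c ⋖ d ∧ D.mate (.inl c) = .inl d := by
  -- Induction on the number of nodes under the link: by planarity a node under it is linked to
  -- another one under it, which gives a shorter link.
  induction hn : (Finset.univ.filter fun x => a < x ∧ x < b).card using Nat.strong_induction_on
    generalizing a b with
  | _ n ih =>
  by_cases hcov : a ⋖ b
  · exact ⟨a, b, le_rfl, le_rfl, hcov, h⟩
  obtain ⟨x, hax, hxb⟩ := (not_covBy_iff hab).1 hcov
  have h1 := D.planar (.inl a) (.inl x) hax (by rw [h]; exact hxb)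
  rw [h] at h1
  rcases hx : D.mate (.inl x) with y | y
  · rw [hx] at h1
    have hyb : y < b := by
      refine lt_of_le_of_ne (not_lt.1 h1) ?_
      rintro rfl
      have := (D.mate_eq_comm.1 hx).symm.trans (D.mate_eq_comm.1 h)
      exact hax.ne (Sum.inl_injective this).symm
    have hay : a < y := by
      by_contra hya
      have hya' : y < a := by
        refine lt_of_le_of_ne (not_lt.1 hya) ?_
        rintro rfl
        rw [D.mate_eq_comm, h] at hx
        exact hxb.ne (Sum.inl_injective hx).symm
      have h2 := D.planar (.inl y) (.inl a) hya' (by rw [D.mate_eq_comm.1 hx]; exact hax)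
      rw [D.mate_eq_comm.1 hx, h] at h2
      exact h2 hxb
    have hxy : x ≠ y := by rintro rfl; exact D.mate_ne _ hx
    have step : ∀ c d, a < c → d < b → c < d → D.mate (.inl c) = .inl d →
        ∃ c d, a ≤ c ∧ d ≤ b ∧ c ⋖ d ∧ D.mate (.inl c) = .inl d := by
      intro c d hac hdb hcd hm
      obtain ⟨e, f, h3, h4, h5, h6⟩ := ih _ (by
        rw [← hn]
        apply Finset.card_lt_card
        rw [Finset.ssubset_iff_of_subset]
        · exact ⟨c, by simp [hac, hcd.trans hdb], by simp⟩
        · intro z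
          simp only [Finset.mem_filter, Finset.mem_univ, true_and]
          exact fun ⟨k1, k2⟩ => ⟨hac.trans k1, k2.trans hdb⟩) hcd hm rfl
      exact ⟨e, f, hac.le.trans h3, h4.trans hdb.le, h5, h6⟩
    rcases lt_or_gt_of_ne hxy with hlt | hlt
    · exact step x y hax hyb hlt hx
    · exact step y x hay hxb hlt (D.mate_eq_comm.1 hx)
  · rw [hx] at h1
    exact absurd trivial h1

theorem exists_left_link_of_ne_id {s : ℕ} {D : LinkDiagram (Fin s) (Fin s)}
    (h : D ≠ LinkDiagram.id (Fin s)) : ∃ a b, D.mate (.inl a) = .inl b := by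
  have h1 : ¬ NoRightLink D.flip := fun h1 => h (by
    rw [← D.flip_flip, h1.eq_id, LinkDiagram.flip_id])
  simp only [NoRightLink, not_forall, not_not] at h1
  obtain ⟨a, b, hab⟩ := h1
  refine ⟨a, b, ?_⟩
  rw [LinkDiagram.flip_mate_inr] at hab
  rw [← Sum.swap_swap (D.mate _), hab]; rfl

theorem exists_right_link_of_ne_id {s : ℕ} {D : LinkDiagram (Fin s) (Fin s)}
    (h : D ≠ LinkDiagram.id (Fin s)) : ∃ a b, D.mate (.inr a) = .inr b := by
  have h1 : ¬ NoRightLink D := fun h1 => h h1.eq_id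
  simpa only [NoRightLink, not_forall, not_not] using h1

/-- An innermost link of `D` joins adjacent nodes, so a generator multiplies `D` by ν; since P
annihilates the generator, ν P D = 0. A link needs at least two nodes, and then ν ≠ 0. -/
theorem IsJonesWenzl.tangleMul_eq_zero {ν : ℂ} {s : ℕ} {P : LinkDiagram (Fin s) (Fin s) →₀ ℂ}
    (hP : IsJonesWenzl ν s P) (hν : 2 ≤ s → ν ≠ 0) {D : LinkDiagram (Fin s) B} {a b : Fin s}
    (h : D.mate (.inl a) = .inl b) : tangleMul ν P (Finsupp.single D 1) = 0 := by
  wlog hab : a < b generalizing a b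
  · refine this (D.mate_eq_comm.1 h) (lt_of_le_of_ne (not_lt.1 hab) ?_)
    rintro rfl
    exact D.mate_ne _ h
  obtain ⟨c, d, -, -, hcd, hm⟩ := D.exists_covBy_link hab h
  have hd : (d : ℕ) = c + 1 := by
    have h1 : (c : ℕ) < d := hcd.1
    by_contra hne
    exact hcd.2 (c := ⟨c + 1, by omega⟩) (by simp [Fin.lt_def]) (by
      rw [Fin.lt_def]; simp only; omega)
  have hc : (c : ℕ) + 1 < s := by rw [← hd]; exact d.2
  have hdd : d = ⟨c + 1, hc⟩ := Fin.ext hd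
  subst hdd
  have h1 := (gen_isCap s c hc).tangleMul hm ν
  have h2 : ν • tangleMul ν P (Finsupp.single D 1) = 0 := by
    rw [← map_smul, ← h1, ← tangleMul_assoc, (hP.2.2 c hc).2]
    simp
  exact (smul_eq_zero.1 h2).resolve_left (hν (by omega))

/-- P annihilates every diagram but the unit, so P P is the unit coefficient times P; idempotence
and P ≠ 0 make that coefficient 1. -/
theorem IsJonesWenzl.idCoeff_eq_one {ν : ℂ} {s : ℕ} {P : LinkDiagram (Fin s) (Fin s) →₀ ℂ}
    (hP : IsJonesWenzl ν s P) (hν : 2 ≤ s → ν ≠ 0) : idCoeff (Fin s) P = 1 := by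
  have h := map_eq_idCoeff_smul (tangleMul ν P) (fun D hD => by
    obtain ⟨a, b, h⟩ := exists_left_link_of_ne_id hD
    exact hP.tangleMul_eq_zero hν h) P
  rw [hP.2.1, tangleMul_id] at h
  have h2 : (1 - idCoeff (Fin s) P) • P = 0 := by rw [sub_smul, one_smul, ← h, sub_self]
  have := (smul_eq_zero.1 h2).resolve_right hP.1
  linear_combination -this

theorem gen_flip (s i : ℕ) (hi : i + 1 < s) : (gen s i hi).flip = gen s i hi := by
  refine LinkDiagram.eq_of_compatible fun σ τ h => ?_
  rw [compatible_flip] at h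
  rw [(gen_isCap s i hi).compatible_iff] at *
  exact ⟨h.2.1, h.1, fun x h1 h2 => (h.2.2 x h1 h2).symm⟩

theorem IsJonesWenzl.dagger {ν : ℂ} {s : ℕ} {P : LinkDiagram (Fin s) (Fin s) →₀ ℂ}
    (hP : IsJonesWenzl ν s P) : IsJonesWenzl ν s (dagger P) := by
  refine ⟨fun h => hP.1 ?_, ?_, fun i hi => ⟨?_, ?_⟩⟩
  · rw [← dagger_dagger P, h, map_zero]
  · rw [← dagger_tangleMul, hP.2.1]
  · have := congrArg ValencedTL.dagger (hP.2.2 i hi).2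
    rwa [dagger_tangleMul, dagger_single, gen_flip, map_zero] at this
  · have := congrArg ValencedTL.dagger (hP.2.2 i hi).1
    rwa [dagger_tangleMul, dagger_single, gen_flip, map_zero] at this

/-- The product P P' equals P when only the unit term of P' survives, and P' when only that of P
does. -/
theorem IsJonesWenzl.unique {ν : ℂ} {s : ℕ} {P P' : LinkDiagram (Fin s) (Fin s) →₀ ℂ}
    (hP : IsJonesWenzl ν s P) (hP' : IsJonesWenzl ν s P') (hν : 2 ≤ s → ν ≠ 0) : P = P' := by
  have h1 := map_eq_idCoeff_smul (tangleMul ν P) (fun D hD => by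
    obtain ⟨a, b, h⟩ := exists_left_link_of_ne_id hD
    exact hP.tangleMul_eq_zero hν h) P'
  have h2 := map_eq_idCoeff_smul ((tangleMul ν).flip P') (fun D hD => by
    rw [LinearMap.flip_apply, ← dagger_dagger (tangleMul ν _ P'), dagger_tangleMul, dagger_single]
    obtain ⟨a, b, h⟩ := exists_right_link_of_ne_id hD
    rw [hP'.dagger.tangleMul_eq_zero hν (a := a) (b := b), map_zero]
    rw [LinkDiagram.flip_mate_inl, h]; rfl) P
  rw [hP'.idCoeff_eq_one hν, one_smul, tangleMul_id] at h1
  rw [hP.idCoeff_eq_one hν, one_smul, LinearMap.flip_apply, LinearMap.flip_apply,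
    id_tangleMul] at h2
  exact h1.symm.trans h2

end Projectors

/-! ### Stacks of tangles -/

noncomputable section Stack

variable {d : ℕ} (ς : Fin d → ℕ)

/-- The colourings of the link ends at a node. -/
def block {ς : Fin d → ℕ} (σ : Ends ς → Bool) (i : Fin d) : Fin (ς i) → Bool :=
  fun k => σ (toLex ⟨i, k⟩)

/-- Colourings of the link ends as families of colourings of the ends at each node. -/
def blockEquiv : (Ends ς → Bool) ≃ ∀ i, Fin (ς i) → Bool where
  toFun σ := block σ
  invFun f x := f (ofLex x).1 (ofLex x).2
  left_inv _ := rfl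
  right_inv _ := rfl

theorem compatible_stack_iff (D : ∀ i, LinkDiagram (Fin (ς i)) (Fin (ς i))) (σ τ : Ends ς → Bool) :
    Compatible (stack ς D) σ τ ↔ ∀ i, Compatible (D i) (block σ i) (block τ i) := by
  have hb : ∀ i (u : Fin (ς i) ⊕ Fin (ς i)), Sum.elim σ τ (blockIncl ς i u) =
      Sum.elim (block σ i) (block τ i) u := by
    rintro i (u | u) <;> rfl
  have hs : ∀ i (u : Fin (ς i) ⊕ Fin (ς i)), (stack ς D).mate (blockIncl ς i u) =
      blockIncl ς i ((D i).mate u) := stackMate_blockIncl ς D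
  constructor
  · intro h i u
    rw [← hb, ← hb, ← hs]
    exact h _
  · intro h x
    obtain ⟨i, u, rfl⟩ := exists_blockIncl ς x
    rw [hs, hb, hb]
    exact h i u

/-- The colourings at different nodes are chosen independently, so the counts multiply. -/
theorem colourMatrix_stack_mul {D E F : ∀ i, LinkDiagram (Fin (ς i)) (Fin (ς i))} {n : Fin d → ℕ}
    (h : ∀ i, colourMatrix (D i) * colourMatrix (E i) = 2 ^ n i • colourMatrix (F i)) :
    colourMatrix (stack ς D) * colourMatrix (stack ς E) =
      2 ^ (∑ i, n i) • colourMatrix (stack ς F) := by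
  refine Matrix.ext fun σ τ => (colourMatrix_mul_apply _ _ σ τ).trans ?_
  rw [Matrix.smul_apply, colourMatrix_apply]
  simp only [compatible_stack_iff]
  have e : {ρ : Ends ς → Bool // (∀ i, Compatible (D i) (block σ i) (block ρ i)) ∧
      ∀ i, Compatible (E i) (block ρ i) (block τ i)} ≃
      ∀ i, {ρ : Fin (ς i) → Bool // Compatible (D i) (block σ i) ρ ∧
        Compatible (E i) ρ (block τ i)} :=
    { toFun := fun ρ i => ⟨block ρ.1 i, ρ.2.1 i, ρ.2.2 i⟩
      invFun := fun f => ⟨(blockEquiv ς).symm fun i => (f i).1,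
        fun i => (f i).2.1, fun i => (f i).2.2⟩
      left_inv := fun _ => rfl
      right_inv := fun _ => rfl }
  rw [Nat.card_congr e, Nat.card_pi]
  have hi : ∀ i, Nat.card {ρ : Fin (ς i) → Bool // Compatible (D i) (block σ i) ρ ∧
        Compatible (E i) ρ (block τ i)} =
      2 ^ n i * if Compatible (F i) (block σ i) (block τ i) then 1 else 0 := by
    intro i
    rw [← colourMatrix_mul_apply, h i]; rfl
  rw [Finset.prod_congr rfl fun i _ => hi i, Finset.prod_mul_distrib, Finset.prod_pow_eq_pow_sum,
    smul_eq_mul]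
  congr 1
  rw [Finset.prod_ite_zero]
  simp

/-- The multilinear extension of `stack`. -/
def stackTangle (f : ∀ i, LinkDiagram (Fin (ς i)) (Fin (ς i)) →₀ ℂ) :
    LinkDiagram (Ends ς) (Ends ς) →₀ ℂ :=
  ∑ D : (∀ i, LinkDiagram (Fin (ς i)) (Fin (ς i))), (∏ i, f i (D i)) • Finsupp.single (stack ς D) 1

theorem compositeProjector_eq (ν : ℂ) :
    compositeProjector ς ν = stackTangle ς fun i => jonesWenzl ν (ς i) := rfl

theorem stackTangle_single (D : ∀ i, LinkDiagram (Fin (ς i)) (Fin (ς i))) (c : Fin d → ℂ) :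
    stackTangle ς (fun i => Finsupp.single (D i) (c i)) =
      (∏ i, c i) • Finsupp.single (stack ς D) 1 := by
  rw [stackTangle, Finset.sum_eq_single D]
  · simp
  · intro E _ hE
    obtain ⟨i, hi⟩ := Function.ne_iff.1 hE
    rw [Finset.prod_eq_zero (Finset.mem_univ i), zero_smul]
    exact Finsupp.single_eq_of_ne hi
  · simp

theorem tangleMul_single_stack (ν : ℂ) (D E : ∀ i, LinkDiagram (Fin (ς i)) (Fin (ς i))) :
    tangleMul ν (Finsupp.single (stack ς D) 1) (Finsupp.single (stack ς E) 1) =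
      stackTangle ς fun i => concat ν (D i) (E i) := by
  choose F n h1 h2 using fun i => exists_colourMatrix_mul (D i) (E i)
  rw [tangleMul_single_eq (colourMatrix_stack_mul ς h1)]
  simp only [h2]
  rw [stackTangle_single, Finset.prod_pow_eq_pow_sum]

theorem tangleMul_single_right {A B C : Type} [LinearOrder A] [LinearOrder B] [LinearOrder C]
    [Fintype A] [Fintype B] [Fintype C] (ν : ℂ) (T : LinkDiagram A B →₀ ℂ) (E : LinkDiagram B C) :
    tangleMul ν T (Finsupp.single E 1) = ∑ D, T D • concat ν D E := by
  conv_lhs => rw [← Finsupp.univ_sum_single T]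
  rw [map_sum, LinearMap.sum_apply]
  refine Finset.sum_congr rfl fun D _ => ?_
  rw [tangleMul_single, mul_one]

theorem stackTangle_mul_stack (ν : ℂ) (f : ∀ i, LinkDiagram (Fin (ς i)) (Fin (ς i)) →₀ ℂ)
    (E : ∀ i, LinkDiagram (Fin (ς i)) (Fin (ς i))) :
    tangleMul ν (stackTangle ς f) (Finsupp.single (stack ς E) 1) =
      stackTangle ς fun i => tangleMul ν (f i) (Finsupp.single (E i) 1) := by
  have h : ∀ F : (∀ i, LinkDiagram (Fin (ς i)) (Fin (ς i))),
      (∏ i, tangleMul ν (f i) (Finsupp.single (E i) 1) (F i)) =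
        ∑ D : (∀ i, LinkDiagram (Fin (ς i)) (Fin (ς i))),
          (∏ i, f i (D i)) * ∏ i, concat ν (D i) (E i) (F i) := by
    intro F
    simp only [tangleMul_single_right, Finsupp.finsetSum_apply, Finsupp.smul_apply, smul_eq_mul]
    rw [Finset.prod_univ_sum, Fintype.piFinset_univ]
    exact Finset.sum_congr rfl fun D _ => Finset.prod_mul_distrib
  rw [stackTangle, stackTangle, map_sum, LinearMap.sum_apply]
  simp only [map_smul, LinearMap.smul_apply, tangleMul_single_stack, h, Finset.sum_smul, mul_smul]
  rw [Finset.sum_comm]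
  refine Finset.sum_congr rfl fun D _ => ?_
  rw [stackTangle, Finset.smul_sum]

theorem stack_flip (D : ∀ i, LinkDiagram (Fin (ς i)) (Fin (ς i))) :
    (stack ς D).flip = stack ς fun i => (D i).flip := by
  refine LinkDiagram.eq_of_compatible fun σ τ h => ?_
  rw [compatible_flip] at h
  rw [compatible_stack_iff] at *
  exact fun i => (compatible_flip _ _ _).2 (h i)

theorem stack_id : stack ς (fun i => LinkDiagram.id (Fin (ς i))) = LinkDiagram.id (Ends ς) := by
  refine LinkDiagram.eq_of_compatible fun σ τ h => ?_
  rw [compatible_stack_iff] at h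
  rw [compatible_id]
  funext x
  exact congrFun ((compatible_id _ _).1 (h (ofLex x).1)) (ofLex x).2

theorem dagger_stackTangle (f : ∀ i, LinkDiagram (Fin (ς i)) (Fin (ς i)) →₀ ℂ) :
    dagger (stackTangle ς f) = stackTangle ς fun i => dagger (f i) := by
  have hd : ∀ i (D : LinkDiagram (Fin (ς i)) (Fin (ς i))), dagger (f i) D = f i D.flip := by
    intro i D
    conv_lhs => rw [← D.flip_flip]
    exact Finsupp.mapDomain_apply (Function.LeftInverse.injective LinkDiagram.flip_flip) _ _
  let e : (∀ i, LinkDiagram (Fin (ς i)) (Fin (ς i))) ≃ (∀ i, LinkDiagram (Fin (ς i)) (Fin (ς i))) :=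
    { toFun := fun D i => (D i).flip
      invFun := fun D i => (D i).flip
      left_inv := fun D => by simp
      right_inv := fun D => by simp }
  rw [stackTangle, stackTangle, map_sum, ← e.sum_comp]
  refine Finset.sum_congr rfl fun D _ => ?_
  rw [map_smul, dagger_single, stack_flip]
  simp [e, hd]

/-! ### The composite projector -/

/-- The Jones-Wenzl projectors of the sizes of `ς` exist, and the loop weight is nonzero if one of
these sizes is at least `2`. -/
def HasProjectors (ν : ℂ) : Prop :=
  ∀ i, IsJonesWenzl ν (ς i) (jonesWenzl ν (ς i)) ∧ (2 ≤ ς i → ν ≠ 0)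

theorem hasProjectors {q : ℂ} (hq : q ≠ 0) (hς : ∀ i, (ς i : ℕ∞) < pbar q) :
    HasProjectors ς (-q - q⁻¹) := by
  intro i
  have hQ := fun k hk hks => quantumInt_ne_zero hq (hς i) (k := k) hk hks
  -- The loop weight is -[2], so it is nonzero as soon as a valence reaches 2.
  refine ⟨?_, fun h2 h0 => hQ 2 (by omega) h2 (by simp [quantumInt, h0])⟩
  have h := exists_isJonesWenzl hQ
  rw [jonesWenzl, dif_pos h]
  exact h.choose_spec

variable {ς} {B : Type} [LinearOrder B] [Fintype B]

/-- A link joins two left ends at the same node. -/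
def LeftLoopLink (D : LinkDiagram (Ends ς) B) : Prop :=
  ∃ x y, D.mate (.inl x) = .inl y ∧ node ς x = node ς y

variable {ν : ℂ}

/-- A loop link encloses a link between adjacent ends, and these sit at the same node because the
ends of a node form an interval. The stack of a generator there with units elsewhere multiplies `D`
by ν and is annihilated by one factor of the composite projector. -/
theorem HasProjectors.tangleMul_eq_zero (h : HasProjectors ς ν) {D : LinkDiagram (Ends ς) B}
    (hD : LeftLoopLink D) : tangleMul ν (compositeProjector ς ν) (Finsupp.single D 1) = 0 := by
  obtain ⟨x, y, hxy, hn⟩ := hD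
  wlog hlt : x < y generalizing x y
  · refine this y x (D.mate_eq_comm.1 hxy) hn.symm (lt_of_le_of_ne (not_lt.1 hlt) ?_)
    rintro rfl
    exact D.mate_ne _ hxy
  obtain ⟨u, v, hxu, hvy, huv, hm⟩ := D.exists_covBy_link hlt hxy
  have hmono : ∀ {z w : Ends ς}, z ≤ w → node ς z ≤ node ς w := by
    rintro ⟨i, k⟩ ⟨j, l⟩ hzw
    rcases hzw.lt_or_eq with hlt | heq
    · rcases (toLex_lt_toLex_iff ς i j k l).1 hlt with hij | ⟨hij, -⟩
      · exact hij.le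
      · exact hij.le
    · rw [heq]
  have hu : node ς u = node ς x :=
    le_antisymm ((hmono (huv.1.le.trans hvy)).trans hn.symm.le) (hmono hxu)
  have hv : node ς v = node ς x :=
    le_antisymm ((hmono hvy).trans hn.symm.le) ((hmono (hxu.trans huv.1.le)))
  obtain ⟨i, k⟩ := u
  obtain ⟨j, l⟩ := v
  obtain rfl : i = j := hu.trans hv.symm
  have hkl : k < l := by
    rcases (toLex_lt_toLex_iff ς i i k l).1 huv.1 with hii | ⟨_, hkl⟩
    · exact absurd hii (lt_irrefl _)
    · exact hkl
  have hl : (l : ℕ) = k + 1 := by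
    have h1 : (k : ℕ) < l := hkl
    by_contra hne
    exact huv.2 (c := toLex ⟨i, ⟨k + 1, by omega⟩⟩)
      ((toLex_lt_toLex_iff ς _ _ _ _).2 (Or.inr ⟨rfl, by simp [Fin.lt_def]⟩))
      ((toLex_lt_toLex_iff ς _ _ _ _).2 (Or.inr ⟨rfl, by
        rw [Fin.lt_def]; simp only; omega⟩))
  have hk : (k : ℕ) + 1 < ς i := by rw [← hl]; exact l.2
  obtain rfl : l = ⟨k + 1, hk⟩ := Fin.ext hl
  set E : ∀ j, LinkDiagram (Fin (ς j)) (Fin (ς j)) :=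
    Function.update (fun j => LinkDiagram.id (Fin (ς j))) i (gen (ς i) k hk) with hE
  have hEi : E i = gen (ς i) k hk := Function.update_self _ _ _
  have hcap : IsCap (stack ς E) (toLex ⟨i, k⟩) (toLex ⟨i, ⟨k + 1, hk⟩⟩) := by
    have hg := gen_isCap (ς i) k hk
    have hs : ∀ j (u : Fin (ς j) ⊕ Fin (ς j)), (stack ς E).mate (blockIncl ς j u) =
      blockIncl ς j ((E j).mate u) := stackMate_blockIncl ς E
    refine ⟨huv.1.ne, ?_, ?_, ?_⟩
    · refine (hs i (.inl k)).trans ?_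
      rw [hEi, hg.left]; rfl
    · refine (hs i (.inr k)).trans ?_
      rw [hEi, hg.right]; rfl
    · rintro ⟨j, m⟩ h1 h2
      refine (hs j (.inl m)).trans ?_
      by_cases hij : j = i
      · subst hij
        rw [hEi, hg.across]
        · rfl
        · rintro rfl; exact h1 rfl
        · rintro rfl; exact h2 rfl
      · have : E j = LinkDiagram.id (Fin (ς j)) := Function.update_of_ne hij _ _
        rw [this]; rfl
  have h1 := hcap.tangleMul hm ν
  have h0 : tangleMul ν (compositeProjector ς ν) (Finsupp.single (stack ς E) 1) = 0 := by
    rw [compositeProjector_eq, stackTangle_mul_stack, stackTangle]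
    refine Finset.sum_eq_zero fun F _ => ?_
    rw [Finset.prod_eq_zero (Finset.mem_univ i), zero_smul]
    rw [hEi, ((h i).1.2.2 k hk).2]
    rfl
  have h2 : ν • tangleMul ν (compositeProjector ς ν) (Finsupp.single D 1) = 0 := by
    rw [← map_smul, ← h1, ← tangleMul_assoc, h0]
    simp
  exact (smul_eq_zero.1 h2).resolve_left ((h i).2 (by omega))

/-- The composite projector is the unit up to diagrams with loop links on both sides. -/
theorem HasProjectors.map_eq (h : HasProjectors ς ν) {W : Type*} [AddCommGroup W] [Module ℂ W]
    (f : (LinkDiagram (Ends ς) (Ends ς) →₀ ℂ) →ₗ[ℂ] W)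
    (hf : ∀ D, LeftLoopLink D → LeftLoopLink D.flip → f (Finsupp.single D 1) = 0) :
    f (compositeProjector ς ν) = f (Finsupp.single (LinkDiagram.id (Ends ς)) 1) := by
  rw [compositeProjector, map_sum, Finset.sum_eq_single fun i => LinkDiagram.id (Fin (ς i))]
  · rw [stack_id, map_smul]
    have : ∏ i, jonesWenzl ν (ς i) (LinkDiagram.id (Fin (ς i))) = 1 :=
      Finset.prod_eq_one fun i _ => (h i).1.idCoeff_eq_one (h i).2
    rw [this, one_smul]
  · intro D _ hD
    -- A stacked factor other than the unit has a link within its node on each of the two sides.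
    obtain ⟨i, hi⟩ := Function.ne_iff.1 hD
    rw [map_smul, hf, smul_zero]
    · obtain ⟨a, b, hab⟩ := exists_left_link_of_ne_id hi
      refine ⟨toLex ⟨i, a⟩, toLex ⟨i, b⟩, ?_, rfl⟩
      exact (stackMate_blockIncl ς D i (.inl a)).trans (by rw [hab]; rfl)
    · obtain ⟨a, b, hab⟩ := exists_right_link_of_ne_id hi
      refine ⟨toLex ⟨i, a⟩, toLex ⟨i, b⟩, ?_, rfl⟩
      rw [LinkDiagram.flip_mate_inl]
      have : (stack ς D).mate (.inr (toLex ⟨i, a⟩)) = .inr (toLex ⟨i, b⟩) :=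
        (stackMate_blockIncl ς D i (.inr a)).trans (by rw [hab]; rfl)
      rw [this]; rfl
  · simp

theorem HasProjectors.dagger_eq (h : HasProjectors ς ν) :
    dagger (compositeProjector ς ν) = compositeProjector ς ν := by
  rw [compositeProjector_eq, dagger_stackTangle]
  congr 1
  funext i
  exact (h i).1.dagger.unique (h i).1 (h i).2

theorem HasProjectors.mul_self (h : HasProjectors ς ν) :
    tangleMul ν (compositeProjector ς ν) (compositeProjector ς ν) = compositeProjector ς ν := by
  rw [h.map_eq (tangleMul ν (compositeProjector ς ν)) fun D hD _ => h.tangleMul_eq_zero hD,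
    tangleMul_id]

end Stack

/-! ### The valenced algebra and its cellular structure. -/

noncomputable section Valenced

variable {d : ℕ} {ς : Fin d → ℕ} {ν : ℂ} {B : Type} [LinearOrder B] [Fintype B]

/-! ### Loop links and projections -/

theorem diagramLoopLink_iff (D : LinkDiagram (Ends ς) (Ends ς)) :
    DiagramLoopLink ς D ↔ LeftLoopLink D ∨ LeftLoopLink D.flip := by
  refine or_congr Iff.rfl (exists_congr fun x => exists_congr fun y => and_congr_left fun _ => ?_)
  rw [LinkDiagram.flip_mate_inl]
  constructor
  · intro h; rw [h]; rfl
  · intro h; rw [← Sum.swap_swap (D.mate _), h]; rfl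

theorem LeftLoopLink.of_mul {C : Type} [LinearOrder C] [Fintype C] {D : LinkDiagram (Ends ς) B}
    {E : LinkDiagram B C} {F : LinkDiagram (Ends ς) C} {n : ℕ}
    (h : colourMatrix D * colourMatrix E = 2 ^ n • colourMatrix F) (hD : LeftLoopLink D) :
    LeftLoopLink F := by
  obtain ⟨x, y, hxy, hn⟩ := hD
  exact ⟨x, y, mate_of_colourMatrix_mul h hxy, hn⟩

theorem HasProjectors.tangleMul_eq_zero_right (h : HasProjectors ς ν)
    {D : LinkDiagram B (Ends ς)} (hD : LeftLoopLink D.flip) :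
    tangleMul ν (Finsupp.single D 1) (compositeProjector ς ν) = 0 := by
  rw [← dagger_dagger (tangleMul ν _ _), dagger_tangleMul, h.dagger_eq, dagger_single,
    h.tangleMul_eq_zero hD, map_zero]

theorem tangleProj_single_of_not {D : LinkDiagram (Ends ς) (Ends ς)} (h : DiagramLoopLink ς D)
    (c : ℂ) : tangleProj ς (Finsupp.single D c) = 0 := by
  simp [tangleProj, h]

theorem tangleProj_single {D : LinkDiagram (Ends ς) (Ends ς)} (h : ¬ DiagramLoopLink ς D)
    (c : ℂ) : tangleProj ς (Finsupp.single D c) = Finsupp.single ⟨D, h⟩ c := by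
  simp [tangleProj, h]

@[simp]
theorem tangleLift_single (D : ValDiagram ς) (c : ℂ) :
    tangleLift ς (Finsupp.single D c) = Finsupp.single D.1 c := by
  simp [tangleLift]

@[simp]
theorem tangleProj_tangleLift (T : ValTangle ς) : tangleProj ς (tangleLift ς T) = T := by
  induction T using Finsupp.induction_linear with
  | zero => simp
  | add _ _ h1 h2 => simp only [map_add, h1, h2]
  | single D c => rw [tangleLift_single, tangleProj_single D.2]

/-- Projecting and lifting back only drops diagrams with loop links, which `f` does not see. This
removes the intermediate truncations from iterated products. -/
theorem map_tangleLift_tangleProj {W : Type*} [AddCommGroup W] [Module ℂ W]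
    (f : (LinkDiagram (Ends ς) (Ends ς) →₀ ℂ) →ₗ[ℂ] W)
    (hf : ∀ D, LeftLoopLink D → f (Finsupp.single D 1) = 0)
    (hf' : ∀ D : LinkDiagram (Ends ς) (Ends ς), LeftLoopLink D.flip → f (Finsupp.single D 1) = 0)
    (T : LinkDiagram (Ends ς) (Ends ς) →₀ ℂ) : f (tangleLift ς (tangleProj ς T)) = f T := by
  induction T using Finsupp.induction_linear with
  | zero => simp
  | add _ _ h1 h2 => simp only [map_add, h1, h2]
  | single D c =>
    by_cases h : DiagramLoopLink ς D
    · rw [tangleProj_single_of_not h, map_zero, map_zero, ← mul_one c, ← smul_eq_mul,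
        ← Finsupp.smul_single, map_smul]
      rcases (diagramLoopLink_iff D).1 h with h | h
      · rw [hf D h, smul_zero]
      · rw [hf' D h, smul_zero]
    · rw [tangleProj_single h, tangleLift_single]

theorem tangleProj_mul_left {D : LinkDiagram (Ends ς) B} (h : LeftLoopLink D)
    (X : LinkDiagram B (Ends ς) →₀ ℂ) :
    tangleProj ς (tangleMul ν (Finsupp.single D 1) X) = 0 := by
  induction X using Finsupp.induction_linear with
  | zero => simp
  | add _ _ h1 h2 => simp only [map_add, h1, h2, add_zero]
  | single E c =>
    obtain ⟨F, n, h1, h2⟩ := exists_colourMatrix_mul D E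
    rw [tangleMul_single, h2, map_smul,
      tangleProj_single_of_not ((diagramLoopLink_iff F).2 (Or.inl (h.of_mul h1))), smul_zero]

theorem tangleProj_mul_right {D : LinkDiagram B (Ends ς)} (h : LeftLoopLink D.flip)
    (X : LinkDiagram (Ends ς) B →₀ ℂ) :
    tangleProj ς (tangleMul ν X (Finsupp.single D 1)) = 0 := by
  induction X using Finsupp.induction_linear with
  | zero => simp
  | add _ _ h1 h2 => simp only [map_add, LinearMap.add_apply, h1, h2, add_zero]
  | single E c =>
    obtain ⟨F, n, h1, h2⟩ := exists_colourMatrix_mul E D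
    have h3 : colourMatrix D.flip * colourMatrix E.flip = 2 ^ n • colourMatrix F.flip := by
      rw [colourMatrix_flip, colourMatrix_flip, colourMatrix_flip, ← Matrix.transpose_mul, h1,
        Matrix.transpose_smul]
    rw [tangleMul_single, h2, map_smul,
      tangleProj_single_of_not ((diagramLoopLink_iff F).2 (Or.inr (h.of_mul h3))), smul_zero]

/-! ### The valenced Temperley-Lieb algebra -/

/-- Left loop links of `S` survive to the final projection, and right ones face the composite
projector; both give zero. -/
theorem valMul_proj_left (h : HasProjectors ς ν) (S : LinkDiagram (Ends ς) (Ends ς) →₀ ℂ)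
    (U : ValTangle ς) : valMul ς ν (tangleProj ς S) U =
      tangleProj ς (tangleMul ν (tangleMul ν S (compositeProjector ς ν)) (tangleLift ς U)) := by
  refine map_tangleLift_tangleProj ((tangleProj ς).comp
    (((tangleMul ν).flip (tangleLift ς U)).comp
      ((tangleMul ν).flip (compositeProjector ς ν)))) ?_ ?_ S
  · intro D hD
    simp only [LinearMap.comp_apply, LinearMap.flip_apply]
    rw [tangleMul_assoc, tangleProj_mul_left hD]
  · intro D hD
    simp only [LinearMap.comp_apply, LinearMap.flip_apply]
    rw [h.tangleMul_eq_zero_right hD]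
    simp

theorem valMul_proj_right (h : HasProjectors ς ν) (T : ValTangle ς)
    (S : LinkDiagram (Ends ς) (Ends ς) →₀ ℂ) : valMul ς ν T (tangleProj ς S) =
      tangleProj ς (tangleMul ν (tangleMul ν (tangleLift ς T) (compositeProjector ς ν)) S) := by
  refine map_tangleLift_tangleProj ((tangleProj ς).comp
    (tangleMul ν (tangleMul ν (tangleLift ς T) (compositeProjector ς ν)))) ?_ ?_ S
  · intro D hD
    simp only [LinearMap.comp_apply]
    rw [tangleMul_assoc, h.tangleMul_eq_zero hD]
    simp
  · intro D hD
    exact tangleProj_mul_right hD _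

theorem valMul_assoc (h : HasProjectors ς ν) (T U V : ValTangle ς) :
    valMul ς ν (valMul ς ν T U) V = valMul ς ν T (valMul ς ν U V) := by
  conv_lhs => rw [show valMul ς ν T U = tangleProj ς _ from rfl, valMul_proj_left h]
  conv_rhs => rw [show valMul ς ν U V = tangleProj ς _ from rfl, valMul_proj_right h]
  simp only [tangleMul_assoc]

/-- In the composite projector every term but the unit shows a loop link on the outer side, where
the final projection removes it. -/
theorem valOne_valMul (h : HasProjectors ς ν) (T : ValTangle ς) :
    valMul ς ν (valOne ς) T = T := by
  rw [valOne, valMul_proj_left h, id_tangleMul]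
  refine (h.map_eq ((tangleProj ς).comp ((tangleMul ν).flip (tangleLift ς T))) ?_).trans ?_
  · intro D hD _
    exact tangleProj_mul_left hD _
  · rw [LinearMap.comp_apply, LinearMap.flip_apply, id_tangleMul, tangleProj_tangleLift]

theorem valMul_valOne (h : HasProjectors ς ν) (T : ValTangle ς) :
    valMul ς ν T (valOne ς) = T := by
  rw [valOne, valMul_proj_right h, tangleMul_id]
  refine (h.map_eq ((tangleProj ς).comp (tangleMul ν (tangleLift ς T))) ?_).trans ?_
  · intro D _ hD
    exact tangleProj_mul_right hD _
  · rw [LinearMap.comp_apply, tangleMul_id, tangleProj_tangleLift]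

/-! ### Valenced link states as tangles -/

/-- A valenced link state as a tangle with `r` right nodes. -/
def stateTangle (ς : Fin d → ℕ) (r : ℕ) : ValState ς r →ₗ[ℂ] (LinkDiagram (Ends ς) (Fin r) →₀ ℂ) :=
  (ofState r).comp (stateLift ς r)

/-- The valenced link state of a tangle with `r` right nodes. -/
def tangleState (ς : Fin d → ℕ) (r : ℕ) : (LinkDiagram (Ends ς) (Fin r) →₀ ℂ) →ₗ[ℂ] ValState ς r :=
  (stateProj ς r).comp (toState r)

variable {r : ℕ}

theorem patternLoopLink_iff (α : LinkPattern (Ends ς) r) :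
    PatternLoopLink ς α ↔ LeftLoopLink (ofPattern α) := by
  constructor
  · rintro ⟨x, hx, hn⟩
    exact ⟨x, α.mate x, ofPattern_mate_of_ne α hx, hn.symm⟩
  · rintro ⟨x, y, hxy, hn⟩
    have hx : α.mate x = y := by
      rw [← ofPattern_leftMate, LinkDiagram.leftMate_of_inl hxy]
    refine ⟨x, ?_, by rw [hx, hn]⟩
    rw [hx]
    rintro rfl
    exact (ofPattern α).mate_ne _ hxy

theorem stateTangle_single (α : ValPattern ς r) (c : ℂ) :
    stateTangle ς r (Finsupp.single α c) = Finsupp.single (ofPattern α.1) c := by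
  simp [stateTangle, stateLift]

theorem tangleState_of_leftLoopLink {D : LinkDiagram (Ends ς) (Fin r)} (h : LeftLoopLink D)
    (c : ℂ) : tangleState ς r (Finsupp.single D c) = 0 := by
  rw [tangleState, LinearMap.comp_apply]
  by_cases hD : NoRightLink D
  · obtain ⟨α, rfl⟩ := hD.exists_ofPattern
    rw [toState_ofPattern]
    simp [stateProj, (patternLoopLink_iff α).2 h]
  · rw [toState_single_of_not hD, map_zero]

theorem tangleState_of_not {D : LinkDiagram (Ends ς) (Fin r)} (h : ¬ NoRightLink D)
    (c : ℂ) : tangleState ς r (Finsupp.single D c) = 0 := by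
  rw [tangleState, LinearMap.comp_apply, toState_single_of_not h, map_zero]

theorem tangleState_ofPattern {α : LinkPattern (Ends ς) r} (h : ¬ PatternLoopLink ς α)
    (c : ℂ) : tangleState ς r (Finsupp.single (ofPattern α) c) = Finsupp.single ⟨α, h⟩ c := by
  rw [tangleState, LinearMap.comp_apply, toState_ofPattern]
  simp [stateProj, h]

@[simp]
theorem tangleState_stateTangle (α : ValState ς r) : tangleState ς r (stateTangle ς r α) = α := by
  induction α using Finsupp.induction_linear with
  | zero => simp
  | add _ _ h1 h2 => simp only [map_add, h1, h2]
  | single D c => rw [stateTangle_single, tangleState_ofPattern D.2]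

theorem map_stateTangle_tangleState {W : Type*} [AddCommGroup W] [Module ℂ W]
    (f : (LinkDiagram (Ends ς) (Fin r) →₀ ℂ) →ₗ[ℂ] W)
    (hf : ∀ D, LeftLoopLink D → f (Finsupp.single D 1) = 0)
    (hf' : ∀ D, ¬ NoRightLink D → f (Finsupp.single D 1) = 0)
    (X : LinkDiagram (Ends ς) (Fin r) →₀ ℂ) : f (stateTangle ς r (tangleState ς r X)) = f X := by
  induction X using Finsupp.induction_linear with
  | zero => simp
  | add _ _ h1 h2 => simp only [map_add, h1, h2]
  | single D c =>
    have hc : f (Finsupp.single D c) = c • f (Finsupp.single D 1) := by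
      rw [← map_smul, Finsupp.smul_single, smul_eq_mul, mul_one]
    by_cases hD : NoRightLink D
    · by_cases hL : LeftLoopLink D
      · rw [tangleState_of_leftLoopLink hL, hc, hf D hL]
        simp
      · obtain ⟨α, rfl⟩ := hD.exists_ofPattern
        rw [tangleState_ofPattern fun h => hL ((patternLoopLink_iff α).1 h), stateTangle_single]
    · rw [tangleState_of_not hD, hc, hf' D hD]
      simp

theorem tangleState_mul_left {D : LinkDiagram (Ends ς) B} (h : LeftLoopLink D)
    (X : LinkDiagram B (Fin r) →₀ ℂ) :
    tangleState ς r (tangleMul ν (Finsupp.single D 1) X) = 0 := by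
  induction X using Finsupp.induction_linear with
  | zero => simp
  | add _ _ h1 h2 => simp only [map_add, h1, h2, add_zero]
  | single E c =>
    obtain ⟨F, n, h1, h2⟩ := exists_colourMatrix_mul D E
    rw [tangleMul_single, h2, map_smul, tangleState_of_leftLoopLink (h.of_mul h1), smul_zero]

theorem tangleState_mul_right {D : LinkDiagram B (Fin r)} (h : ¬ NoRightLink D)
    (X : LinkDiagram (Ends ς) B →₀ ℂ) :
    tangleState ς r (tangleMul ν X (Finsupp.single D 1)) = 0 := by
  induction X using Finsupp.induction_linear with
  | zero => simp
  | add _ _ h1 h2 => simp only [map_add, LinearMap.add_apply, h1, h2, add_zero]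
  | single E c =>
    obtain ⟨F, n, h1, h2⟩ := exists_colourMatrix_mul E D
    rw [tangleMul_single, h2, map_smul,
      tangleState_of_not (not_noRightLink_of_colourMatrix_mul h1 h), smul_zero]

/-! ### The standard modules -/

theorem stdAction_eq (T : ValTangle ς) (α : ValState ς r) :
    stdAction ς ν r T α = tangleState ς r
      (tangleMul ν (tangleMul ν (tangleLift ς T) (compositeProjector ς ν)) (stateTangle ς r α)) := by
  rw [stdAction_apply, tangleState, LinearMap.comp_apply, ← tangleAct_toState, stateTangle,
    LinearMap.comp_apply, toState_ofState]

theorem stdAction_proj (h : HasProjectors ς ν) (S : LinkDiagram (Ends ς) (Ends ς) →₀ ℂ)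
    (α : ValState ς r) : stdAction ς ν r (tangleProj ς S) α = tangleState ς r
      (tangleMul ν (tangleMul ν S (compositeProjector ς ν)) (stateTangle ς r α)) := by
  rw [stdAction_eq]
  refine map_tangleLift_tangleProj ((tangleState ς r).comp
    (((tangleMul ν).flip (stateTangle ς r α)).comp
      ((tangleMul ν).flip (compositeProjector ς ν)))) ?_ ?_ S
  · intro D hD
    simp only [LinearMap.comp_apply, LinearMap.flip_apply]
    rw [tangleMul_assoc, tangleState_mul_left hD]
  · intro D hD
    simp only [LinearMap.comp_apply, LinearMap.flip_apply]
    rw [h.tangleMul_eq_zero_right hD]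
    simp

theorem stdAction_tangleState (h : HasProjectors ς ν) (T : ValTangle ς)
    (X : LinkDiagram (Ends ς) (Fin r) →₀ ℂ) :
    stdAction ς ν r T (tangleState ς r X) = tangleState ς r
      (tangleMul ν (tangleMul ν (tangleLift ς T) (compositeProjector ς ν)) X) := by
  rw [stdAction_eq]
  refine map_stateTangle_tangleState ((tangleState ς r).comp
    (tangleMul ν (tangleMul ν (tangleLift ς T) (compositeProjector ς ν)))) ?_ ?_ X
  · intro D hD
    rw [LinearMap.comp_apply, tangleMul_assoc, h.tangleMul_eq_zero hD]
    simp
  · intro D hD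
    rw [LinearMap.comp_apply, tangleState_mul_right hD]

theorem stdAction_isTLModule (h : HasProjectors ς ν) (r : ℕ) :
    IsTLModule ς ν (stdAction ς ν r) := by
  constructor
  · refine LinearMap.ext fun α => ?_
    rw [valOne, stdAction_proj h, id_tangleMul, Module.End.one_apply]
    refine (h.map_eq ((tangleState ς r).comp ((tangleMul ν).flip (stateTangle ς r α))) ?_).trans ?_
    · intro D hD _
      exact tangleState_mul_left hD _
    · rw [LinearMap.comp_apply, LinearMap.flip_apply, id_tangleMul, tangleState_stateTangle]
  · intro T U
    refine LinearMap.ext fun α => ?_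
    rw [Module.End.mul_apply, stdAction_eq U, stdAction_tangleState h, valMul, stdAction_proj h]
    simp only [tangleMul_assoc]

/-! ### The bilinear form -/

/-- The two projector boxes merge into one, the composite projector being self-adjoint and
idempotent. -/
theorem valForm_eq (h : HasProjectors ς ν) (α β : ValState ς r) :
    valForm ς ν r α β = idCoeff (Fin r) (tangleMul ν (dagger (stateTangle ς r α))
      (tangleMul ν (compositeProjector ς ν) (stateTangle ς r β))) := by
  have hl : ∀ α : ValState ς r, tangleAct ν r (compositeProjector ς ν) (stateLift ς r α) =
      toState r (tangleMul ν (compositeProjector ς ν) (stateTangle ς r α)) := by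
    intro α
    rw [← tangleAct_toState, stateTangle, LinearMap.comp_apply, toState_ofState]
  change linkForm ν r (tangleAct ν r (compositeProjector ς ν) (stateLift ς r α))
    (tangleAct ν r (compositeProjector ς ν) (stateLift ς r β)) = _
  rw [hl, hl, linkForm_toState, dagger_tangleMul, h.dagger_eq, tangleMul_assoc,
    ← tangleMul_assoc ν (compositeProjector ς ν), h.mul_self]

theorem idCoeff_dagger {A : Type} [LinearOrder A] [Fintype A] (T : LinkDiagram A A →₀ ℂ) :
    idCoeff A (dagger T) = idCoeff A T := by
  induction T using Finsupp.induction_linear with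
  | zero => simp
  | add _ _ h1 h2 => simp only [map_add, h1, h2]
  | single D c =>
    have : D.flip = LinkDiagram.id A ↔ D = LinkDiagram.id A :=
      ⟨fun h => by rw [← D.flip_flip, h, LinkDiagram.flip_id],
        fun h => by rw [h, LinkDiagram.flip_id]⟩
    rw [dagger_single, idCoeff_single, idCoeff_single]
    simp only [this]

theorem valForm_comm (h : HasProjectors ς ν) (α β : ValState ς r) :
    valForm ς ν r α β = valForm ς ν r β α := by
  rw [valForm_eq h, valForm_eq h, ← idCoeff_dagger, dagger_tangleMul, dagger_tangleMul,
    dagger_dagger, h.dagger_eq, tangleMul_assoc]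

theorem idCoeff_mul_right {D : LinkDiagram B (Fin r)} (h : ¬ NoRightLink D)
    (X : LinkDiagram (Fin r) B →₀ ℂ) :
    idCoeff (Fin r) (tangleMul ν X (Finsupp.single D 1)) = 0 := by
  induction X using Finsupp.induction_linear with
  | zero => simp
  | add _ _ h1 h2 => simp only [map_add, LinearMap.add_apply, h1, h2, add_zero]
  | single E c =>
    obtain ⟨F, n, h1, h2⟩ := exists_colourMatrix_mul E D
    rw [tangleMul_single, h2, map_smul, idCoeff_single, if_neg, smul_zero]
    rintro rfl
    refine not_noRightLink_of_colourMatrix_mul h1 h fun k l => ?_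
    simp [LinkDiagram.id]

theorem valForm_tangleState (h : HasProjectors ς ν) (α : ValState ς r)
    (X : LinkDiagram (Ends ς) (Fin r) →₀ ℂ) :
    valForm ς ν r α (tangleState ς r X) = idCoeff (Fin r)
      (tangleMul ν (dagger (stateTangle ς r α)) (tangleMul ν (compositeProjector ς ν) X)) := by
  rw [valForm_eq h]
  refine map_stateTangle_tangleState ((idCoeff (Fin r)).comp
    ((tangleMul ν (dagger (stateTangle ς r α))).comp (tangleMul ν (compositeProjector ς ν)))) ?_ ?_ X
  · intro D hD
    simp only [LinearMap.comp_apply]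
    rw [h.tangleMul_eq_zero hD]
    simp
  · intro D hD
    simp only [LinearMap.comp_apply]
    rw [← tangleMul_assoc, idCoeff_mul_right hD]

/-- The action of a tangle is adjoint, for the form, to that of its reflection. -/
theorem stdAction_mem_rad (h : HasProjectors ς ν) (T : ValTangle ς) {α : ValState ς r}
    (hα : α ∈ rad ς ν r) : stdAction ς ν r T α ∈ rad ς ν r := by
  have hα' : ∀ X, idCoeff (Fin r) (tangleMul ν (dagger (stateTangle ς r α))
      (tangleMul ν (compositeProjector ς ν) X)) = 0 := by
    intro X
    rw [← valForm_tangleState h, LinearMap.mem_ker.1 hα]; rfl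
  rw [rad, LinearMap.mem_ker]
  refine LinearMap.ext fun β => ?_
  rw [valForm_comm h, stdAction_eq, valForm_tangleState h, LinearMap.zero_apply, ← idCoeff_dagger]
  rw [← hα' (tangleMul ν (dagger (tangleLift ς T))
    (tangleMul ν (compositeProjector ς ν) (stateTangle ς r β)))]
  simp only [dagger_tangleMul, dagger_dagger, h.dagger_eq, tangleMul_assoc]

/-! ### The cells -/

/-- The valenced tangle formed by joining the defects of two link states. -/
def cell (ν : ℂ) (r : ℕ) (β : ValState ς r) : ValState ς r →ₗ[ℂ] ValTangle ς :=
  (tangleProj ς).comp (((tangleMul ν).flip (dagger (stateTangle ς r β))).comp (stateTangle ς r))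

theorem cell_apply (ν : ℂ) (r : ℕ) (α β : ValState ς r) : cell ν r β α =
    tangleProj ς (tangleMul ν (stateTangle ς r α) (dagger (stateTangle ς r β))) := rfl

/-- The span of the cells with fewer than `r` through-lines. -/
def lowerCells (ς : Fin d → ℕ) (ν : ℂ) (r : ℕ) : Submodule ℂ (ValTangle ς) :=
  Submodule.span ℂ {T | ∃ s < r, ∃ α β : ValState ς s, T = cell ν s β α}

theorem lowerCells_mono {r s : ℕ} (h : r ≤ s) : lowerCells ς ν r ≤ lowerCells ς ν s :=
  Submodule.span_mono fun _ ⟨t, ht, k⟩ => ⟨t, ht.trans_le h, k⟩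

/-- Between α and the result stands the square tangle formed by β reflected, the projector and γ.
Its terms other than the unit have right links and vanish; the unit occurs with coefficient (β | γ).
-/
theorem stdAction_cell (h : HasProjectors ς ν) (α β γ : ValState ς r) :
    stdAction ς ν r (cell ν r β α) γ = valForm ς ν r β γ • α := by
  rw [cell_apply, stdAction_proj h, valForm_eq h, tangleMul_assoc, tangleMul_assoc]
  conv_rhs => rw [← tangleState_stateTangle α, ← tangleMul_id ν (stateTangle ς r α)]
  refine map_eq_idCoeff_smul ((tangleState ς r).comp (tangleMul ν (stateTangle ς r α))) ?_ _
  intro D hD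
  rw [LinearMap.comp_apply, tangleState_mul_right fun k => hD k.eq_id]

/-- With only s < r lines to pass through, some right nodes must be linked together, and the state
is zero. -/
theorem stdAction_cell_of_lt (h : HasProjectors ς ν) {s : ℕ} (hs : s < r) (α β : ValState ς s)
    (γ : ValState ς r) : stdAction ς ν r (cell ν s β α) γ = 0 := by
  rw [cell_apply, stdAction_proj h, tangleMul_assoc, tangleMul_assoc]
  generalize tangleMul ν (dagger (stateTangle ς s β))
    (tangleMul ν (compositeProjector ς ν) (stateTangle ς r γ)) = X
  induction X using Finsupp.induction_linear with
  | zero => simp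
  | add _ _ h1 h2 => simp only [map_add, h1, h2, add_zero]
  | single D c =>
    have : ¬ NoRightLink D := fun k => hs.not_ge k.le
    rw [← mul_one c, ← smul_eq_mul, ← Finsupp.smul_single, map_smul, map_smul,
      tangleState_mul_right this, smul_zero]

/-- A diagram with a link between right nodes factors through fewer nodes. -/
theorem exists_factorization_of_not_noRightLink {A : Type} [LinearOrder A] [Fintype A]
    {D : LinkDiagram A (Fin r)} (h : ¬ NoRightLink D) (ν : ℂ) :
    ∃ s < r, ∃ (X : LinkDiagram A (Fin s) →₀ ℂ) (Y : LinkDiagram (Fin r) (Fin s) →₀ ℂ),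
      Finsupp.single D 1 = tangleMul ν X (dagger Y) := by
  obtain ⟨s, α, β, hD⟩ := exists_factorization D
  have hsr : s ≤ r := (ofPattern_noRightLink β).le
  have hmul := tangleMul_single_eq hD ν
  rw [pow_zero, one_smul] at hmul
  refine ⟨s, lt_of_le_of_ne hsr ?_, Finsupp.single (ofPattern α) 1, Finsupp.single (ofPattern β) 1,
    by rw [dagger_single, hmul]⟩
  -- If s were r, the right half would be the unit and `D` would have no right link.
  rintro rfl
  rw [(ofPattern_noRightLink β).eq_id, LinkDiagram.flip_id, tangleMul_id] at hmul
  apply h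
  rw [← Finsupp.single_left_injective one_ne_zero hmul]
  exact ofPattern_noRightLink α

/-- Replacing `X` and `Y` by the valenced states they represent discards loop links, which vanish on
projection, and right links, which factor through fewer nodes and are covered by strong induction on
r. -/
theorem tangleProj_mul_mem (X Y : LinkDiagram (Ends ς) (Fin r) →₀ ℂ) :
    tangleProj ς (tangleMul ν X (dagger Y)) ∈ lowerCells ς ν (r + 1) := by
  induction r using Nat.strong_induction_on with
  | _ r ih =>
  have hl : ∀ D, ¬ NoRightLink D → ∀ Y : LinkDiagram (Ends ς) (Fin r) →₀ ℂ,
      tangleProj ς (tangleMul ν (Finsupp.single D 1) (dagger Y)) ∈ lowerCells ς ν r := by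
    intro D hD Y
    obtain ⟨s, hs, Z, Z', hZ⟩ := exists_factorization_of_not_noRightLink hD ν
    rw [hZ, tangleMul_assoc, ← dagger_tangleMul]
    exact lowerCells_mono hs (ih s hs _ _)
  have hr : ∀ D, ¬ NoRightLink D → ∀ X : LinkDiagram (Ends ς) (Fin r) →₀ ℂ,
      tangleProj ς (tangleMul ν X (dagger (Finsupp.single D 1))) ∈ lowerCells ς ν r := by
    intro D hD X
    obtain ⟨s, hs, Z, Z', hZ⟩ := exists_factorization_of_not_noRightLink hD ν
    rw [hZ, dagger_tangleMul, dagger_dagger, ← tangleMul_assoc]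
    exact lowerCells_mono hs (ih s hs _ _)
  have h1 : (lowerCells ς ν r).mkQ (tangleProj ς (tangleMul ν
      (stateTangle ς r (tangleState ς r X)) (dagger Y))) =
      (lowerCells ς ν r).mkQ (tangleProj ς (tangleMul ν X (dagger Y))) := by
    refine map_stateTangle_tangleState ((lowerCells ς ν r).mkQ.comp ((tangleProj ς).comp
      ((tangleMul ν).flip (dagger Y)))) ?_ ?_ X
    · intro D hD
      simp only [LinearMap.comp_apply, LinearMap.flip_apply]
      rw [tangleProj_mul_left hD, map_zero]
    · intro D hD
      simp only [LinearMap.comp_apply, LinearMap.flip_apply]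
      rw [Submodule.mkQ_apply, Submodule.Quotient.mk_eq_zero]
      exact hl D hD Y
  have h2 : (lowerCells ς ν r).mkQ (tangleProj ς (tangleMul ν
      (stateTangle ς r (tangleState ς r X)) (dagger (stateTangle ς r (tangleState ς r Y))))) =
      (lowerCells ς ν r).mkQ (tangleProj ς (tangleMul ν
        (stateTangle ς r (tangleState ς r X)) (dagger Y))) := by
    refine map_stateTangle_tangleState ((lowerCells ς ν r).mkQ.comp ((tangleProj ς).comp
      ((tangleMul ν (stateTangle ς r (tangleState ς r X))).comp dagger))) ?_ ?_ Y
    · intro D hD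
      simp only [LinearMap.comp_apply]
      rw [dagger_single, tangleProj_mul_right (by rwa [LinkDiagram.flip_flip]), map_zero]
    · intro D hD
      simp only [LinearMap.comp_apply]
      rw [Submodule.mkQ_apply, Submodule.Quotient.mk_eq_zero]
      exact hr D hD _
  have h3 := h2.trans h1
  rw [Submodule.mkQ_apply, Submodule.mkQ_apply, Submodule.Quotient.eq] at h3
  have h4 : cell ν r (tangleState ς r Y) (tangleState ς r X) ∈ lowerCells ς ν (r + 1) :=
    Submodule.subset_span ⟨r, Nat.lt_succ_self r, _, _, rfl⟩
  have h5 := Submodule.sub_mem _ h4 (lowerCells_mono (Nat.le_succ r) h3)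
  rwa [cell_apply, sub_sub_cancel] at h5

theorem mem_span_cells (T : ValTangle ς) :
    T ∈ Submodule.span ℂ {T | ∃ s, ∃ α β : ValState ς s, T = cell ν s β α} := by
  have hle : ∀ r, lowerCells ς ν r ≤
      Submodule.span ℂ {T | ∃ s, ∃ α β : ValState ς s, T = cell ν s β α} := fun r =>
    Submodule.span_mono fun _ ⟨t, _, k⟩ => ⟨t, k⟩
  induction T using Finsupp.induction_linear with
  | zero => exact Submodule.zero_mem _
  | add _ _ h1 h2 => exact Submodule.add_mem _ h1 h2
  | single D c =>
    obtain ⟨s, α, β, hD⟩ := exists_factorization D.1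
    have hmul := tangleMul_single_eq hD ν
    rw [pow_zero, one_smul, ← dagger_single] at hmul
    have h1 := tangleProj_mul_mem (ν := ν) (Finsupp.single (ofPattern α) 1)
      (Finsupp.single (ofPattern β) 1)
    rw [hmul, tangleProj_single D.2] at h1
    have h2 := Submodule.smul_mem _ c (hle _ h1)
    rwa [Finsupp.smul_single, smul_eq_mul, mul_one] at h2

/-- The action discards the terms of T P α with right links; joined to β reflected, these factor
through fewer than r lines. -/
theorem valMul_cell_sub_mem (h : HasProjectors ς ν) (T : ValTangle ς) (α β : ValState ς r) :
    cell ν r β (stdAction ς ν r T α) - valMul ς ν T (cell ν r β α) ∈ lowerCells ς ν r := by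
  rw [← Submodule.Quotient.eq, ← Submodule.mkQ_apply, ← Submodule.mkQ_apply]
  conv_rhs => rw [cell_apply, valMul_proj_right h, ← tangleMul_assoc]
  rw [cell_apply, stdAction_eq]
  refine map_stateTangle_tangleState ((lowerCells ς ν r).mkQ.comp ((tangleProj ς).comp
    ((tangleMul ν).flip (dagger (stateTangle ς r β))))) ?_ ?_ _
  · intro D hD
    simp only [LinearMap.comp_apply, LinearMap.flip_apply]
    rw [tangleProj_mul_left hD, map_zero]
  · intro D hD
    simp only [LinearMap.comp_apply, LinearMap.flip_apply]
    rw [Submodule.mkQ_apply, Submodule.Quotient.mk_eq_zero]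
    obtain ⟨s, hs, Z, Z', hZ⟩ := exists_factorization_of_not_noRightLink hD ν
    rw [hZ, tangleMul_assoc, ← dagger_tangleMul]
    exact lowerCells_mono hs (tangleProj_mul_mem _ _)

/-! ### The simple modules -/

theorem rad_le_comap_stdAction (h : HasProjectors ς ν) (T : ValTangle ς) :
    rad ς ν r ≤ (rad ς ν r).comap (stdAction ς ν r T) := by
  intro α hα
  rw [Submodule.mem_comap]
  exact stdAction_mem_rad h T hα

/-- The module structure of the quotient of a standard module by its radical. -/
def quotientAction (h : HasProjectors ς ν) (r : ℕ) :
    ValTangle ς →ₗ[ℂ] Module.End ℂ (StdQuotient ς ν r) where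
  toFun T := (rad ς ν r).mapQ (rad ς ν r) (stdAction ς ν r T) (rad_le_comap_stdAction h T)
  map_add' T U := by
    refine LinearMap.ext fun v => ?_
    obtain ⟨α, rfl⟩ := Submodule.Quotient.mk_surjective _ v
    simp only [LinearMap.add_apply, Submodule.mapQ_apply, map_add, Submodule.Quotient.mk_add]
  map_smul' c T := by
    refine LinearMap.ext fun v => ?_
    obtain ⟨α, rfl⟩ := Submodule.Quotient.mk_surjective _ v
    simp only [LinearMap.smul_apply, Submodule.mapQ_apply, map_smul, Submodule.Quotient.mk_smul,
      RingHom.id_apply]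

theorem quotientAction_mk (h : HasProjectors ς ν) (r : ℕ) (T : ValTangle ς) (α : ValState ς r) :
    quotientAction h r T (Submodule.Quotient.mk α) =
      Submodule.Quotient.mk (stdAction ς ν r T α) := rfl

theorem quotientAction_isTLModule (h : HasProjectors ς ν) (r : ℕ) :
    IsTLModule ς ν (quotientAction h r) := by
  obtain ⟨h1, h2⟩ := stdAction_isTLModule h r
  constructor
  · refine LinearMap.ext fun v => ?_
    obtain ⟨α, rfl⟩ := Submodule.Quotient.mk_surjective _ v
    rw [quotientAction_mk, h1]; rfl
  · intro T U
    refine LinearMap.ext fun v => ?_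
    obtain ⟨α, rfl⟩ := Submodule.Quotient.mk_surjective _ v
    rw [quotientAction_mk, h2]; rfl

theorem exists_valForm_ne_zero (h : HasProjectors ς ν) {γ : ValState ς r} (hγ : γ ∉ rad ς ν r) :
    ∃ β, valForm ς ν r β γ ≠ 0 := by
  by_contra hcon
  push Not at hcon
  apply hγ
  rw [rad, LinearMap.mem_ker]
  refine LinearMap.ext fun β => ?_
  rw [valForm_comm h, hcon β]; rfl

/-- A vector γ outside the radical pairs nontrivially with some β, and the cells of (α, β) carry it
to nonzero multiples of every α. -/
theorem quotientAction_isSimpleTL (h : HasProjectors ς ν) (r : ℕ)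
    (hn : Nontrivial (StdQuotient ς ν r)) : IsSimpleTL (quotientAction h r) := by
  refine ⟨hn, fun W hW => ?_⟩
  rw [or_iff_not_imp_left]
  intro hne
  obtain ⟨w, hw, hw0⟩ := (Submodule.ne_bot_iff W).1 hne
  obtain ⟨γ, rfl⟩ := Submodule.Quotient.mk_surjective _ w
  rw [Ne, Submodule.Quotient.mk_eq_zero] at hw0
  obtain ⟨β, hβ⟩ := exists_valForm_ne_zero h hw0
  rw [Submodule.eq_top_iff']
  intro v
  obtain ⟨α, rfl⟩ := Submodule.Quotient.mk_surjective _ v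
  have := hW (cell ν r β α) _ hw
  rw [quotientAction_mk, stdAction_cell h, Submodule.Quotient.mk_smul] at this
  exact (Submodule.smul_mem_iff _ hβ).1 this

/-- If (β | γ) ≠ 0, the cell of (γ, β) scales γ by that number at level s but annihilates level r >
s. -/
theorem not_isoTL_of_lt (h : HasProjectors ς ν) {s : ℕ} (hs : s < r)
    (hn : Nontrivial (StdQuotient ς ν s)) (e : StdQuotient ς ν s ≃ₗ[ℂ] StdQuotient ς ν r)
    (he : ∀ T v, e (quotientAction h s T v) = quotientAction h r T (e v)) : False := by
  obtain ⟨v, hv⟩ := exists_ne (0 : StdQuotient ς ν s)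
  obtain ⟨γ, rfl⟩ := Submodule.Quotient.mk_surjective _ v
  have hγ := hv
  rw [Ne, Submodule.Quotient.mk_eq_zero] at hγ
  obtain ⟨β, hβ⟩ := exists_valForm_ne_zero h hγ
  have h1 := he (cell ν s β γ) (Submodule.Quotient.mk γ)
  obtain ⟨δ, hδ⟩ := Submodule.Quotient.mk_surjective _ (e (Submodule.Quotient.mk γ))
  rw [quotientAction_mk, stdAction_cell h, Submodule.Quotient.mk_smul, map_smul, ← hδ,
    quotientAction_mk, stdAction_cell_of_lt h hs, Submodule.Quotient.mk_zero, hδ] at h1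
  have h2 := (smul_eq_zero.1 h1).resolve_left hβ
  exact hv (e.map_eq_zero_iff.1 h2)

theorem eq_of_isoTL (h : HasProjectors ς ν) {s : ℕ} (hr : Nontrivial (StdQuotient ς ν r))
    (hs : Nontrivial (StdQuotient ς ν s))
    (hiso : IsoTL (quotientAction h r) (quotientAction h s)) : r = s := by
  obtain ⟨e, he⟩ := hiso
  rcases lt_trichotomy r s with hlt | heq | hlt
  · exact (not_isoTL_of_lt h hlt hr e he).elim
  · exact heq
  · refine (not_isoTL_of_lt h hlt hs e.symm fun T v => ?_).elim
    rw [LinearEquiv.symm_apply_eq, he, LinearEquiv.apply_symm_apply]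

theorem exists_isoTL_of_isSimpleTL (h : HasProjectors ς ν) {V : Type*} [AddCommGroup V]
    [Module ℂ V] {σ : ValTangle ς →ₗ[ℂ] Module.End ℂ V} (hσ : IsTLModule ς ν σ)
    (hs : IsSimpleTL σ) :
    ∃ r ∈ defectSet ς, Nontrivial (StdQuotient ς ν r) ∧ IsoTL σ (quotientAction h r) := by
  obtain ⟨hnt, hsimple⟩ := hs
  have hex : ∃ r, ∃ α β : ValState ς r, σ (cell ν r β α) ≠ 0 := by
    by_contra hcon
    push Not at hcon
    have h0 : ∀ T, σ T = 0 := by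
      intro T
      have hT := mem_span_cells (ν := ν) T
      have hle : Submodule.span ℂ {T | ∃ s, ∃ α β : ValState ς s, T = cell ν s β α} ≤
          LinearMap.ker σ := by
        rw [Submodule.span_le]
        rintro _ ⟨s, α, β, rfl⟩
        exact hcon s α β
      exact hle hT
    obtain ⟨v, hv⟩ := exists_ne (0 : V)
    apply hv
    rw [← Module.End.one_apply (R := ℂ) v, ← hσ.1, h0, LinearMap.zero_apply]
  obtain ⟨r, ⟨α₀, β₀, hne⟩, hmin⟩ : ∃ r, (∃ α β : ValState ς r, σ (cell ν r β α) ≠ 0) ∧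
      ∀ s < r, ∀ α β : ValState ς s, σ (cell ν s β α) = 0 := by
    refine ⟨Nat.find hex, Nat.find_spec hex, fun s hs α β => ?_⟩
    have := Nat.find_min hex hs
    push Not at this
    exact this α β
  have hlow : ∀ T ∈ lowerCells ς ν r, σ T = 0 := by
    have hle : lowerCells ς ν r ≤ LinearMap.ker σ := by
      rw [lowerCells, Submodule.span_le]
      rintro _ ⟨s, hs, α, β, rfl⟩
      exact hmin s hs α β
    exact fun T hT => hle hT
  obtain ⟨v₀, hv₀⟩ : ∃ v, σ (cell ν r β₀ α₀) v ≠ 0 := by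
    by_contra hcon
    push Not at hcon
    exact hne (LinearMap.ext hcon)
  -- Lower cells act as zero on V by minimality of r, so the failure of α ↦ cell(α, β₀) to be
  -- equivariant is invisible in V.
  let f : ValState ς r →ₗ[ℂ] V := (LinearMap.applyₗ v₀).comp (σ.comp (cell ν r β₀))
  have hf : ∀ T α, f (stdAction ς ν r T α) = σ T (f α) := by
    intro T α
    have h1 := hlow _ (valMul_cell_sub_mem h T α β₀)
    rw [map_sub, sub_eq_zero, hσ.2] at h1
    change σ (cell ν r β₀ (stdAction ς ν r T α)) v₀ = σ T (σ (cell ν r β₀ α) v₀)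
    rw [h1]; rfl
  have hf0 : f α₀ ≠ 0 := hv₀
  have hrange : LinearMap.range f = ⊤ := by
    refine (hsimple (LinearMap.range f) ?_).resolve_left ?_
    · rintro T _ ⟨α, rfl⟩
      exact ⟨_, hf T α⟩
    · intro k
      rw [LinearMap.range_eq_bot] at k
      exact hf0 (by rw [k]; rfl)
  have hsurj := LinearMap.range_eq_top.1 hrange
  -- For γ in the kernel, applying the cell of (α₀, β) gives (β | γ) f α₀ = 0 for every β.
  have hker : LinearMap.ker f ≤ rad ς ν r := by
    intro γ hγ
    by_contra hγ'
    obtain ⟨β, hβ⟩ := exists_valForm_ne_zero h hγ'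
    have h1 := hf (cell ν r β α₀) γ
    rw [stdAction_cell h, LinearMap.mem_ker.1 hγ, map_zero, map_smul] at h1
    exact hf0 ((smul_eq_zero.1 h1).resolve_left hβ)
  -- If the form vanished, the cell of (α₀, β₀) would annihilate the image of `f`, which is all of
  -- V.
  have hrad : rad ς ν r ≠ ⊤ := by
    intro htop
    have hform : ∀ α β, valForm ς ν r α β = 0 := by
      intro α β
      have : α ∈ rad ς ν r := by rw [htop]; trivial
      rw [LinearMap.mem_ker.1 this]; rfl
    apply hne
    refine LinearMap.ext fun v => ?_
    obtain ⟨γ, rfl⟩ := hsurj v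
    rw [← hf, stdAction_cell h, hform, zero_smul, map_zero, LinearMap.zero_apply]
  -- The image of the radical is a submodule of V. It cannot be V: since the kernel lies in the
  -- radical, the radical would then be everything.
  have hker' : rad ς ν r ≤ LinearMap.ker f := by
    have hmap : (rad ς ν r).map f = ⊥ := by
      refine (hsimple ((rad ς ν r).map f) ?_).resolve_right ?_
      · rintro T _ ⟨α, hα, rfl⟩
        exact ⟨_, stdAction_mem_rad h T hα, hf T α⟩
      · intro htop
        apply hrad
        rw [Submodule.eq_top_iff']
        intro α
        obtain ⟨γ, hγ, hγα⟩ : f α ∈ (rad ς ν r).map f := by rw [htop]; trivial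
        have : α - γ ∈ rad ς ν r := hker (by rw [LinearMap.mem_ker, map_sub, hγα, sub_self])
        have := Submodule.add_mem _ this hγ
        rwa [sub_add_cancel] at this
    exact (LinearMap.le_ker_iff_map).2 hmap
  have hkeq : rad ς ν r = LinearMap.ker f := le_antisymm hker' hker
  have hQ : Nontrivial (StdQuotient ς ν r) := Submodule.Quotient.nontrivial_iff.2 hrad
  refine ⟨r, ?_, hQ, ?_⟩
  · by_contra hempty
    have hE : IsEmpty (ValPattern ς r) := not_nonempty_iff.1 hempty
    exact hf0 (by rw [Subsingleton.elim α₀ 0, map_zero])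
  · let e : StdQuotient ς ν r ≃ₗ[ℂ] V :=
      (Submodule.quotEquivOfEq _ _ hkeq).trans (f.quotKerEquivOfSurjective hsurj)
    have hemk : ∀ α, e (Submodule.Quotient.mk α) = f α := fun α => rfl
    refine ⟨e.symm, fun T v => ?_⟩
    obtain ⟨w, rfl⟩ := e.surjective v
    obtain ⟨α, rfl⟩ := Submodule.Quotient.mk_surjective _ w
    rw [LinearEquiv.symm_apply_eq, LinearEquiv.symm_apply_apply, quotientAction_mk, hemk, hemk, hf]

end Valenced

end ValencedTL

/-! ### The classification of the simple modules. -/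

theorem mainTheorem6 (q : ℂ) (hq : q ≠ 0) (ν : ℂ) (hν : ν = -q - q⁻¹)
    {d : ℕ} (ς : Fin d → ℕ) (hς : ∀ i, (ς i : ℕ∞) < ValencedTL.pbar q) :
    -- `TL_ς(ν)` is an associative unital algebra
    (∀ T U V, ValencedTL.valMul ς ν (ValencedTL.valMul ς ν T U) V =
      ValencedTL.valMul ς ν T (ValencedTL.valMul ς ν U V)) ∧
    (∀ T, ValencedTL.valMul ς ν (ValencedTL.valOne ς) T = T ∧
      ValencedTL.valMul ς ν T (ValencedTL.valOne ς) = T) ∧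
    -- the standard modules are modules
    (∀ r, ValencedTL.IsTLModule ς ν (ValencedTL.stdAction ς ν r)) ∧
    -- `ρ r` is the module structure of the quotient of the `r`-th standard module
    ∃ ρ : ∀ r : ℕ, ValencedTL.ValTangle ς →ₗ[ℂ] Module.End ℂ (ValencedTL.StdQuotient ς ν r),
      (∀ r T α, ρ r T (Submodule.Quotient.mk α) =
        Submodule.Quotient.mk (ValencedTL.stdAction ς ν r T α)) ∧
      (∀ r, ValencedTL.IsTLModule ς ν (ρ r)) ∧
      -- the nonzero quotients are simple
      (∀ r ∈ ValencedTL.defectSet ς, Nontrivial (ValencedTL.StdQuotient ς ν r) →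
        ValencedTL.IsSimpleTL (ρ r)) ∧
      -- they are pairwise non-isomorphic
      (∀ r ∈ ValencedTL.defectSet ς, Nontrivial (ValencedTL.StdQuotient ς ν r) →
        ∀ r' ∈ ValencedTL.defectSet ς, Nontrivial (ValencedTL.StdQuotient ς ν r') →
          ValencedTL.IsoTL (ρ r) (ρ r') → r = r') ∧
      -- every simple module is isomorphic to one of them
      (∀ (V : Type*) [AddCommGroup V] [Module ℂ V]
        (σ : ValencedTL.ValTangle ς →ₗ[ℂ] Module.End ℂ V),
        ValencedTL.IsTLModule ς ν σ → ValencedTL.IsSimpleTL σ →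
          ∃ r ∈ ValencedTL.defectSet ς, Nontrivial (ValencedTL.StdQuotient ς ν r) ∧
            ValencedTL.IsoTL σ (ρ r)) := by
  subst hν
  have h := ValencedTL.hasProjectors ς hq hς
  exact ⟨ValencedTL.valMul_assoc h,
    fun T => ⟨ValencedTL.valOne_valMul h T, ValencedTL.valMul_valOne h T⟩,
    ValencedTL.stdAction_isTLModule h, ValencedTL.quotientAction h,
    ValencedTL.quotientAction_mk h, ValencedTL.quotientAction_isTLModule h,
    fun r _ hr => ValencedTL.quotientAction_isSimpleTL h r hr,
    fun r _ hr s _ hs hiso => ValencedTL.eq_of_isoTL h hr hs hiso,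
    fun V _ _ σ hσ hs => ValencedTL.exists_isoTL_of_isSimpleTL h hσ hs⟩
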